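/- For a bounded Lipschitz domain $\Omega\subset\mathbb{R}^n$ and $\alpha\in\mathbb{R}$, let $\lambda_1(\Omega;\alpha)\le\lambda_2(\Omega;\alpha)\le\cdots$ denote the eigenvalues of the Robin Laplacian on $\Omega$, that is, \[ \lambda_k(\Omega;\alpha)=\min_{U_k}\ \max_{u\in U_k\setminus\{0\}}\ \frac{\int_\Omega|\nabla u|^2\,dx+\alpha\int_{\partial\Omega}u^2\,dS}{\int_\Omega u^2\,dx}, \] where $U_k$ ranges over the $k$-dimensional subspaces of the real Sobolev space $H^1(\Omega)$, boundary values are taken in the sense of traces, and for $n=1$ the measure $dS$ is counting measure on the endpoints. A rectangular box in $\mathbb{R}^n$ is a Cartesian product $\mathcal{B}=(a_1,b_1)\times\cdots\times(a_n,b_n)$ of bounded nonempty open intervals. Theorem. Let $\alpha\in\mathbb{R}$ and $n\ge 2$. For every rectangular box $\mathcal{B}\subset\mathbb{R}^n$ of diameter $D$, the minima defining $\lambda_1$ and $\lambda_2$ of $\mathcal{B}$ and of the interval $(0,D)$ are attained, and \[ \lambda_2(\mathcal{B};\alpha)-\lambda_1(\mathcal{B};\alpha)\;>\;\lambda_2((0,D);\alpha)-\lambda_1((0,D);\alpha).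 \] -/

import Mathlib

open MeasureTheory Set Filter Topology
open scoped ContDiff

noncomputable section

namespace Robin

/-- The Hilbert space `L²(Ω)` of real-valued functions on `Ω ⊆ ℝⁿ`. -/
abbrev L2 {n : ℕ} (Ω : Set (EuclideanSpace ℝ (Fin n))) : Type :=
  Lp ℝ 2 (volume.restrict Ω)

/-- The space `L²(Ω; ℝⁿ)` of square integrable vector fields on `Ω ⊆ ℝⁿ`. -/
abbrev L2Vec {n : ℕ} (Ω : Set (EuclideanSpace ℝ (Fin n))) : Type :=
  Lp (EuclideanSpace ℝ (Fin n)) 2 (volume.restrict Ω)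

/-- The surface measure `dS` on `∂Ω`, for `Ω ⊆ ℝⁿ` with `n ≥ 1`: the `(n-1)`-dimensional Hausdorff
measure, normalized to agree with Lebesgue measure on hyperplanes. For `n = 1` it is the counting
measure on `∂Ω`. -/
def surfaceMeasure {n : ℕ} (Ω : Set (EuclideanSpace ℝ (Fin n))) :
    Measure (EuclideanSpace ℝ (Fin n)) :=
  (Measure.euclideanHausdorffMeasure (n - 1)).restrict (frontier Ω)

/-- The space `L²(∂Ω)`. -/
abbrev L2Boundary {n : ℕ} (Ω : Set (EuclideanSpace ℝ (Fin n))) : Type :=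
  Lp ℝ 2 (surfaceMeasure Ω)

/-- `p` is the weak gradient of `u` in the open set `Ω`: for every `φ ∈ C_c^∞(Ω)` and every `i`,
`∫_Ω u ∂ᵢφ dx = - ∫_Ω pᵢ φ dx`. -/
def HasWeakGradient {n : ℕ} (Ω : Set (EuclideanSpace ℝ (Fin n))) (u : L2 Ω) (p : L2Vec Ω) : Prop :=
  ∀ φ : EuclideanSpace ℝ (Fin n) → ℝ, ContDiff ℝ ∞ φ → HasCompactSupport φ → tsupport φ ⊆ Ω →
    ∀ i : Fin n,
      ∫ x in Ω, u x * fderiv ℝ φ x (EuclideanSpace.single i 1) = - ∫ x in Ω, p x i * φ x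

/-- Membership in the Sobolev space `H¹(Ω)`: `u ∈ L²(Ω)` has a weak gradient in `L²(Ω; ℝⁿ)`. -/
def MemH1 {n : ℕ} (Ω : Set (EuclideanSpace ℝ (Fin n))) (u : L2 Ω) : Prop :=
  ∃ p : L2Vec Ω, HasWeakGradient Ω u p

open Classical in
/-- The weak gradient `∇u` of `u ∈ H¹(Ω)` (it is unique; the value is `0` if `u ∉ H¹(Ω)`). -/
def weakGradient {n : ℕ} (Ω : Set (EuclideanSpace ℝ (Fin n))) (u : L2 Ω) : L2Vec Ω :=
  if h : MemH1 Ω u then h.choose else 0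

/-- `g ∈ L²(∂Ω)` is the boundary trace of `u ∈ H¹(Ω)`: there are smooth functions `φⱼ` on `ℝⁿ` with
`φⱼ → u` in `H¹(Ω)` and `φⱼ → g` in `L²(∂Ω)`. -/
def HasTrace {n : ℕ} (Ω : Set (EuclideanSpace ℝ (Fin n))) (u : L2 Ω) (g : L2Boundary Ω) : Prop :=
  ∃ φ : ℕ → EuclideanSpace ℝ (Fin n) → ℝ,
    (∀ j, ContDiff ℝ ∞ (φ j)) ∧
    Tendsto (fun j => eLpNorm (fun x => φ j x - u x) 2 (volume.restrict Ω)) atTop (𝓝 0) ∧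
    Tendsto (fun j => eLpNorm (fun x => gradient (φ j) x - weakGradient Ω u x) 2
      (volume.restrict Ω)) atTop (𝓝 0) ∧
    Tendsto (fun j => eLpNorm (fun x => φ j x - g x) 2 (surfaceMeasure Ω)) atTop (𝓝 0)

open Classical in
/-- The boundary trace of `u ∈ H¹(Ω)`. On a bounded Lipschitz domain each `u ∈ H¹(Ω)` has exactly
one trace (the value is `0` if there is none). -/
def trace {n : ℕ} (Ω : Set (EuclideanSpace ℝ (Fin n))) (u : L2 Ω) : L2Boundary Ω :=
  if h : ∃ g : L2Boundary Ω, HasTrace Ω u g then h.choose else 0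

/-- The Robin Rayleigh quotient `(∫_Ω |∇u|² dx + α ∫_∂Ω u² dS) / ∫_Ω u² dx`. -/
def rayleigh {n : ℕ} (Ω : Set (EuclideanSpace ℝ (Fin n))) (α : ℝ) (u : L2 Ω) : ℝ :=
  ((∫ x in Ω, ‖weakGradient Ω u x‖ ^ 2) + α * ∫ x, trace Ω u x ^ 2 ∂(surfaceMeasure Ω)) /
    ∫ x in Ω, u x ^ 2

/-- The numbers `max_{u ∈ U \ 0} R(u)`, where `R` is the Robin Rayleigh quotient and `U` ranges over
the `k`-dimensional subspaces of `H¹(Ω)`, for `k ≥ 1`. -/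
def minimaxValues {n : ℕ} (Ω : Set (EuclideanSpace ℝ (Fin n))) (α : ℝ) (k : ℕ) : Set ℝ :=
  {m | ∃ U : Submodule ℝ (L2 Ω), (∀ u ∈ U, MemH1 Ω u) ∧ Module.finrank ℝ U = k ∧
    IsGreatest (rayleigh Ω α '' {u | u ∈ U ∧ u ≠ 0}) m}

/-- The `k`-th Robin eigenvalue `λ_k(Ω; α)`, `k = 1, 2, …`, counted with multiplicity, on a bounded
Lipschitz domain `Ω`, given by the minimax formula
`λ_k(Ω; α) = min_U max_{u ∈ U \ 0} R(u)`. -/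
def robinEigenvalue {n : ℕ} (Ω : Set (EuclideanSpace ℝ (Fin n))) (α : ℝ) (k : ℕ) : ℝ :=
  sInf (minimaxValues Ω α k)

/-- The rectangular box `(a₁, b₁) × ⋯ × (aₙ, bₙ)` in `ℝⁿ` with its Euclidean metric. -/
def openBox {n : ℕ} (a b : Fin n → ℝ) : Set (EuclideanSpace ℝ (Fin n)) :=
  {x | ∀ i, x i ∈ Ioo (a i) (b i)}

/-- The interval `(0, D)`, as a domain in `ℝ¹`. -/
def lineSegment (D : ℝ) : Set (EuclideanSpace ℝ (Fin 1)) :=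
  openBox (fun _ => 0) (fun _ => D)

end Robin

end

/-! The gap of a box is the smallest of the gaps of its edges (`box_spectrum`), and the gap of an
interval strictly decreases with its length (`IsRobinPair.gap_lt`). For n ≥ 2 every edge is shorter
than the diameter (`edge_lt_diam`), so the edge that realises the gap of the box beats the interval
(0, D).

Box: let φᵢ > 0 be the ground state of the i-th edge, with eigenvalue μ₁ᵢ, and qᵢ = φᵢ'/φᵢ. The
field with components −qᵢ(xᵢ) has outer normal component α on the boundary (Robin condition), and
−qᵢ' = μ₁ᵢ + qᵢ² (Riccati equation). The divergence theorem therefore rewrites the Robin energy of u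
as (∑ μ₁ᵢ)‖u‖² plus the excess ∑ ∫ (∂ᵢu − qᵢu)² (`energy_eq`). The excess is nonnegative and
vanishes on ∏ φᵢ, so λ₁ = ∑ μ₁ᵢ. For u orthogonal to ∏ φᵢ the excess is at least the smallest edge
gap times ‖u‖² (`poincare_box`): this combines the one-dimensional inequality `IsRobinPair.poincare`
with an Efron-Stein argument (`tensorization`). Exciting the edge of smallest gap gives equality,
which determines λ₂.

These identities are obtained for smooth functions and carried over to H¹ by density
(`exists_smooth_approx`). Density holds because a graph element orthogonal to all smooth graphs is
orthogonal to every Neumann cosine mode, and these modes are complete. The boundary identity with α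
replaced by 1 then also produces traces (`exists_hasTrace`).

Interval of half-length L: for α ≤ 0, Wronskian comparisons show that the first eigenvalue does not
decrease with L while the second strictly decreases. For α > 0 the gap is split at the level
(π/(2L))², and the characteristic equations show that both pieces decrease, the lower one strictly.
-/

noncomputable section

namespace Robin

/-! ### Existence of the first two Robin eigenfunctions of an interval -/

/-- `φ` and `χ` are the even ground state and the odd first excited state of the Robin Laplacian on
the interval `(-L, L)`, with eigenvalues `μ₁` and `μ₂`. -/
structure IsRobinPair (α L μ₁ μ₂ : ℝ) (φ χ : ℝ → ℝ) : Prop where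
  pos : 0 < L
  φ_smooth : ContDiff ℝ ∞ φ
  χ_smooth : ContDiff ℝ ∞ χ
  φ_eq : ∀ t, HasDerivAt (deriv φ) (-μ₁ * φ t) t
  χ_eq : ∀ t, HasDerivAt (deriv χ) (-μ₂ * χ t) t
  φ_pos : ∀ t ∈ Icc (-L) L, 0 < φ t
  χ_pos : ∀ t ∈ Ioc 0 L, 0 < χ t
  φ_even : ∀ t, φ (-t) = φ t
  χ_odd : ∀ t, χ (-t) = -χ t
  φ_bdry : deriv φ L = -α * φ L
  χ_bdry : deriv χ L = -α * χ L
  χ_deriv : 0 < deriv χ 0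
  -- For α ≤ 0 the gap comparison only needs the sign of the first eigenvalue; for α > 0 it needs
  -- the explicit frequencies. Writing the excited frequency as π/2 + z turns −cot into tan, so both
  -- characteristic equations take the form (c + x) tan x = αL, with c = 0 or c = π/2.
  low : α ≤ 0 → μ₁ ≤ 0
  high : 0 < α → ∃ x z, x ∈ Ioo 0 (Real.pi / 2) ∧ z ∈ Ioo 0 (Real.pi / 2) ∧
    μ₁ = (x / L) ^ 2 ∧ μ₂ = ((Real.pi / 2 + z) / L) ^ 2 ∧
    x * Real.sin x = α * L * Real.cos x ∧ (Real.pi / 2 + z) * Real.sin z = α * L * Real.cos z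

lemma deriv_cos_mul (k : ℝ) : deriv (fun t => Real.cos (k * t)) = fun t => -k * Real.sin (k * t) := by
  funext t
  have := ((hasDerivAt_id t).const_mul k).cos
  simp only [id, mul_one] at this
  rw [this.deriv]; ring

lemma deriv_sin_mul (k : ℝ) : deriv (fun t => Real.sin (k * t)) = fun t => k * Real.cos (k * t) := by
  funext t
  have := ((hasDerivAt_id t).const_mul k).sin
  simp only [id, mul_one] at this
  rw [this.deriv]; ring

lemma deriv_cosh_mul (k : ℝ) :
    deriv (fun t => Real.cosh (k * t)) = fun t => k * Real.sinh (k * t) := by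
  funext t
  have := ((hasDerivAt_id t).const_mul k).cosh
  simp only [id, mul_one] at this
  rw [this.deriv]; ring

lemma deriv_sinh_mul (k : ℝ) :
    deriv (fun t => Real.sinh (k * t)) = fun t => k * Real.cosh (k * t) := by
  funext t
  have := ((hasDerivAt_id t).const_mul k).sinh
  simp only [id, mul_one] at this
  rw [this.deriv]; ring

/-- A triple `(μ, φ)` satisfying the conditions on the even ground state. -/
def IsGround (α L μ : ℝ) (φ : ℝ → ℝ) : Prop :=
  ContDiff ℝ ∞ φ ∧ (∀ t, HasDerivAt (deriv φ) (-μ * φ t) t) ∧ (∀ t ∈ Icc (-L) L, 0 < φ t) ∧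
    (∀ t, φ (-t) = φ t) ∧ deriv φ L = -α * φ L

/-- The conditions on the odd excited state. -/
def IsExcited (α L μ : ℝ) (χ : ℝ → ℝ) : Prop :=
  ContDiff ℝ ∞ χ ∧ (∀ t, HasDerivAt (deriv χ) (-μ * χ t) t) ∧ (∀ t ∈ Ioc 0 L, 0 < χ t) ∧
    (∀ t, χ (-t) = -χ t) ∧ deriv χ L = -α * χ L ∧ 0 < deriv χ 0

lemma isGround_cos {α L x : ℝ} (hL : 0 < L) (hx : x ∈ Ico 0 (Real.pi / 2))
    (h : x * Real.sin x = α * L * Real.cos x) :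
    IsGround α L ((x / L) ^ 2) (fun t => Real.cos (x / L * t)) := by
  refine ⟨by fun_prop, fun t => ?_, fun t ht => ?_, fun t => by simp, ?_⟩
  · rw [deriv_cos_mul]
    have := (((hasDerivAt_id t).const_mul (x / L)).sin).const_mul (-(x / L))
    simp only [id, mul_one] at this
    exact this.congr_deriv (by ring)
  · have h1 : |x / L * t| ≤ x := by
      rw [abs_mul, abs_of_nonneg (div_nonneg hx.1 hL.le), div_mul_eq_mul_div, div_le_iff₀ hL]
      exact mul_le_mul_of_nonneg_left (abs_le.2 ht) hx.1
    have := abs_le.1 h1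
    exact Real.cos_pos_of_mem_Ioo ⟨by linarith [hx.2], by linarith [hx.2]⟩
  · rw [deriv_cos_mul]
    simp only
    rw [div_mul_cancel₀ _ hL.ne']
    field_simp
    linarith

lemma isExcited_sin {α L y : ℝ} (hL : 0 < L) (hy : y ∈ Ioo 0 Real.pi)
    (h : y * Real.cos y = -(α * L * Real.sin y)) :
    IsExcited α L ((y / L) ^ 2) (fun t => Real.sin (y / L * t)) := by
  refine ⟨by fun_prop, fun t => ?_, fun t ht => ?_, fun t => by simp, ?_, ?_⟩
  · rw [deriv_sin_mul]
    have := (((hasDerivAt_id t).const_mul (y / L)).cos).const_mul (y / L)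
    simp only [id, mul_one] at this
    exact this.congr_deriv (by ring)
  · have : y / L * t ≤ y := by
      rw [div_mul_eq_mul_div, div_le_iff₀ hL]
      exact mul_le_mul_of_nonneg_left ht.2 hy.1.le
    exact Real.sin_pos_of_pos_of_lt_pi (mul_pos (div_pos hy.1 hL) ht.1) (by linarith [hy.2])
  · rw [deriv_sin_mul]
    simp only
    rw [div_mul_cancel₀ _ hL.ne']
    field_simp
    linarith
  · rw [deriv_sin_mul]
    simpa using div_pos hy.1 hL

lemma isGround_cosh {α L x : ℝ} (hL : 0 < L)
    (h : x * Real.sinh x = -(α * L * Real.cosh x)) :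
    IsGround α L (-(x / L) ^ 2) (fun t => Real.cosh (x / L * t)) := by
  refine ⟨by fun_prop, fun t => ?_, fun t ht => Real.cosh_pos _, fun t => by simp, ?_⟩
  · rw [deriv_cosh_mul]
    have := (((hasDerivAt_id t).const_mul (x / L)).sinh).const_mul (x / L)
    simp only [id, mul_one] at this
    exact this.congr_deriv (by ring)
  · rw [deriv_cosh_mul]
    simp only
    rw [div_mul_cancel₀ _ hL.ne']
    field_simp
    linarith

lemma isExcited_sinh {α L y : ℝ} (hL : 0 < L) (hy : 0 < y)
    (h : y * Real.cosh y = -(α * L * Real.sinh y)) :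
    IsExcited α L (-(y / L) ^ 2) (fun t => Real.sinh (y / L * t)) := by
  refine ⟨by fun_prop, fun t => ?_, fun t ht => ?_, fun t => by simp, ?_, ?_⟩
  · rw [deriv_sinh_mul]
    have := (((hasDerivAt_id t).const_mul (y / L)).cosh).const_mul (y / L)
    simp only [id, mul_one] at this
    exact this.congr_deriv (by ring)
  · exact Real.sinh_pos_iff.2 (mul_pos (div_pos hy hL) ht.1)
  · rw [deriv_sinh_mul]
    simp only
    rw [div_mul_cancel₀ _ hL.ne']
    field_simp
    linarith
  · rw [deriv_sinh_mul]
    simpa using div_pos hy hL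

lemma isExcited_id {α L : ℝ} (h : α * L = -1) : IsExcited α L 0 (fun t => t) := by
  have hd : deriv (fun t : ℝ => t) = fun _ => 1 := by funext t; simp
  refine ⟨contDiff_id, fun t => ?_, fun t ht => ht.1, fun t => rfl, ?_, ?_⟩
  · rw [hd]; simpa using hasDerivAt_const t (1 : ℝ)
  · rw [hd]; simp only; linarith
  · rw [hd]; norm_num

lemma exists_ground {α L : ℝ} (hL : 0 < L) : ∃ μ φ, IsGround α L μ φ ∧ (α ≤ 0 → μ ≤ 0) ∧
    (0 < α → ∃ x ∈ Ioo 0 (Real.pi / 2), μ = (x / L) ^ 2 ∧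
      x * Real.sin x = α * L * Real.cos x) := by
  have hpi := Real.pi_pos
  rcases le_or_gt 0 α with hα | hα
  · obtain ⟨x, hx, hx0⟩ : ∃ x ∈ Icc 0 (Real.pi / 2),
        x * Real.sin x - α * L * Real.cos x = 0 := by
      refine intermediate_value_Icc (by positivity) (by fun_prop) ⟨?_, ?_⟩
      · simp; positivity
      · simp; positivity
    have hx2 : x ≠ Real.pi / 2 := by
      rintro rfl; simp at hx0
    have hx0' : x * Real.sin x = α * L * Real.cos x := by linarith
    refine ⟨_, _, isGround_cos hL ⟨hx.1, lt_of_le_of_ne hx.2 hx2⟩ hx0', fun h => ?_, fun h => ?_⟩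
    · obtain rfl : α = 0 := le_antisymm h hα
      rcases hx.1.eq_or_lt with h0 | h0
      · simp [← h0]
      · have := mul_pos h0 (Real.sin_pos_of_pos_of_lt_pi h0 (by linarith [hx.2]))
        simp at hx0'
        rcases hx0' with h | h
        · exact absurd h h0.ne'
        · rw [h] at this; simp at this
    · refine ⟨x, ⟨lt_of_le_of_ne hx.1 ?_, lt_of_le_of_ne hx.2 hx2⟩, rfl, hx0'⟩
      rintro rfl
      have := mul_pos h hL
      simp at hx0; rcases hx0 with h1 | h1 <;> linarith
  -- The right endpoint y satisfies −αL = (y − 1)/2 and y ≥ 1, so cosh y ≤ 2 sinh y gives −αL cosh y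
  -- ≤ (y − 1) sinh y ≤ y sinh y, the sign needed for the intermediate value theorem.
  · obtain ⟨x, hx, hx0⟩ : ∃ x ∈ Icc 0 (1 + -2 * (α * L)),
        x * Real.sinh x + α * L * Real.cosh x = 0 := by
      have haL : α * L < 0 := mul_neg_of_neg_of_pos hα hL
      refine intermediate_value_Icc (by linarith) (by fun_prop) ⟨?_, ?_⟩
      · simp; linarith
      · set y := 1 + -2 * (α * L)
        have hy : 1 ≤ y := by simp only [y]; linarith
        have h1 : Real.cosh y ≤ 2 * Real.sinh y := by
          rw [Real.cosh_eq, Real.sinh_eq]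
          have h2 : y + 1 ≤ Real.exp y := Real.add_one_le_exp y
          have h3 : Real.exp (-y) * Real.exp y = 1 := by rw [← Real.exp_add]; simp
          have h4 := Real.exp_pos (-y)
          have : Real.exp (-y) ≤ 1 / 2 := by nlinarith
          linarith
        have h2 : 0 ≤ Real.sinh y := Real.sinh_nonneg_iff.2 (by linarith)
        have h3 : α * L = (1 - y) / 2 := by simp only [y]; ring
        rw [h3]
        have := mul_le_mul_of_nonneg_left h1 (show 0 ≤ (y - 1) / 2 by linarith)
        linarith
    have h1 : x * Real.sinh x = -(α * L * Real.cosh x) := by linarith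
    exact ⟨_, _, isGround_cosh hL h1, fun _ => by simpa using sq_nonneg (x / L),
      fun h => absurd h (by linarith)⟩

/-- The excited eigenvalue changes sign at αL = −1, which gives the three shapes sinh, identity and
sin. The case α > 0 is treated apart in order to place the frequency in (π/2, π). -/
lemma exists_excited {α L : ℝ} (hL : 0 < L) : ∃ μ χ, IsExcited α L μ χ ∧
    (0 < α → ∃ z ∈ Ioo 0 (Real.pi / 2), μ = ((Real.pi / 2 + z) / L) ^ 2 ∧
      (Real.pi / 2 + z) * Real.sin z = α * L * Real.cos z) := by
  have hpi := Real.pi_pos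
  rcases lt_or_ge 0 α with hα | hα
  · have haL : 0 < α * L := mul_pos hα hL
    obtain ⟨z, hz, hz0⟩ : ∃ z ∈ Icc 0 (Real.pi / 2),
        (Real.pi / 2 + z) * Real.sin z - α * L * Real.cos z = 0 := by
      refine intermediate_value_Icc (by positivity) (by fun_prop) ⟨?_, ?_⟩
      · simp; positivity
      · simp only [Real.sin_pi_div_two, Real.cos_pi_div_two]; linarith
    have hz1 : z ≠ 0 := by
      rintro rfl; simp at hz0; rcases hz0 with h | h
      · exact hα.ne' h
      · exact hL.ne' h
    have hz2 : z ≠ Real.pi / 2 := by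
      rintro rfl; simp at hz0
    have hz' : z ∈ Ioo 0 (Real.pi / 2) := ⟨lt_of_le_of_ne hz.1 hz1.symm, lt_of_le_of_ne hz.2 hz2⟩
    refine ⟨_, _, isExcited_sin (y := Real.pi / 2 + z) hL
      ⟨by linarith [hz'.1], by linarith [hz'.2]⟩ ?_, fun _ => ⟨z, hz', rfl, by linarith⟩⟩
    rw [add_comm, Real.cos_add_pi_div_two, Real.sin_add_pi_div_two]
    linarith
  have hno : ¬ 0 < α := not_lt.2 hα
  rcases lt_trichotomy (α * L) (-1) with h | h | h
  -- y = 0 is always a root and has to be avoided. Starting at ε makes the left value negative,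
  -- since sinh ε ≥ ε bounds it by ε (cosh ε + αL).
  · obtain ⟨ε, hε, hεlt⟩ : ∃ ε > 0, Real.cosh ε < -(α * L) := by
      have : ∀ᶠ t in 𝓝[>] (0 : ℝ), Real.cosh t < -(α * L) := by
        refine (Real.continuous_cosh.tendsto 0).eventually_lt_const ?_ |>.filter_mono
          nhdsWithin_le_nhds
        simp; linarith
      obtain ⟨t, ht, ht'⟩ := (this.and self_mem_nhdsWithin).exists
      exact ⟨t, ht', ht⟩
    have hM : ε ≤ max ε (-(α * L)) := le_max_left _ _
    obtain ⟨y, hy, hy0⟩ : ∃ y ∈ Icc ε (max ε (-(α * L))),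
        y * Real.cosh y + α * L * Real.sinh y = 0 := by
      refine intermediate_value_Icc hM (by fun_prop) ⟨?_, ?_⟩
      · have h1 : ε ≤ Real.sinh ε := Real.self_le_sinh_iff.2 hε.le
        nlinarith [Real.cosh_pos ε]
      · set y := max ε (-(α * L))
        have h1 : -(α * L) ≤ y := le_max_right _ _
        have h2 := Real.sinh_lt_cosh y
        have h3 : 0 ≤ Real.sinh y := Real.sinh_nonneg_iff.2 (by linarith)
        nlinarith
    exact ⟨_, _, isExcited_sinh hL (lt_of_lt_of_le hε hy.1) (by linarith), fun h => absurd h hno⟩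
  · exact ⟨_, _, isExcited_id h, fun h => absurd h hno⟩
  -- Dividing the characteristic equation by y removes the trivial root at 0; the quotient
  -- `Real.sinc` is 1 there, so the left value is −(1 + αL) < 0.
  · obtain ⟨y, hy, hy0⟩ : ∃ y ∈ Icc 0 Real.pi,
        -(Real.cos y + α * L * Real.sinc y) = 0 := by
      refine intermediate_value_Icc hpi.le
        ((by have := Real.continuous_sinc; fun_prop : Continuous _).continuousOn) ⟨?_, ?_⟩
      · simp; linarith
      · simp [Real.sinc_of_ne_zero hpi.ne']
    have h0 : y ≠ 0 := by
      rintro rfl; simp at hy0; linarith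
    have h1 : y ≠ Real.pi := by
      rintro rfl; simp [Real.sinc_of_ne_zero hpi.ne'] at hy0
    refine ⟨_, _, isExcited_sin (y := y) hL
      ⟨lt_of_le_of_ne hy.1 h0.symm, lt_of_le_of_ne hy.2 h1⟩ ?_, fun h => absurd h hno⟩
    rw [Real.sinc_of_ne_zero h0] at hy0
    field_simp at hy0
    linarith

lemma exists_robinPair (α : ℝ) {L : ℝ} (hL : 0 < L) :
    ∃ μ₁ μ₂ φ χ, IsRobinPair α L μ₁ μ₂ φ χ := by
  obtain ⟨μ₁, φ, ⟨a1, a2, a3, a4, a5⟩, a6, a7⟩ := exists_ground (α := α) hL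
  obtain ⟨μ₂, χ, ⟨b1, b2, b3, b4, b5, b6⟩, b7⟩ := exists_excited (α := α) hL
  refine ⟨μ₁, μ₂, φ, χ, hL, a1, b1, a2, b2, a3, b3, a4, b4, a5, b5, b6, a6, fun h => ?_⟩
  obtain ⟨x, hx, hx1, hx2⟩ := a7 h
  obtain ⟨z, hz, hz1, hz2⟩ := b7 h
  exact ⟨x, z, hx, hz, hx1, hz1, hx2, hz2⟩

/-! ### Strict decrease of the interval gap with the length -/

/-- The derivative of the Wronskian of two solutions, one of them shifted. -/
lemma hasDerivAt_wronskian {u v : ℝ → ℝ} {μ ν : ℝ} (hu : Differentiable ℝ u)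
    (hv : Differentiable ℝ v) (hu' : ∀ t, HasDerivAt (deriv u) (-μ * u t) t)
    (hv' : ∀ t, HasDerivAt (deriv v) (-ν * v t) t) (δ t : ℝ) :
    HasDerivAt (fun x => deriv u x * v (x + δ) - u x * deriv v (x + δ))
      ((ν - μ) * (u t * v (t + δ))) t := by
  have h1 := (hu t).hasDerivAt
  have h2 := ((hv (t + δ)).hasDerivAt).comp_add_const t δ
  have h3 := (hv' (t + δ)).comp_add_const t δ
  exact (((hu' t).mul h2).sub (h1.mul h3)).congr_deriv (by ring)

namespace IsRobinPair

variable {α L L' μ₁ μ₂ ν₁ ν₂ : ℝ} {φ χ φ' χ' : ℝ → ℝ}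

/-- Shifting by L' − L aligns the right endpoints, where both functions satisfy the same Robin
condition and the Wronskian vanishes. If ν₂ ≥ μ₂ it would be nondecreasing on [0, L], yet at 0 it
equals χ'(0) times a positive value of the other excited state. -/
lemma second_lt (h : IsRobinPair α L μ₁ μ₂ φ χ) (h' : IsRobinPair α L' ν₁ ν₂ φ' χ')
    (hL : L < L') : ν₂ < μ₂ := by
  by_contra! hle
  have hd := hasDerivAt_wronskian (h.χ_smooth.differentiable (by simp))
    (h'.χ_smooth.differentiable (by simp)) h.χ_eq h'.χ_eq (L' - L)
  have hmono : MonotoneOn (fun x => deriv χ x * χ' (x + (L' - L)) -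
      χ x * deriv χ' (x + (L' - L))) (Icc 0 L) := by
    refine monotoneOn_of_deriv_nonneg (convex_Icc _ _)
      (fun x _ => (hd x).continuousAt.continuousWithinAt)
      (fun x _ => (hd x).differentiableAt.differentiableWithinAt) fun x hx => ?_
    rw [interior_Icc] at hx
    rw [(hd x).deriv]
    have h1 := h.χ_pos x ⟨hx.1, hx.2.le⟩
    have h2 := h'.χ_pos (x + (L' - L)) ⟨by linarith [hx.1], by linarith [hx.2]⟩
    exact mul_nonneg (by linarith) (mul_pos h1 h2).le
  have := hmono ⟨le_rfl, h.pos.le⟩ ⟨h.pos.le, le_rfl⟩ h.pos.le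
  have hχ0 : χ 0 = 0 := by have := h.χ_odd 0; simp at this; linarith
  have h2 := mul_pos h.χ_deriv (h'.χ_pos (L' - L) ⟨by linarith, by linarith [h.pos]⟩)
  simp only [zero_add, hχ0, zero_mul, sub_zero, add_sub_cancel, h.χ_bdry, h'.χ_bdry] at this
  nlinarith

lemma deriv_ground_zero (h : IsRobinPair α L μ₁ μ₂ φ χ) : deriv φ 0 = 0 := by
  have h1 : (fun t => φ (-t)) = φ := funext h.φ_even
  have h2 := deriv_comp_neg φ 0
  rw [h1] at h2
  simp at h2; linarith

/-- Again the Wronskian of the aligned states vanishes at the right end; if ν₁ < μ₁ it strictly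
decreases, hence is positive at 0. But α ≤ 0 gives ν₁ ≤ 0, so the longer ground state is convex and
even, its slope at L' − L is nonnegative, and the Wronskian at 0 is at most 0. -/
lemma first_le (h : IsRobinPair α L μ₁ μ₂ φ χ) (h' : IsRobinPair α L' ν₁ ν₂ φ' χ')
    (hL : L < L') (hα : α ≤ 0) : μ₁ ≤ ν₁ := by
  by_contra! hlt
  have hpos' : ∀ t ∈ Icc 0 L', 0 < φ' t := fun t ht => h'.φ_pos t ⟨by linarith [ht.1, h'.pos], ht.2⟩
  have hmono : MonotoneOn (deriv φ') (Icc 0 L') := by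
    refine monotoneOn_of_deriv_nonneg (convex_Icc _ _)
      (fun x _ => (h'.φ_eq x).continuousAt.continuousWithinAt)
      (fun x _ => (h'.φ_eq x).differentiableAt.differentiableWithinAt) fun x hx => ?_
    rw [interior_Icc] at hx
    rw [(h'.φ_eq x).deriv]
    exact mul_nonneg (by linarith [h'.low hα]) (hpos' x ⟨hx.1.le, hx.2.le⟩).le
  have hd := hasDerivAt_wronskian (h.φ_smooth.differentiable (by simp))
    (h'.φ_smooth.differentiable (by simp)) h.φ_eq h'.φ_eq (L' - L)
  have hanti : StrictAntiOn (fun x => deriv φ x * φ' (x + (L' - L)) -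
      φ x * deriv φ' (x + (L' - L))) (Icc 0 L) := by
    refine strictAntiOn_of_deriv_neg (convex_Icc _ _)
      (fun x _ => (hd x).continuousAt.continuousWithinAt) fun x hx => ?_
    rw [interior_Icc] at hx
    rw [(hd x).deriv]
    have h1 := h.φ_pos x ⟨by linarith [hx.1, h.pos], hx.2.le⟩
    have h2 := hpos' (x + (L' - L)) ⟨by linarith [hx.1], by linarith [hx.2]⟩
    exact mul_neg_of_neg_of_pos (by linarith) (mul_pos h1 h2)
  have := hanti ⟨le_rfl, h.pos.le⟩ ⟨h.pos.le, le_rfl⟩ h.pos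
  have h1 := h.φ_pos 0 ⟨by linarith [h.pos], h.pos.le⟩
  have h2 := hmono (a := 0) (b := L' - L) ⟨le_rfl, h'.pos.le⟩ ⟨by linarith, by linarith [h.pos]⟩
    (by linarith)
  rw [h'.deriv_ground_zero] at h2
  simp only [zero_add, h.deriv_ground_zero, zero_mul, add_sub_cancel, h.φ_bdry, h'.φ_bdry] at this
  nlinarith

end IsRobinPair

lemma antitoneOn_mul_cot :
    AntitoneOn (fun z => z * Real.cos z / Real.sin z) (Ioo 0 (Real.pi / 2)) := by
  have hs : ∀ z ∈ Ioo 0 (Real.pi / 2), 0 < Real.sin z := fun z hz =>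
    Real.sin_pos_of_pos_of_lt_pi hz.1 (by linarith [hz.2, Real.pi_pos])
  have hd : ∀ z ∈ Ioo 0 (Real.pi / 2), HasDerivAt (fun z => z * Real.cos z / Real.sin z)
      (((1 * Real.cos z + z * -Real.sin z) * Real.sin z - z * Real.cos z * Real.cos z) /
        Real.sin z ^ 2) z := fun z hz =>
    ((hasDerivAt_id z).mul (Real.hasDerivAt_cos z)).div (Real.hasDerivAt_sin z) (hs z hz).ne'
  refine antitoneOn_of_deriv_nonpos (convex_Ioo _ _)
    (fun x hx => (hd x hx).continuousAt.continuousWithinAt)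
    (fun x hx => (hd x (by simpa using hx)).differentiableAt.differentiableWithinAt) fun x hx => ?_
  rw [interior_Ioo] at hx
  rw [(hd x hx).deriv]
  refine div_nonpos_of_nonpos_of_nonneg ?_ (sq_nonneg _)
  have h1 := Real.sin_lt hx.1
  have h2 := Real.cos_le_one x
  have h3 := Real.sin_sq_add_cos_sq x
  -- The numerator of the derivative of z cot z reduces to sin z cos z − z.
  have : Real.cos x * Real.sin x ≤ x := by nlinarith [hs x hx]
  have e : (1 * Real.cos x + x * -Real.sin x) * Real.sin x - x * Real.cos x * Real.cos x =
      Real.cos x * Real.sin x - x * (Real.sin x ^ 2 + Real.cos x ^ 2) := by ring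
  rw [e, h3]
  linarith

/-- (c + x) tan x is strictly increasing on (0, π/2). It serves the ground state with c = 0 and the
excited state with c = π/2. -/
lemma mul_sin_lt_imp {c a a' x x' : ℝ} (hc : 0 ≤ c) (ha : 0 < a) (haa : a < a')
    (hx : x ∈ Ioo 0 (Real.pi / 2)) (hx' : x' ∈ Ioo 0 (Real.pi / 2))
    (h : (c + x) * Real.sin x = a * Real.cos x)
    (h' : (c + x') * Real.sin x' = a' * Real.cos x') : x < x' := by
  by_contra! hle
  have h1 : Real.sin x' ≤ Real.sin x :=
    Real.sin_le_sin_of_le_of_le_pi_div_two (by linarith [hx'.1, Real.pi_pos]) hx.2.le hle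
  have h2 : Real.cos x ≤ Real.cos x' :=
    Real.cos_le_cos_of_nonneg_of_le_pi hx'.1.le (by linarith [hx.2, Real.pi_pos]) hle
  have h3 : 0 < Real.cos x' :=
    Real.cos_pos_of_mem_Ioo ⟨by linarith [hx'.1, Real.pi_pos], hx'.2⟩
  have h4 : 0 < Real.sin x' := Real.sin_pos_of_pos_of_lt_pi hx'.1 (by linarith [hx'.2, Real.pi_pos])
  have h5 : (c + x') * Real.sin x' ≤ (c + x) * Real.sin x :=
    mul_le_mul (by linarith) h1 h4.le (by linarith [hx.1])
  nlinarith

/-- z (π + z) = (π/2 + z)² − (π/2)² is the part of the excited eigenvalue above (π/2)², before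
scaling. Since z grows with L, the monotonicity is not visible directly. The characteristic equation
trades one factor 1/L for α cot z / (π/2 + z), which leaves α times z cot z, 1 + (π/2)/(π/2 + z) and
1/L, none of which increases. -/
lemma excited_term_le {α L L' z z' : ℝ} (hα : 0 < α) (hL : 0 < L) (hLL : L < L')
    (hz : z ∈ Ioo 0 (Real.pi / 2)) (hz' : z' ∈ Ioo 0 (Real.pi / 2)) (hzz : z < z')
    (h : (Real.pi / 2 + z) * Real.sin z = α * L * Real.cos z)
    (h' : (Real.pi / 2 + z') * Real.sin z' = α * L' * Real.cos z') :
    z' * (Real.pi + z') / L' ^ 2 ≤ z * (Real.pi + z) / L ^ 2 := by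
  have key : ∀ L z, 0 < L → z ∈ Ioo 0 (Real.pi / 2) →
      (Real.pi / 2 + z) * Real.sin z = α * L * Real.cos z →
      z * (Real.pi + z) / L ^ 2 = α * ((z * Real.cos z / Real.sin z) *
        ((1 + Real.pi / 2 / (Real.pi / 2 + z)) * (1 / L))) := by
    intro L z hL hz h
    have hs : 0 < Real.sin z := Real.sin_pos_of_pos_of_lt_pi hz.1 (by linarith [hz.2, Real.pi_pos])
    have hp : 0 < Real.pi / 2 + z := by linarith [hz.1, Real.pi_pos]
    have hc : Real.cos z = (Real.pi / 2 + z) * Real.sin z / (α * L) := by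
      rw [h]; field_simp
    have e : 1 + Real.pi / 2 / (Real.pi / 2 + z) = (Real.pi + z) / (Real.pi / 2 + z) := by
      rw [eq_div_iff hp.ne', add_mul, div_mul_cancel₀ _ hp.ne']; ring
    rw [hc, e]
    have hp' : Real.pi + z * 2 ≠ 0 := by linarith [hz.1, Real.pi_pos]
    field_simp
  rw [key L z hL hz h, key L' z' (hL.trans hLL) hz' h']
  have hpi := Real.pi_pos
  have hs : ∀ z ∈ Ioo 0 (Real.pi / 2), 0 ≤ z * Real.cos z / Real.sin z := fun z hz =>
    div_nonneg (mul_nonneg hz.1.le (Real.cos_nonneg_of_mem_Icc ⟨by linarith [hz.1], hz.2.le⟩))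
      (Real.sin_pos_of_pos_of_lt_pi hz.1 (by linarith [hz.2, Real.pi_pos])).le
  have h1 := antitoneOn_mul_cot hz hz' hzz.le
  simp only at h1
  have h2 : Real.pi / 2 / (Real.pi / 2 + z') ≤ Real.pi / 2 / (Real.pi / 2 + z) :=
    div_le_div_of_nonneg_left (by positivity) (by linarith [hz.1]) (by linarith)
  have h3 : 1 / L' ≤ 1 / L := one_div_le_one_div_of_le hL hLL.le
  have h4 : 0 ≤ Real.pi / 2 / (Real.pi / 2 + z') := div_nonneg (by positivity) (by linarith [hz'.1])
  have hL' : 0 < L' := hL.trans hLL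
  have h5 := hs z hz
  refine mul_le_mul_of_nonneg_left (mul_le_mul h1 (mul_le_mul (by linarith) h3 (by positivity)
    (by linarith)) (by positivity) (hs z hz)) hα.le

/-- The spectral gap of the Robin Laplacian on an interval strictly decreases with its length. -/
theorem IsRobinPair.gap_lt {α L L' μ₁ μ₂ ν₁ ν₂ : ℝ} {φ χ φ' χ' : ℝ → ℝ}
    (h : IsRobinPair α L μ₁ μ₂ φ χ) (h' : IsRobinPair α L' ν₁ ν₂ φ' χ') (hL : L < L') :
    ν₂ - ν₁ < μ₂ - μ₁ := by
  rcases le_or_gt α 0 with hα | hα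
  -- For α ≤ 0 the two eigenvalues move towards each other as the interval grows.
  · linarith [h.first_le h' hL hα, h.second_lt h' hL]
  obtain ⟨x, z, hx, hz, h1, h2, h3, h4⟩ := h.high hα
  obtain ⟨x', z', hx', hz', h1', h2', h3', h4'⟩ := h'.high hα
  have hpos := h.pos
  have hpos' := h'.pos
  have hxx : x < x' := mul_sin_lt_imp (c := 0) le_rfl (mul_pos hα hpos)
    (mul_lt_mul_of_pos_left hL hα) hx hx' (by simpa using h3) (by simpa using h3')
  have hzz : z < z' := mul_sin_lt_imp (c := Real.pi / 2) (by positivity) (mul_pos hα hpos)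
    (mul_lt_mul_of_pos_left hL hα) hz hz' h4 h4'
  -- The level (π/(2L))² separates the two eigenvalues. The distance below it decreases strictly
  -- because x increases with L and stays below π/2.
  have e1 : μ₂ - μ₁ = z * (Real.pi + z) / L ^ 2 + ((Real.pi / 2) ^ 2 - x ^ 2) / L ^ 2 := by
    rw [h1, h2]; field_simp; ring
  have e2 : ν₂ - ν₁ = z' * (Real.pi + z') / L' ^ 2 + ((Real.pi / 2) ^ 2 - x' ^ 2) / L' ^ 2 := by
    rw [h1', h2']; field_simp; ring
  rw [e1, e2]
  refine add_lt_add_of_le_of_lt (excited_term_le hα hpos hL hz hz' hzz h4 h4') ?_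
  have h5 : x ^ 2 < x' ^ 2 := pow_lt_pow_left₀ hxx hx.1.le two_ne_zero
  have h6 : x' ^ 2 < (Real.pi / 2) ^ 2 := pow_lt_pow_left₀ hx'.2 hx'.1.le two_ne_zero
  calc ((Real.pi / 2) ^ 2 - x' ^ 2) / L' ^ 2 ≤ ((Real.pi / 2) ^ 2 - x' ^ 2) / L ^ 2 :=
        div_le_div_of_nonneg_left (by linarith) (by positivity)
          (pow_le_pow_left₀ hpos.le hL.le 2)
    _ < _ := div_lt_div_of_pos_right (by linarith) (by positivity)

end Robin

end

/-! ### Faces of a box and its surface measure -/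

noncomputable section

namespace Robin

variable {n m : ℕ}

/-- The closed box `[a₁, b₁] × ⋯ × [aₙ, bₙ]`. -/
def closedBox (a b : Fin n → ℝ) : Set (EuclideanSpace ℝ (Fin n)) :=
  {x | ∀ i, x i ∈ Icc (a i) (b i)}

lemma openBox_eq_preimage (a b : Fin n → ℝ) :
    openBox a b = (WithLp.ofLp : EuclideanSpace ℝ (Fin n) → Fin n → ℝ) ⁻¹'
      (univ.pi fun i => Ioo (a i) (b i)) := by
  ext x; simp only [openBox, mem_preimage, Set.mem_pi, mem_univ, forall_const]; rfl

lemma closedBox_eq_preimage (a b : Fin n → ℝ) :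
    closedBox a b = (WithLp.ofLp : EuclideanSpace ℝ (Fin n) → Fin n → ℝ) ⁻¹'
      (univ.pi fun i => Icc (a i) (b i)) := by
  ext x; simp only [closedBox, mem_preimage, Set.mem_pi, mem_univ, forall_const]; rfl

lemma closedBox_eq_preimage_Icc (a b : Fin n → ℝ) :
    closedBox a b = (WithLp.ofLp : EuclideanSpace ℝ (Fin n) → Fin n → ℝ) ⁻¹' (Icc a b) := by
  rw [closedBox_eq_preimage, pi_univ_Icc]

lemma openBox_subset_closedBox (a b : Fin n → ℝ) : openBox a b ⊆ closedBox a b :=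
  fun _ hx i => Ioo_subset_Icc_self (hx i)

lemma isOpen_openBox (a b : Fin n → ℝ) : IsOpen (openBox a b) := by
  rw [openBox_eq_preimage]
  exact (isOpen_set_pi finite_univ fun _ _ => isOpen_Ioo).preimage (PiLp.continuous_ofLp 2 _)

lemma isCompact_closedBox (a b : Fin n → ℝ) : IsCompact (closedBox a b) := by
  rw [closedBox_eq_preimage]
  exact (EuclideanSpace.equiv (Fin n) ℝ).toHomeomorph.isCompact_preimage.2
    (isCompact_univ_pi fun _ => isCompact_Icc)

lemma closure_openBox {a b : Fin n → ℝ} (hab : ∀ i, a i < b i) :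
    closure (openBox a b) = closedBox a b := by
  have := (EuclideanSpace.equiv (Fin n) ℝ).toHomeomorph.preimage_closure
    (univ.pi fun i => Ioo (a i) (b i))
  rw [closure_pi_set] at this
  simp only [closure_Ioo (hab _).ne] at this
  rw [openBox_eq_preimage, closedBox_eq_preimage]
  exact this.symm

/-- The face `{xᵢ = c}` of the closed box. -/
def boxFace (a b : Fin n → ℝ) (i : Fin n) (c : ℝ) : Set (EuclideanSpace ℝ (Fin n)) :=
  {x | x ∈ closedBox a b ∧ x i = c}

lemma isClosed_boxFace (a b : Fin n → ℝ) (i : Fin n) (c : ℝ) : IsClosed (boxFace a b i c) :=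
  (isCompact_closedBox a b).isClosed.inter (isClosed_eq (by fun_prop) continuous_const)

/-- The upper or lower endpoint of the `i`-th edge. -/
def endpoint (a b : Fin n → ℝ) (k : Fin n × Bool) : ℝ := if k.2 then b k.1 else a k.1

lemma frontier_openBox {a b : Fin n → ℝ} (hab : ∀ i, a i < b i) :
    frontier (openBox a b) = ⋃ k : Fin n × Bool, boxFace a b k.1 (endpoint a b k) := by
  rw [(isOpen_openBox a b).frontier_eq, closure_openBox hab]
  ext x
  simp only [Set.mem_sdiff, mem_iUnion, Prod.exists, Bool.exists_bool, boxFace, endpoint, mem_ofPred_eq]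
  constructor
  · rintro ⟨h1, h2⟩
    simp only [openBox, mem_ofPred_eq, not_forall] at h2
    obtain ⟨i, hi⟩ := h2
    refine ⟨i, ?_⟩
    rcases (h1 i).1.eq_or_lt with h | h
    · left; exact ⟨h1, by simp [h]⟩
    · right
      refine ⟨h1, ?_⟩
      by_contra hne
      exact hi ⟨h, lt_of_le_of_ne (h1 i).2 (by simpa using hne)⟩
  · rintro ⟨i, ⟨h1, h2⟩ | ⟨h1, h2⟩⟩
    · refine ⟨h1, fun h => ?_⟩
      have := (h i).1; simp at h2; linarith
    · refine ⟨h1, fun h => ?_⟩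
      have := (h i).2; simp at h2; linarith

/-- The affine isometry `ℝᵐ → ℝᵐ⁺¹` onto the hyperplane `{xᵢ = c}`. -/
def faceMap (i : Fin (m + 1)) (c : ℝ) (y : EuclideanSpace ℝ (Fin m)) :
    EuclideanSpace ℝ (Fin (m + 1)) :=
  WithLp.toLp 2 (i.insertNth c (WithLp.ofLp y) : Fin (m + 1) → ℝ)

@[simp] lemma faceMap_apply_same (i : Fin (m + 1)) (c : ℝ) (y : EuclideanSpace ℝ (Fin m)) :
    faceMap i c y i = c := by simp [faceMap]

@[simp] lemma faceMap_apply_succAbove (i : Fin (m + 1)) (c : ℝ) (y : EuclideanSpace ℝ (Fin m))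
    (j : Fin m) : faceMap i c y (i.succAbove j) = y j := by simp [faceMap]

lemma isometry_faceMap (i : Fin (m + 1)) (c : ℝ) : Isometry (faceMap i c) := by
  refine Isometry.of_dist_eq fun x y => ?_
  rw [EuclideanSpace.dist_eq, EuclideanSpace.dist_eq, Fin.sum_univ_succAbove _ i]
  simp

lemma range_faceMap (i : Fin (m + 1)) (c : ℝ) : range (faceMap i c) = {x | x i = c} := by
  ext x
  constructor
  · rintro ⟨y, rfl⟩; simp
  · intro hx
    refine ⟨WithLp.toLp 2 fun j => x (i.succAbove j), ?_⟩
    ext j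
    rcases Fin.eq_self_or_eq_succAbove i j with rfl | ⟨k, rfl⟩
    · simpa using hx.symm
    · simp

/-- Isometries transport the Hausdorff measure, whose Euclidean normalisation makes it Lebesgue
measure on ℝᵐ. Integrals over faces thereby become Lebesgue integrals over boxes of one dimension
less. -/
lemma map_faceMap (i : Fin (m + 1)) (c : ℝ) :
    (volume : Measure (EuclideanSpace ℝ (Fin m))).map (faceMap i c) =
      (Measure.euclideanHausdorffMeasure m).restrict {x | x i = c} := by
  rw [← range_faceMap, ← (isometry_faceMap i c).map_euclideanHausdorffMeasure,
    EuclideanSpace.euclideanHausdorffMeasure_eq_volume]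

lemma volume_hyperplane (j : Fin n) (c : ℝ) :
    volume {y : EuclideanSpace ℝ (Fin n) | y j = c} = 0 := by
  have := (PiLp.volume_preserving_ofLp (Fin n)).measure_preimage
    (s := {y | y j = c}) (measurableSet_eq_fun (by fun_prop) (by fun_prop)).nullMeasurableSet
  refine this.trans ?_
  rw [volume_pi]
  exact Measure.pi_hyperplane (fun _ : Fin n => (volume : Measure ℝ)) j c

lemma faceMap_preimage_boxFace {a b : Fin (m + 1) → ℝ} {i : Fin (m + 1)} {c : ℝ}
    (hc : c ∈ Icc (a i) (b i)) :
    faceMap i c ⁻¹' boxFace a b i c =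
      closedBox (fun j => a (i.succAbove j)) (fun j => b (i.succAbove j)) := by
  ext y
  simp only [mem_preimage, boxFace, closedBox, mem_ofPred_eq, faceMap_apply_same, and_true]
  constructor
  · intro h j
    simpa using h (i.succAbove j)
  · intro h j
    rcases Fin.eq_self_or_eq_succAbove i j with rfl | ⟨k, rfl⟩
    · simpa using hc
    · simpa using h k

lemma restrict_boxFace {a b : Fin (m + 1) → ℝ} {i : Fin (m + 1)} {c : ℝ}
    (hc : c ∈ Icc (a i) (b i)) :
    (Measure.euclideanHausdorffMeasure m).restrict (boxFace a b i c) =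
      (volume.restrict (closedBox (fun j => a (i.succAbove j)) (fun j => b (i.succAbove j)))).map
        (faceMap i c) := by
  rw [← faceMap_preimage_boxFace hc, ← Measure.restrict_map (isometry_faceMap i c).continuous.measurable
    (isClosed_boxFace a b i c).measurableSet, map_faceMap, Measure.restrict_restrict
    (isClosed_boxFace a b i c).measurableSet, inter_eq_left.2 fun x hx => hx.2]

lemma endpoint_mem {a b : Fin n → ℝ} (hab : ∀ i, a i < b i) (k : Fin n × Bool) :
    endpoint a b k ∈ Icc (a k.1) (b k.1) := by
  unfold endpoint; split_ifs
  · exact ⟨(hab _).le, le_rfl⟩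
  · exact ⟨le_rfl, (hab _).le⟩

/-- Opposite faces are disjoint. Faces in different directions meet inside a coordinate hyperplane
of one of them, which is null there. -/
lemma aedisjoint_boxFace {a b : Fin (m + 1) → ℝ} (hab : ∀ i, a i < b i) :
    Pairwise (Function.onFun (AEDisjoint (Measure.euclideanHausdorffMeasure m))
      fun k : Fin (m + 1) × Bool => boxFace a b k.1 (endpoint a b k)) := by
  rintro ⟨i, s⟩ ⟨j, t⟩ hne
  by_cases hij : i = j
  · subst hij
    have hst : s ≠ t := fun h => hne (by rw [h])
    refine (Set.disjoint_left.2 fun x hx hx' => ?_).aedisjoint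
    have := hx.2.symm.trans hx'.2
    have h1 := hab i
    simp only [endpoint] at this
    cases s <;> cases t <;> simp at this hst <;> linarith
  · obtain ⟨k, rfl⟩ := (Fin.eq_self_or_eq_succAbove i j).resolve_left fun h => hij h.symm
    set c := endpoint a b (i, s)
    set d := endpoint a b (i.succAbove k, t)
    have h1 : (Measure.euclideanHausdorffMeasure m)
        ({x : EuclideanSpace ℝ (Fin (m + 1)) | x (i.succAbove k) = d} ∩ {x | x i = c}) = 0 := by
      have hm : MeasurableSet {x : EuclideanSpace ℝ (Fin (m + 1)) | x (i.succAbove k) = d} :=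
        measurableSet_eq_fun (by fun_prop) (by fun_prop)
      rw [← Measure.restrict_apply hm, ← map_faceMap,
        Measure.map_apply (isometry_faceMap i c).continuous.measurable hm]
      simpa using volume_hyperplane k d
    refine measure_mono_null (t := {x : EuclideanSpace ℝ (Fin (m + 1)) |
      x (i.succAbove k) = d} ∩ {x | x i = c}) (fun x hx => ?_) h1
    exact ⟨hx.2.2, hx.1.2⟩

/-- The surface measure of a box is the sum of the Lebesgue measures of its faces. -/
lemma surfaceMeasure_openBox {a b : Fin (m + 1) → ℝ} (hab : ∀ i, a i < b i) :
    surfaceMeasure (openBox a b) = ∑ k : Fin (m + 1) × Bool,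
      (volume.restrict (closedBox (fun j => a (k.1.succAbove j))
        (fun j => b (k.1.succAbove j)))).map (faceMap k.1 (endpoint a b k)) := by
  rw [surfaceMeasure, frontier_openBox hab, Nat.add_sub_cancel,
    Measure.restrict_iUnion_ae (aedisjoint_boxFace hab)
      fun k => (isClosed_boxFace a b _ _).measurableSet.nullMeasurableSet, Measure.sum_fintype]
  exact Finset.sum_congr rfl fun k _ => restrict_boxFace (endpoint_mem hab k)

lemma isFiniteMeasure_restrict_closedBox (a b : Fin n → ℝ) :
    IsFiniteMeasure (volume.restrict (closedBox a b)) :=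
  ⟨by simpa using (isCompact_closedBox a b).measure_lt_top⟩

lemma isFiniteMeasure_surfaceMeasure {a b : Fin (m + 1) → ℝ} (hab : ∀ i, a i < b i) :
    IsFiniteMeasure (surfaceMeasure (openBox a b)) := by
  rw [surfaceMeasure_openBox hab]
  have := fun k : Fin (m + 1) × Bool => isFiniteMeasure_restrict_closedBox
    (fun j => a (k.1.succAbove j)) (fun j => b (k.1.succAbove j))
  refine ⟨?_⟩
  simp only [Measure.coe_finsetSum, Finset.sum_apply]
  exact ENNReal.sum_lt_top.2 fun k _ => measure_lt_top _ _

lemma integral_surfaceMeasure {a b : Fin (m + 1) → ℝ} (hab : ∀ i, a i < b i)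
    {F : EuclideanSpace ℝ (Fin (m + 1)) → ℝ} (hF : Continuous F) :
    ∫ x, F x ∂(surfaceMeasure (openBox a b)) = ∑ i : Fin (m + 1),
      ((∫ y in closedBox (fun j => a (i.succAbove j)) (fun j => b (i.succAbove j)),
        F (faceMap i (b i) y)) +
      ∫ y in closedBox (fun j => a (i.succAbove j)) (fun j => b (i.succAbove j)),
        F (faceMap i (a i) y)) := by
  have hcont : ∀ k : Fin (m + 1) × Bool, Continuous fun y => F (faceMap k.1 (endpoint a b k) y) :=
    fun k => hF.comp (isometry_faceMap _ _).continuous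
  rw [surfaceMeasure_openBox hab, integral_finsetSum_measure, Fintype.sum_prod_type]
  · refine Finset.sum_congr rfl fun i _ => ?_
    rw [Fintype.sum_bool]
    rw [integral_map (isometry_faceMap _ _).continuous.aemeasurable hF.aestronglyMeasurable,
      integral_map (isometry_faceMap _ _).continuous.aemeasurable hF.aestronglyMeasurable]
    simp [endpoint]
  · intro k _
    rw [integrable_map_measure hF.aestronglyMeasurable
      (isometry_faceMap _ _).continuous.aemeasurable]
    exact (hcont k).continuousOn.integrableOn_compact (isCompact_closedBox _ _)

lemma closedBox_ae_eq_openBox (a b : Fin n → ℝ) :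
    (closedBox a b : Set (EuclideanSpace ℝ (Fin n))) =ᵐ[volume] openBox a b := by
  rw [closedBox_eq_preimage_Icc, openBox_eq_preimage]
  refine (PiLp.volume_preserving_ofLp (Fin n)).quasiMeasurePreserving.preimage_ae_eq ?_
  rw [volume_pi]
  exact Measure.univ_pi_Ioo_ae_eq_Icc.symm

lemma restrict_closedBox (a b : Fin n → ℝ) :
    (volume.restrict (closedBox a b) : Measure (EuclideanSpace ℝ (Fin n))) =
      volume.restrict (openBox a b) :=
  Measure.restrict_congr_set (closedBox_ae_eq_openBox a b)

end Robin

end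

/-! ### Boundary integrals as volume integrals -/

noncomputable section

namespace Robin

variable {n m : ℕ}

lemma setIntegral_closedBox (a b : Fin n → ℝ) (F : EuclideanSpace ℝ (Fin n) → ℝ) :
    ∫ x in closedBox a b, F x = ∫ y in Icc a b, F (WithLp.toLp 2 y) := by
  have := (PiLp.volume_preserving_ofLp (Fin n)).setIntegral_preimage_emb
    (MeasurableEquiv.toLp 2 (Fin n → ℝ)).symm.measurableEmbedding
    (fun y => F (WithLp.toLp 2 y)) (Icc a b)
  rw [closedBox_eq_preimage_Icc]
  exact this

lemma gradient_apply {f : EuclideanSpace ℝ (Fin n) → ℝ} (x : EuclideanSpace ℝ (Fin n))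
    (i : Fin n) : gradient f x i = fderiv ℝ f x (EuclideanSpace.single i 1) := by
  have h1 : inner ℝ (gradient f x) (EuclideanSpace.single i (1 : ℝ)) = gradient f x i := by
    rw [EuclideanSpace.inner_single_right]; simp
  rw [← h1, gradient, InnerProductSpace.toDual_symm_apply]

lemma continuous_gradient {f : EuclideanSpace ℝ (Fin n) → ℝ} (hf : ContDiff ℝ 1 f) :
    Continuous (gradient f) :=
  (LinearIsometryEquiv.continuous _).comp (hf.continuous_fderiv (by simp))

/-- A boundary term of the form `β ∫ f² dS` on a box, expressed through an integral over the box. -/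
lemma boundary_identity {a b : Fin (m + 1) → ℝ} (hab : ∀ i, a i < b i)
    {h h' : Fin (m + 1) → ℝ → ℝ} {β : ℝ} (hc : ∀ i, ContinuousOn (h i) (Icc (a i) (b i)))
    (hc' : ∀ i, ContinuousOn (h' i) (Icc (a i) (b i)))
    (hd : ∀ i, ∀ t ∈ Ioo (a i) (b i), HasDerivAt (h i) (h' i t) t)
    (hb : ∀ i, h i (b i) = β) (ha : ∀ i, h i (a i) = -β)
    {f : EuclideanSpace ℝ (Fin (m + 1)) → ℝ} (hf : ContDiff ℝ 1 f) :
    β * ∫ x, f x ^ 2 ∂(surfaceMeasure (openBox a b)) =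
      ∫ x in openBox a b, ∑ i, (h' i (x i) * f x ^ 2 + 2 * (h i (x i) * f x * gradient f x i)) := by
  set e := (EuclideanSpace.equiv (Fin (m + 1)) ℝ).symm
  set g : (Fin (m + 1) → ℝ) → ℝ := fun x => f (e x)
  have hg : ∀ x, HasFDerivAt g ((fderiv ℝ f (e x)).comp
      (e : (Fin (m + 1) → ℝ) →L[ℝ] EuclideanSpace ℝ (Fin (m + 1)))) x := fun x =>
    ((hf.differentiable (by simp)).differentiableAt.hasFDerivAt).comp x e.hasFDerivAt
  have hgc : Continuous g := hf.continuous.comp e.continuous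
  set D : (Fin (m + 1) → ℝ) → (Fin (m + 1) → ℝ) →L[ℝ] ℝ := fun x => (fderiv ℝ f (e x)).comp
      (e : (Fin (m + 1) → ℝ) →L[ℝ] EuclideanSpace ℝ (Fin (m + 1))) with hD
  have hDc : Continuous D :=
    ((hf.continuous_fderiv (by simp)).comp e.continuous).clm_comp continuous_const
  have hpr : ∀ i, MapsTo (fun x : Fin (m + 1) → ℝ => x i) (Icc a b) (Icc (a i) (b i)) :=
    fun i x hx => ⟨hx.1 i, hx.2 i⟩
  have hci : ∀ i, ContinuousOn (fun x : Fin (m + 1) → ℝ => h i (x i)) (Icc a b) := fun i =>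
    (hc i).comp (continuous_apply i).continuousOn (hpr i)
  have hci' : ∀ i, ContinuousOn (fun x : Fin (m + 1) → ℝ => h' i (x i)) (Icc a b) := fun i =>
    (hc' i).comp (continuous_apply i).continuousOn (hpr i)
  -- The divergence theorem is applied to the field with components hᵢ(xᵢ) f(x)².
  have key := integral_divergence_of_hasFDerivAt_off_countable' a b (fun i => (hab i).le)
    (fun i x => h i (x i) * g x ^ 2)
    (fun i x => h i (x i) • ((2 * g x ^ (2 - 1)) • D x) + g x ^ 2 • (h' i (x i) •
      (ContinuousLinearMap.proj i : (Fin (m + 1) → ℝ) →L[ℝ] ℝ))) ∅ countable_empty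
    (fun i => (hci i).mul (hgc.pow 2).continuousOn)
    (fun x hx i => by
      have h1 := hd i (x i) (hx.1 i (mem_univ _))
      have h2 : HasFDerivAt (fun x : Fin (m + 1) → ℝ => x i)
        (ContinuousLinearMap.proj i : (Fin (m + 1) → ℝ) →L[ℝ] ℝ) x :=
        (ContinuousLinearMap.proj i : (Fin (m + 1) → ℝ) →L[ℝ] ℝ).hasFDerivAt
      have h3 := h1.comp_hasFDerivAt x h2
      have h4 := (hg x).pow 2
      refine (h3.mul h4).congr_fderiv ?_
      simp [D])
    (by
      refine ContinuousOn.integrableOn_compact isCompact_Icc ?_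
      refine continuousOn_finsetSum _ fun i _ => ?_
      have h5 : Continuous fun x => D x (Pi.single i 1) := hDc.clm_apply continuous_const
      simp only [add_apply, smul_apply, smul_eq_mul]
      exact ((hci i).mul (((hgc.pow _).const_mul 2).mul h5).continuousOn).add
        ((hgc.pow 2).continuousOn.mul ((hci' i).mul_const _)))
  have hL : ∫ x in openBox a b, ∑ i, (h' i (x i) * f x ^ 2 +
      2 * (h i (x i) * f x * gradient f x i)) = ∫ x in Icc a b, ∑ i,
      (h i (x i) • ((2 * g x ^ (2 - 1)) • D x) + g x ^ 2 • (h' i (x i) •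
      (ContinuousLinearMap.proj i : (Fin (m + 1) → ℝ) →L[ℝ] ℝ))) (Pi.single i 1) := by
    rw [← restrict_closedBox, setIntegral_closedBox]
    congr 1
    ext x
    refine Finset.sum_congr rfl fun i _ => ?_
    have : e (Pi.single i 1) = EuclideanSpace.single i (1 : ℝ) := rfl
    simp only [gradient_apply, add_apply, smul_apply,
      smul_eq_mul, hD, ContinuousLinearMap.comp_apply, ContinuousLinearEquiv.coe_coe, this,
      ContinuousLinearMap.proj_apply, Pi.single_eq_same, g]
    have : e x = WithLp.toLp 2 x := rfl
    rw [this]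
    ring
  rw [hL, key, integral_surfaceMeasure hab (F := fun x => f x ^ 2) (hf.continuous.pow 2), Finset.mul_sum]
  refine Finset.sum_congr rfl fun i _ => ?_
  -- On the upper face hᵢ = β, and on the lower face hᵢ = −β meets the minus sign of the outer
  -- normal; every face contributes β ∫ f².
  simp only [Fin.insertNth_apply_same, hb, ha]
  rw [setIntegral_closedBox, setIntegral_closedBox, integral_const_mul, integral_const_mul]
  simp only [faceMap, g]
  have : ∀ x, e x = WithLp.toLp 2 x := fun _ => rfl
  simp only [this]
  have e1 : (a ∘ i.succAbove) = fun j => a (i.succAbove j) := rfl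
  have e2 : (b ∘ i.succAbove) = fun j => b (i.succAbove j) := rfl
  rw [e1, e2]
  ring

end Robin

end

/-! ### Convergence in L² and the boundary identity on H¹ -/

noncomputable section

namespace Robin

variable {n m : ℕ}

/-- Convergence in `L²(μ)` of a family of functions along a filter. -/
structure L2Tendsto {ι X F : Type*} [MeasurableSpace X] [NormedAddCommGroup F] (μ : Measure X)
    (l : Filter ι) (f : ι → X → F) (f₀ : X → F) : Prop where
  memLp : ∀ j, MemLp (f j) 2 μ
  memLp_lim : MemLp f₀ 2 μ
  tendsto : Tendsto (fun j => eLpNorm (fun x => f j x - f₀ x) 2 μ) l (𝓝 0)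

namespace L2Tendsto

variable {ι X F : Type*} [MeasurableSpace X] [NormedAddCommGroup F] {μ : Measure X}
  {l : Filter ι}

lemma tendsto_toLp {f : ι → X → F} {f₀ : X → F} (h : L2Tendsto μ l f f₀) :
    Tendsto (fun j => (h.memLp j).toLp (f j)) l (𝓝 (h.memLp_lim.toLp f₀)) :=
  (Lp.tendsto_Lp_iff_tendsto_eLpNorm'' f h.memLp f₀ h.memLp_lim).2 h.tendsto

/-- Joint continuity of the inner product of L². -/
lemma integral_mul {f g : ι → X → ℝ} {f₀ g₀ : X → ℝ} (hf : L2Tendsto μ l f f₀)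
    (hg : L2Tendsto μ l g g₀) :
    Tendsto (fun j => ∫ x, f j x * g j x ∂μ) l (𝓝 (∫ x, f₀ x * g₀ x ∂μ)) := by
  have key : ∀ {f g : X → ℝ} (hf : MemLp f 2 μ) (hg : MemLp g 2 μ),
      inner ℝ (hf.toLp f) (hg.toLp g) = ∫ x, f x * g x ∂μ := by
    intro f g hf hg
    rw [L2.inner_def]
    refine integral_congr_ae ?_
    filter_upwards [hf.coeFn_toLp, hg.coeFn_toLp] with x h1 h2
    rw [h1, h2]
    simp [mul_comm]
  have := hf.tendsto_toLp.inner hg.tendsto_toLp (𝕜 := ℝ)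
  simpa only [key] using this

lemma comp {f : ι → X → F} {f₀ : X → F} (h : L2Tendsto μ l f f₀) {κ : Type*} {l' : Filter κ}
    {s : κ → ι} (hs : Tendsto s l' l) : L2Tendsto μ l' (fun k => f (s k)) f₀ :=
  ⟨fun k => h.memLp (s k), h.memLp_lim, h.tendsto.comp hs⟩

lemma of_norm_le {f : ι → X → F} {f₀ : X → F} (h : L2Tendsto μ l f f₀) {F' : Type*}
    [NormedAddCommGroup F'] {g : ι → X → F'} {g₀ : X → F'} (hg : ∀ j, MemLp (g j) 2 μ)
    (hg₀ : MemLp g₀ 2 μ) {C : ℝ}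
    (hle : ∀ j, ∀ᵐ x ∂μ, ‖g j x - g₀ x‖ ≤ C * ‖f j x - f₀ x‖) : L2Tendsto μ l g g₀ := by
  refine ⟨hg, hg₀, ?_⟩
  have h1 : Tendsto (fun j => ENNReal.ofReal C * eLpNorm (fun x => f j x - f₀ x) 2 μ) l
      (𝓝 0) := by
    simpa using ENNReal.Tendsto.const_mul h.tendsto (Or.inr ENNReal.ofReal_ne_top)
  exact tendsto_of_tendsto_of_tendsto_of_le_of_le tendsto_const_nhds h1 (fun _ => zero_le)
    fun j => eLpNorm_le_mul_eLpNorm_of_ae_le_mul (hle j) 2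

lemma bdd_mul {f : ι → X → ℝ} {f₀ : X → ℝ} (h : L2Tendsto μ l f f₀) {k : X → ℝ}
    (hk : AEStronglyMeasurable k μ) {C : ℝ} (hC : ∀ᵐ x ∂μ, |k x| ≤ C) :
    L2Tendsto μ l (fun j x => k x * f j x) (fun x => k x * f₀ x) := by
  have hm : ∀ {f : X → ℝ}, MemLp f 2 μ → MemLp (fun x => k x * f x) 2 μ := fun {f} hf => by
    refine hf.of_le_mul (c := C) (hk.mul hf.1) ?_
    filter_upwards [hC] with x hx
    rw [norm_mul]
    exact mul_le_mul_of_nonneg_right hx (norm_nonneg _)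
  refine h.of_norm_le (fun j => hm (h.memLp j)) (hm h.memLp_lim) (C := C) fun j => ?_
  filter_upwards [hC] with x hx
  rw [← mul_sub, norm_mul]
  exact mul_le_mul_of_nonneg_right hx (norm_nonneg _)

lemma coord {f : ι → X → EuclideanSpace ℝ (Fin n)} {f₀ : X → EuclideanSpace ℝ (Fin n)}
    (h : L2Tendsto μ l f f₀) (i : Fin n) :
    L2Tendsto μ l (fun j x => f j x i) (fun x => f₀ x i) := by
  have hm : ∀ {f : X → EuclideanSpace ℝ (Fin n)}, MemLp f 2 μ → MemLp (fun x => f x i) 2 μ :=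
    fun {f} hf => hf.of_le ((by fun_prop : Continuous fun y : EuclideanSpace ℝ (Fin n) =>
      y i).comp_aestronglyMeasurable hf.1) (ae_of_all _ fun x => PiLp.norm_apply_le (f x) i)
  refine h.of_norm_le (fun j => hm (h.memLp j)) (hm h.memLp_lim) (C := 1) fun j =>
    ae_of_all _ fun x => ?_
  rw [one_mul]
  exact PiLp.norm_apply_le (f j x - f₀ x) i

lemma sub {f g : ι → X → F} {f₀ g₀ : X → F} (hf : L2Tendsto μ l f f₀) (hg : L2Tendsto μ l g g₀) :
    L2Tendsto μ l (fun j x => f j x - g j x) (fun x => f₀ x - g₀ x) := by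
  refine ⟨fun j => (hf.memLp j).sub (hg.memLp j), hf.memLp_lim.sub hg.memLp_lim, ?_⟩
  have h1 : Tendsto (fun j => eLpNorm (fun x => f j x - f₀ x) 2 μ +
      eLpNorm (fun x => g j x - g₀ x) 2 μ) l (𝓝 0) := by
    simpa using hf.tendsto.add hg.tendsto
  refine tendsto_of_tendsto_of_tendsto_of_le_of_le tendsto_const_nhds h1 (fun _ => zero_le)
    fun j => ?_
  have e : (fun x => f j x - g j x - (f₀ x - g₀ x)) =
      (fun x => f j x - f₀ x) - fun x => g j x - g₀ x := by
    funext x; simp only [Pi.sub_apply]; abel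
  simp only [e]
  exact eLpNorm_sub_le ((hf.memLp j).sub hf.memLp_lim).1 ((hg.memLp j).sub hg.memLp_lim).1
    one_le_two

end L2Tendsto

section Box

variable {a b : Fin n → ℝ}

lemma ae_mem_openBox (a b : Fin n → ℝ) :
    ∀ᵐ x ∂(volume.restrict (openBox a b) : Measure (EuclideanSpace ℝ (Fin n))), x ∈ openBox a b :=
  ae_restrict_mem (isOpen_openBox a b).measurableSet

instance isFiniteMeasure_restrict_openBox (a b : Fin n → ℝ) : IsFiniteMeasure
    (volume.restrict (openBox a b) : Measure (EuclideanSpace ℝ (Fin n))) := by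
  rw [← restrict_closedBox]; exact isFiniteMeasure_restrict_closedBox a b

lemma exists_bound_closedBox {F : Type*} [NormedAddCommGroup F]
    {k : EuclideanSpace ℝ (Fin n) → F} (hk : ContinuousOn k (closedBox a b)) :
    ∃ C, ∀ x ∈ closedBox a b, ‖k x‖ ≤ C :=
  (isCompact_closedBox a b).exists_bound_of_continuousOn hk

lemma aestronglyMeasurable_openBox {F : Type*} [NormedAddCommGroup F]
    {k : EuclideanSpace ℝ (Fin n) → F} (hk : ContinuousOn k (closedBox a b)) :
    AEStronglyMeasurable k (volume.restrict (openBox a b)) := by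
  rw [← restrict_closedBox]
  exact hk.aestronglyMeasurable_of_isCompact (isCompact_closedBox a b)
    (isCompact_closedBox a b).measurableSet

lemma memLp_openBox {F : Type*} [NormedAddCommGroup F] {k : EuclideanSpace ℝ (Fin n) → F}
    (hk : ContinuousOn k (closedBox a b)) : MemLp k 2 (volume.restrict (openBox a b)) := by
  obtain ⟨C, hC⟩ := exists_bound_closedBox hk
  refine MemLp.of_bound (aestronglyMeasurable_openBox hk) C ?_
  filter_upwards [ae_mem_openBox a b] with x hx using hC x (openBox_subset_closedBox a b hx)

lemma L2Tendsto.continuousOn_mul {ι : Type*} {l : Filter ι} {f : ι → EuclideanSpace ℝ (Fin n) → ℝ}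
    {f₀ : EuclideanSpace ℝ (Fin n) → ℝ} (h : L2Tendsto (volume.restrict (openBox a b)) l f f₀)
    {k : EuclideanSpace ℝ (Fin n) → ℝ} (hk : ContinuousOn k (closedBox a b)) :
    L2Tendsto (volume.restrict (openBox a b)) l (fun j x => k x * f j x) (fun x => k x * f₀ x) := by
  obtain ⟨C, hC⟩ := exists_bound_closedBox hk
  refine h.bdd_mul (aestronglyMeasurable_openBox hk) (C := C) ?_
  filter_upwards [ae_mem_openBox a b] with x hx using hC x (openBox_subset_closedBox a b hx)

lemma continuousOn_coord_comp {k : ℝ → ℝ} {i : Fin n} (hk : ContinuousOn k (Icc (a i) (b i))) :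
    ContinuousOn (fun x : EuclideanSpace ℝ (Fin n) => k (x i)) (closedBox a b) :=
  hk.comp (by fun_prop) fun _ hx => hx i

end Box

/-- A coordinatewise vector field whose outer normal component on the boundary of the box is the
constant `β`. -/
structure NormalField (a b : Fin n → ℝ) (β : ℝ) (h h' : Fin n → ℝ → ℝ) : Prop where
  cont : ∀ i, ContinuousOn (h i) (Icc (a i) (b i))
  cont' : ∀ i, ContinuousOn (h' i) (Icc (a i) (b i))
  hasDeriv : ∀ i, ∀ t ∈ Ioo (a i) (b i), HasDerivAt (h i) (h' i t) t
  upper : ∀ i, h i (b i) = β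
  lower : ∀ i, h i (a i) = -β

lemma integrable_boundaryTerm {a b : Fin n → ℝ} {β : ℝ} {h h' : Fin n → ℝ → ℝ}
    (hN : NormalField a b β h h') {u : EuclideanSpace ℝ (Fin n) → ℝ}
    {p : EuclideanSpace ℝ (Fin n) → EuclideanSpace ℝ (Fin n)}
    (hu : MemLp u 2 (volume.restrict (openBox a b)))
    (hp : MemLp p 2 (volume.restrict (openBox a b))) (i : Fin n) :
    Integrable (fun x => h' i (x i) * u x * u x) (volume.restrict (openBox a b)) ∧
    Integrable (fun x => h i (x i) * u x * p x i) (volume.restrict (openBox a b)) := by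
  -- Constant sequences let the closure properties of `L2Tendsto` supply the memberships in L².
  have h0 : L2Tendsto (volume.restrict (openBox a b)) (atTop : Filter ℕ) (fun _ : ℕ => u) u := ⟨fun _ => hu, hu, by simp⟩
  have h1 : L2Tendsto (volume.restrict (openBox a b)) (atTop : Filter ℕ) (fun _ : ℕ => p) p := ⟨fun _ => hp, hp, by simp⟩
  have h2 := (h0.continuousOn_mul (continuousOn_coord_comp (hN.cont' i))).memLp_lim
  have h3 := (h0.continuousOn_mul (continuousOn_coord_comp (hN.cont i))).memLp_lim
  exact ⟨h2.integrable_mul hu, h3.integrable_mul (h1.coord i).memLp_lim⟩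

/-- The quadratic form on `H¹` representing the boundary term `β ∫ u² dS`. -/
def boundaryForm (a b : Fin n → ℝ) (h h' : Fin n → ℝ → ℝ) (u : EuclideanSpace ℝ (Fin n) → ℝ)
    (p : EuclideanSpace ℝ (Fin n) → EuclideanSpace ℝ (Fin n)) : ℝ :=
  ∑ i, ((∫ x in openBox a b, h' i (x i) * u x * u x) +
    2 * ∫ x in openBox a b, h i (x i) * u x * p x i)

lemma boundary_eq_boundaryForm {a b : Fin (m + 1) → ℝ} (hab : ∀ i, a i < b i)
    {β : ℝ} {h h' : Fin (m + 1) → ℝ → ℝ} (hN : NormalField a b β h h')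
    {f : EuclideanSpace ℝ (Fin (m + 1)) → ℝ} (hf : ContDiff ℝ 1 f) :
    β * ∫ x, f x ^ 2 ∂(surfaceMeasure (openBox a b)) = boundaryForm a b h h' f (gradient f) := by
  have hi := fun i => integrable_boundaryTerm hN (memLp_openBox hf.continuous.continuousOn)
    (memLp_openBox (continuous_gradient hf).continuousOn) i
  rw [boundary_identity hab hN.cont hN.cont' hN.hasDeriv hN.upper hN.lower hf, boundaryForm,
    integral_finsetSum]
  · refine Finset.sum_congr rfl fun i _ => ?_
    rw [← integral_const_mul, ← integral_add (hi i).1 ((hi i).2.const_mul 2)]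
    congr 1
    ext x
    ring
  · intro i _
    refine ((hi i).1.add ((hi i).2.const_mul 2)).congr (ae_of_all _ fun x => ?_)
    simp only [Pi.add_apply]
    ring

/-- The coefficients are bounded on the box, so L² convergence of functions and gradients inside the
box controls the boundary term. This carries the boundary identity to H¹ and makes boundary values
of approximating sequences converge. -/
lemma tendsto_boundaryForm {ι : Type*} {l : Filter ι} {a b : Fin n → ℝ}
    {β : ℝ} {h h' : Fin n → ℝ → ℝ} (hN : NormalField a b β h h')
    {f : ι → EuclideanSpace ℝ (Fin n) → ℝ} {u : EuclideanSpace ℝ (Fin n) → ℝ}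
    {q : ι → EuclideanSpace ℝ (Fin n) → EuclideanSpace ℝ (Fin n)}
    {p : EuclideanSpace ℝ (Fin n) → EuclideanSpace ℝ (Fin n)}
    (hu : L2Tendsto (volume.restrict (openBox a b)) l f u)
    (hp : L2Tendsto (volume.restrict (openBox a b)) l q p) :
    Tendsto (fun j => boundaryForm a b h h' (f j) (q j)) l (𝓝 (boundaryForm a b h h' u p)) := by
  refine tendsto_finsetSum _ fun i _ => ?_
  have h2 := hu.continuousOn_mul (continuousOn_coord_comp (hN.cont' i))
  have h3 := hu.continuousOn_mul (continuousOn_coord_comp (hN.cont i))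
  exact (h2.integral_mul hu).add ((h3.integral_mul (hp.coord i)).const_mul 2)

lemma continuous_memLp_surface {a b : Fin (m + 1) → ℝ} (hab : ∀ i, a i < b i)
    {f : EuclideanSpace ℝ (Fin (m + 1)) → ℝ} (hf : Continuous f) :
    MemLp f 2 (surfaceMeasure (openBox a b)) := by
  have := isFiniteMeasure_surfaceMeasure hab
  obtain ⟨C, hC⟩ := exists_bound_closedBox (a := a) (b := b) hf.continuousOn
  refine MemLp.of_bound hf.aestronglyMeasurable C ?_
  have : ∀ᵐ x ∂(surfaceMeasure (openBox a b)), x ∈ frontier (openBox a b) :=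
    ae_restrict_mem isClosed_frontier.measurableSet
  filter_upwards [this] with x hx
  rw [(isOpen_openBox a b).frontier_eq, closure_openBox hab] at hx
  exact hC x hx.1

/-- The boundary identity for `u ∈ H¹` and any trace of `u`. -/
lemma HasTrace.boundary_eq {a b : Fin (m + 1) → ℝ} (hab : ∀ i, a i < b i)
    {β : ℝ} {h h' : Fin (m + 1) → ℝ → ℝ} (hN : NormalField a b β h h')
    {u : L2 (openBox a b)} {g : L2Boundary (openBox a b)} (hg : HasTrace (openBox a b) u g) :
    β * ∫ x, g x ^ 2 ∂(surfaceMeasure (openBox a b)) =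
      boundaryForm a b h h' u (weakGradient (openBox a b) u) := by
  obtain ⟨φ, hφ, h1, h2, h3⟩ := hg
  have hφ1 : ∀ j, ContDiff ℝ 1 (φ j) := fun j => (hφ j).of_le (by simp)
  have t1 : L2Tendsto (volume.restrict (openBox a b)) atTop φ u :=
    ⟨fun j => memLp_openBox (hφ j).continuous.continuousOn, Lp.memLp u, h1⟩
  have t2 : L2Tendsto (volume.restrict (openBox a b)) atTop (fun j => gradient (φ j))
      (weakGradient (openBox a b) u) :=
    ⟨fun j => memLp_openBox (continuous_gradient (hφ1 j)).continuousOn, Lp.memLp _, h2⟩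
  have t3 : L2Tendsto (surfaceMeasure (openBox a b)) atTop φ g :=
    ⟨fun j => continuous_memLp_surface hab (hφ j).continuous, Lp.memLp g, h3⟩
  -- The two sides of the smooth identity converge separately along the sequence that defines the
  -- trace, so ∫ g² does not depend on which trace was chosen when β ≠ 0.
  have l1 := (t3.integral_mul t3).const_mul β
  have l2 := tendsto_boundaryForm hN t1 t2
  simp only [← pow_two] at l1
  refine tendsto_nhds_unique l1 ?_
  simpa only [boundary_eq_boundaryForm hab hN (hφ1 _)] using l2

end Robin

end

/-! ### Cutoffs and integration by parts up to the boundary -/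

noncomputable section

namespace Robin

variable {n m : ℕ}

/-- The product function `x ↦ ∏ⱼ gⱼ(xⱼ)`. -/
def prodFun (g : Fin n → ℝ → ℝ) (x : EuclideanSpace ℝ (Fin n)) : ℝ := ∏ j, g j (x j)

lemma contDiff_prodFun {g : Fin n → ℝ → ℝ} (hg : ∀ j, ContDiff ℝ ∞ (g j)) :
    ContDiff ℝ ∞ (prodFun g) :=
  contDiff_prod fun j _ => (hg j).comp (by fun_prop)

lemma prodFun_update_apply (g : Fin n → ℝ → ℝ) (i : Fin n) (k : ℝ → ℝ)
    (x : EuclideanSpace ℝ (Fin n)) :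
    prodFun (Function.update g i k) x = k (x i) * ∏ j ∈ Finset.univ.erase i, g j (x j) := by
  rw [prodFun, ← Finset.mul_prod_erase _ _ (Finset.mem_univ i), Function.update_self]
  congr 1
  refine Finset.prod_congr rfl fun j hj => ?_
  rw [Function.update_of_ne (Finset.ne_of_mem_erase hj)]

lemma prodFun_eq_mul (g : Fin n → ℝ → ℝ) (i : Fin n) (x : EuclideanSpace ℝ (Fin n)) :
    prodFun g x = g i (x i) * ∏ j ∈ Finset.univ.erase i, g j (x j) := by
  rw [← prodFun_update_apply, Function.update_eq_self]

lemma fderiv_prodFun {g : Fin n → ℝ → ℝ} (hg : ∀ j, Differentiable ℝ (g j)) (i : Fin n)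
    (x : EuclideanSpace ℝ (Fin n)) :
    fderiv ℝ (prodFun g) x (EuclideanSpace.single i 1) =
      prodFun (Function.update g i (deriv (g i))) x := by
  have h1 : ∀ j, HasFDerivAt (fun y : EuclideanSpace ℝ (Fin n) => g j (y j))
      (deriv (g j) (x j) • (EuclideanSpace.proj j : EuclideanSpace ℝ (Fin n) →L[ℝ] ℝ)) x :=
    fun j => (hg j (x j)).hasDerivAt.comp_hasFDerivAt x
      (EuclideanSpace.proj j : EuclideanSpace ℝ (Fin n) →L[ℝ] ℝ).hasFDerivAt
  have h2 : HasFDerivAt (prodFun g) _ x := HasFDerivAt.finsetProd (u := Finset.univ) fun j _ => h1 j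
  rw [h2.fderiv, prodFun_update_apply]
  simp [mul_comm]

/-- A smooth cutoff function, equal to `1` at points whose distance to the endpoints of `(a, b)` is
at least `2 / k`. -/
def cutoff (a b k t : ℝ) : ℝ :=
  Real.smoothTransition (k * (t - a) - 1) * Real.smoothTransition (k * (b - t) - 1)

lemma contDiff_cutoff (a b k : ℝ) : ContDiff ℝ ∞ (cutoff a b k) := by
  have h : ContDiff ℝ ∞ Real.smoothTransition := Real.smoothTransition.contDiff
  exact (h.comp (by fun_prop)).mul (h.comp (by fun_prop))

lemma cutoff_nonneg (a b k t : ℝ) : 0 ≤ cutoff a b k t :=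
  mul_nonneg (Real.smoothTransition.nonneg _) (Real.smoothTransition.nonneg _)

lemma cutoff_le_one (a b k t : ℝ) : cutoff a b k t ≤ 1 :=
  mul_le_one₀ (Real.smoothTransition.le_one _) (Real.smoothTransition.nonneg _)
    (Real.smoothTransition.le_one _)

lemma cutoff_ne_zero {a b k t : ℝ} (h : cutoff a b k t ≠ 0) :
    1 ≤ k * (t - a) ∧ 1 ≤ k * (b - t) := by
  constructor
  · by_contra! hlt
    exact h (by rw [cutoff, Real.smoothTransition.zero_of_nonpos (by linarith), zero_mul])
  · by_contra! hlt
    exact h (by rw [cutoff, Real.smoothTransition.zero_of_nonpos (x := k * (b - t) - 1)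
      (by linarith), mul_zero])

lemma cutoff_eq_one {a b k t : ℝ} (h1 : 2 ≤ k * (t - a)) (h2 : 2 ≤ k * (b - t)) :
    cutoff a b k t = 1 := by
  rw [cutoff, Real.smoothTransition.one_of_one_le (by linarith),
    Real.smoothTransition.one_of_one_le (by linarith), mul_one]

lemma deriv_cutoff_eq_zero {a b k t : ℝ} (h1 : 2 < k * (t - a)) (h2 : 2 < k * (b - t)) :
    deriv (cutoff a b k) t = 0 := by
  have : cutoff a b k =ᶠ[𝓝 t] fun _ => 1 := by
    have c1 : ∀ᶠ s in 𝓝 t, 2 < k * (s - a) :=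
      (by fun_prop : Continuous fun s => k * (s - a)).continuousAt.eventually_const_lt h1
    have c2 : ∀ᶠ s in 𝓝 t, 2 < k * (b - s) :=
      (by fun_prop : Continuous fun s => k * (b - s)).continuousAt.eventually_const_lt h2
    filter_upwards [c1, c2] with s h1 h2 using cutoff_eq_one h1.le h2.le
  rw [this.deriv_eq]; simp

/-- The derivative of the transition vanishes once its argument exceeds 1, so only r in [0, 2]
matters, a compact range. With r = k(t − a) this is the scale-invariant bound for a cutoff of width
1/k. -/
lemma exists_bound_smoothTransition :
    ∃ M, 0 ≤ M ∧ ∀ r, 0 ≤ r → r * |deriv Real.smoothTransition (r - 1)| ≤ M := by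
  have hc : Continuous (deriv Real.smoothTransition) :=
    (Real.smoothTransition.contDiff (n := 1)).continuous_deriv (by simp)
  obtain ⟨C, hC⟩ := (isCompact_Icc (a := (0 : ℝ)) (b := 2)).exists_bound_of_continuousOn
    (f := fun r => r * |deriv Real.smoothTransition (r - 1)|) (by fun_prop)
  have hC0 : 0 ≤ C := (norm_nonneg _).trans (hC 0 (by simp))
  refine ⟨C, hC0, fun r hr => ?_⟩
  rcases le_or_gt r 2 with h | h
  · exact (le_abs_self _).trans (hC r ⟨hr, h⟩)
  · have : Real.smoothTransition =ᶠ[𝓝 (r - 1)] fun _ => 1 := by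
      filter_upwards [eventually_gt_nhds (show 1 < r - 1 by linarith)] with s hs
      exact Real.smoothTransition.one_of_one_le hs.le
    rw [this.deriv_eq]; simpa using hC0

/-- The slope of the cutoff has order k, but only at distance of order 1/k from the endpoints. A
factor y bounded by K times that distance cancels k; the bound is uniform in k and serves as
domination when k tends to infinity. -/
lemma exists_bound_mul_deriv_cutoff : ∃ M, ∀ a b k t y K : ℝ, 0 ≤ k → t ∈ Icc a b →
    0 ≤ K → |y| ≤ K * (t - a) → |y| ≤ K * (b - t) → |y * deriv (cutoff a b k) t| ≤ K * M := by
  obtain ⟨M, hM0, hM⟩ := exists_bound_smoothTransition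
  refine ⟨2 * M, fun a b k t y K hk ht hK h1 h2 => ?_⟩
  have hσ : Differentiable ℝ Real.smoothTransition :=
    (Real.smoothTransition.contDiff (n := 1)).differentiable (by simp)
  have d1 : HasDerivAt (fun t => Real.smoothTransition (k * (t - a) - 1))
      (deriv Real.smoothTransition (k * (t - a) - 1) * (k * 1)) t :=
    (hσ _).hasDerivAt.comp t ((((hasDerivAt_id t).sub_const a).const_mul k).sub_const 1)
  have d2 : HasDerivAt (fun t => Real.smoothTransition (k * (b - t) - 1))
      (deriv Real.smoothTransition (k * (b - t) - 1) * (k * (-1))) t :=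
    (hσ _).hasDerivAt.comp t ((((hasDerivAt_id t).const_sub b).const_mul k).sub_const 1)
  have hd := (d1.mul d2).deriv
  have e : deriv (cutoff a b k) t = _ := hd
  rw [e]
  have b1 : |y| * (k * |deriv Real.smoothTransition (k * (t - a) - 1)|) ≤ K * M := by
    have := hM (k * (t - a)) (mul_nonneg hk (by linarith [ht.1]))
    calc _ ≤ K * (t - a) * (k * |deriv Real.smoothTransition (k * (t - a) - 1)|) :=
          mul_le_mul_of_nonneg_right h1 (by positivity)
      _ = K * (k * (t - a) * |deriv Real.smoothTransition (k * (t - a) - 1)|) := by ring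
      _ ≤ _ := mul_le_mul_of_nonneg_left this hK
  have b2 : |y| * (k * |deriv Real.smoothTransition (k * (b - t) - 1)|) ≤ K * M := by
    have := hM (k * (b - t)) (mul_nonneg hk (by linarith [ht.2]))
    calc _ ≤ K * (b - t) * (k * |deriv Real.smoothTransition (k * (b - t) - 1)|) :=
          mul_le_mul_of_nonneg_right h2 (by positivity)
      _ = K * (k * (b - t) * |deriv Real.smoothTransition (k * (b - t) - 1)|) := by ring
      _ ≤ _ := mul_le_mul_of_nonneg_left this hK
  have s1 := Real.smoothTransition.nonneg (k * (t - a) - 1)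
  have s2 := Real.smoothTransition.nonneg (k * (b - t) - 1)
  have s3 := Real.smoothTransition.le_one (k * (t - a) - 1)
  have s4 := Real.smoothTransition.le_one (k * (b - t) - 1)
  rw [mul_add]
  refine (abs_add_le _ _).trans ?_
  simp only [abs_mul, abs_neg, abs_one, mul_one, abs_of_nonneg hk, abs_of_nonneg s1,
    abs_of_nonneg s2]
  set A := |deriv Real.smoothTransition (k * (t - a) - 1)|
  set B := |deriv Real.smoothTransition (k * (b - t) - 1)|
  have f1 : |y| * (A * k * Real.smoothTransition (k * (b - t) - 1)) ≤ |y| * (k * A) * 1 := by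
    rw [show |y| * (A * k * Real.smoothTransition (k * (b - t) - 1)) =
      |y| * (k * A) * Real.smoothTransition (k * (b - t) - 1) by ring]
    exact mul_le_mul_of_nonneg_left s4 (by positivity)
  have f2 : |y| * (Real.smoothTransition (k * (t - a) - 1) * (B * k)) ≤ |y| * (k * B) * 1 := by
    rw [show |y| * (Real.smoothTransition (k * (t - a) - 1) * (B * k)) =
      |y| * (k * B) * Real.smoothTransition (k * (t - a) - 1) by ring]
    exact mul_le_mul_of_nonneg_left s3 (by positivity)
  linarith

/-- The product cutoff function of a box. -/
def boxCutoff (a b : Fin n → ℝ) (k : ℝ) : EuclideanSpace ℝ (Fin n) → ℝ :=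
  prodFun fun j => cutoff (a j) (b j) k

lemma contDiff_boxCutoff (a b : Fin n → ℝ) (k : ℝ) : ContDiff ℝ ∞ (boxCutoff a b k) :=
  contDiff_prodFun fun _ => contDiff_cutoff _ _ _

lemma abs_prod_cutoff_le (s : Finset (Fin n)) (a b : Fin n → ℝ) (k : ℝ)
    (x : EuclideanSpace ℝ (Fin n)) : |∏ j ∈ s, cutoff (a j) (b j) k (x j)| ≤ 1 := by
  rw [abs_of_nonneg (Finset.prod_nonneg fun j _ => cutoff_nonneg _ _ _ _)]
  exact Finset.prod_le_one (fun j _ => cutoff_nonneg _ _ _ _) fun j _ => cutoff_le_one _ _ _ _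

lemma support_boxCutoff_subset (a b : Fin n → ℝ) {k : ℝ} (hk : 0 < k) :
    ∃ K, IsCompact K ∧ K ⊆ openBox a b ∧ Function.support (boxCutoff a b k) ⊆ K := by
  refine ⟨closedBox (fun j => a j + 1 / k) (fun j => b j - 1 / k), isCompact_closedBox _ _,
    fun x hx j => ?_, fun x hx j => ?_⟩
  · have := hx j
    have h1 : 0 < 1 / k := by positivity
    exact ⟨by linarith [this.1], by linarith [this.2]⟩
  · have h : cutoff (a j) (b j) k (x j) ≠ 0 := fun h0 =>
      hx (Finset.prod_eq_zero (Finset.mem_univ j) h0)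
    have := cutoff_ne_zero h
    have h1 : 1 / k ≤ x j - a j := by rw [div_le_iff₀ hk]; linarith [this.1]
    have h2 : 1 / k ≤ b j - x j := by rw [div_le_iff₀ hk]; linarith [this.2]
    exact ⟨by linarith, by linarith⟩

lemma eventually_interior {a b : Fin n → ℝ} {x : EuclideanSpace ℝ (Fin n)} (hx : x ∈ openBox a b) :
    ∀ᶠ k : ℕ in atTop, ∀ j, 2 < ((k : ℝ) + 1) * (x j - a j) ∧ 2 < ((k : ℝ) + 1) * (b j - x j) := by
  rw [eventually_all]
  intro j
  have h1 : Tendsto (fun k : ℕ => (k : ℝ) + 1) atTop atTop :=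
    tendsto_atTop_add_const_right _ _ tendsto_natCast_atTop_atTop
  exact ((h1.atTop_mul_const (sub_pos.2 (hx j).1)).eventually_gt_atTop 2).and
    ((h1.atTop_mul_const (sub_pos.2 (hx j).2)).eventually_gt_atTop 2)

lemma integrable_L2 {X : Type*} [MeasurableSpace X] {μ : Measure X} [IsFiniteMeasure μ]
    {u : X → ℝ} (hu : MemLp u 2 μ) : Integrable u μ :=
  memLp_one_iff_integrable.1 (hu.mono_exponent (by norm_num))

/-- Integration by parts on a box against a smooth function vanishing on two opposite faces. -/
lemma HasWeakGradient.integral_mul_fderiv {a b : Fin n → ℝ} {u : L2 (openBox a b)}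
    {p : L2Vec (openBox a b)} (h : HasWeakGradient (openBox a b) u p) {i : Fin n}
    {η : EuclideanSpace ℝ (Fin n) → ℝ} (hη : ContDiff ℝ ∞ η) {K : ℝ} (hK : 0 ≤ K)
    (h1 : ∀ x ∈ openBox a b, |η x| ≤ K * (x i - a i))
    (h2 : ∀ x ∈ openBox a b, |η x| ≤ K * (b i - x i)) :
    ∫ x in openBox a b, u x * fderiv ℝ η x (EuclideanSpace.single i 1) =
      - ∫ x in openBox a b, p x i * η x := by
  obtain ⟨M, hM⟩ := exists_bound_mul_deriv_cutoff
  set χ : ℕ → EuclideanSpace ℝ (Fin n) → ℝ := fun k => boxCutoff a b ((k : ℝ) + 1) with hχ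
  have hkpos : ∀ k : ℕ, (0 : ℝ) < (k : ℝ) + 1 := fun k => by positivity
  have hχs : ∀ k, ContDiff ℝ ∞ (χ k) := fun k => contDiff_boxCutoff a b _
  have hχ1 : ∀ k x, |χ k x| ≤ 1 := fun k x => abs_prod_cutoff_le Finset.univ a b _ x
  have hdχ : ∀ k x, fderiv ℝ (χ k) x (EuclideanSpace.single i 1) =
      deriv (cutoff (a i) (b i) ((k : ℝ) + 1)) (x i) *
        ∏ j ∈ Finset.univ.erase i, cutoff (a j) (b j) ((k : ℝ) + 1) (x j) := fun k x => by
    rw [hχ]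
    simp only [boxCutoff]
    rw [fderiv_prodFun fun j => (contDiff_cutoff _ _ _).differentiable (by simp),
      prodFun_update_apply]
  have hfd : ∀ k x, fderiv ℝ (fun x => η x * χ k x) x (EuclideanSpace.single i 1) =
      fderiv ℝ η x (EuclideanSpace.single i 1) * χ k x +
        η x * fderiv ℝ (χ k) x (EuclideanSpace.single i 1) := fun k x => by
    rw [fderiv_fun_mul (hη.differentiable (by simp) x) ((hχs k).differentiable (by simp) x)]
    simp only [add_apply, smul_apply, smul_eq_mul]
    ring
  -- The product of η with the cutoff is an admissible test function.
  have hid : ∀ k, ∫ x in openBox a b, u x * fderiv ℝ (fun x => η x * χ k x) x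
      (EuclideanSpace.single i 1) = - ∫ x in openBox a b, p x i * (η x * χ k x) := fun k => by
    obtain ⟨S, hS1, hS2, hS3⟩ := support_boxCutoff_subset a b (hkpos k)
    have hsub : tsupport (fun x => η x * χ k x) ⊆ S :=
      closure_minimal (fun x hx => hS3 (right_ne_zero_of_mul hx)) hS1.isClosed
    exact h _ (hη.mul (hχs k)) (HasCompactSupport.of_support_subset_isCompact hS1
      (subset_tsupport _ |>.trans hsub)) (hsub.trans hS2) i
  have hu : Integrable u (volume.restrict (openBox a b)) := integrable_L2 (Lp.memLp u)
  have hp : Integrable (fun x => p x i) (volume.restrict (openBox a b)) :=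
    integrable_L2 ((L2Tendsto.mk (l := atTop) (fun _ : ℕ => Lp.memLp p) (Lp.memLp p) (by simp)).coord i).memLp_lim
  have hηd : Continuous fun x => fderiv ℝ η x (EuclideanSpace.single i 1) :=
    (hη.continuous_fderiv (by simp)).clm_apply continuous_const
  obtain ⟨C₁, hC₁⟩ := exists_bound_closedBox (a := a) (b := b) hη.continuous.continuousOn
  obtain ⟨C₂, hC₂⟩ := exists_bound_closedBox (a := a) (b := b) hηd.continuousOn
  have lim1 : Tendsto (fun k => ∫ x in openBox a b, p x i * (η x * χ k x)) atTop
      (𝓝 (∫ x in openBox a b, p x i * η x)) := by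
    refine tendsto_integral_of_dominated_convergence (fun x => ‖p x i‖ * C₁)
      (fun k => hp.1.mul (hη.continuous.mul (hχs k).continuous).aestronglyMeasurable)
      (hp.norm.mul_const _) (fun k => ?_) ?_
    · filter_upwards [ae_mem_openBox a b] with x hx
      rw [norm_mul, norm_mul]
      have := hC₁ x (openBox_subset_closedBox a b hx)
      refine mul_le_mul_of_nonneg_left ?_ (norm_nonneg _)
      calc ‖η x‖ * ‖χ k x‖ ≤ ‖η x‖ * 1 := mul_le_mul_of_nonneg_left (hχ1 k x) (norm_nonneg _)
        _ ≤ C₁ := by simpa using this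
    · filter_upwards [ae_mem_openBox a b] with x hx
      refine tendsto_const_nhds.congr' ?_
      filter_upwards [eventually_interior hx] with k hk
      have : χ k x = 1 := Finset.prod_eq_one (s := Finset.univ)
        (f := fun j => cutoff (a j) (b j) ((k : ℝ) + 1) (x j)) fun j _ => cutoff_eq_one (hk j).1.le (hk j).2.le
      rw [this, mul_one]
  have lim2 : Tendsto (fun k => ∫ x in openBox a b, u x * fderiv ℝ (fun x => η x * χ k x) x
      (EuclideanSpace.single i 1)) atTop
      (𝓝 (∫ x in openBox a b, u x * fderiv ℝ η x (EuclideanSpace.single i 1))) := by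
    refine tendsto_integral_of_dominated_convergence (fun x => ‖u x‖ * (C₂ + K * M))
      (fun k => hu.1.mul ?_) (hu.norm.mul_const _) (fun k => ?_) ?_
    · exact (((hη.mul (hχs k)).continuous_fderiv (by simp)).clm_apply
        continuous_const).aestronglyMeasurable
    · filter_upwards [ae_mem_openBox a b] with x hx
      rw [norm_mul, hfd]
      refine mul_le_mul_of_nonneg_left ((norm_add_le _ _).trans (add_le_add ?_ ?_)) (norm_nonneg _)
      · have := hC₂ x (openBox_subset_closedBox a b hx)
        rw [norm_mul]
        calc _ ≤ ‖fderiv ℝ η x (EuclideanSpace.single i 1)‖ * 1 :=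
              mul_le_mul_of_nonneg_left (hχ1 k x) (norm_nonneg _)
          _ ≤ C₂ := by simpa using this
      -- Only the i-th derivative of the cutoff occurs, so η has to vanish linearly on the two faces
      -- xᵢ = aᵢ and xᵢ = bᵢ and on no others.
      · rw [hdχ, ← mul_assoc, norm_mul]
        have h3 := hM (a i) (b i) (k + 1) (x i) (η x) K (hkpos k).le
          (Ioo_subset_Icc_self (hx i)) hK (h1 x hx) (h2 x hx)
        calc _ ≤ ‖η x * deriv (cutoff (a i) (b i) ((k : ℝ) + 1)) (x i)‖ * 1 :=
              mul_le_mul_of_nonneg_left (abs_prod_cutoff_le _ _ _ _ _) (norm_nonneg _)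
          _ ≤ _ := by rw [mul_one]; exact h3
    · filter_upwards [ae_mem_openBox a b] with x hx
      refine tendsto_const_nhds.congr' ?_
      filter_upwards [eventually_interior hx] with k hk
      have : χ k x = 1 := Finset.prod_eq_one (s := Finset.univ)
        (f := fun j => cutoff (a j) (b j) ((k : ℝ) + 1) (x j)) fun j _ => cutoff_eq_one (hk j).1.le (hk j).2.le
      rw [hfd, hdχ, this, deriv_cutoff_eq_zero (hk i).1 (hk i).2]
      ring
  simp only [hid] at lim2
  exact tendsto_nhds_unique lim2 lim1.neg

end Robin

end

/-! ### Completeness of the Neumann cosine modes -/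

noncomputable section

namespace Robin

variable {n m : ℕ}

/-- The frequency `π / (bⱼ - aⱼ)` of the first Neumann mode in the `j`-th coordinate. -/
def freq (a b : Fin n → ℝ) (j : Fin n) : ℝ := Real.pi / (b j - a j)

/-- The Neumann modes `∏ⱼ cos(kⱼ π (xⱼ - aⱼ) / (bⱼ - aⱼ))` of a box. -/
def cosMode (a b : Fin n → ℝ) (k : Fin n → ℤ) : EuclideanSpace ℝ (Fin n) → ℝ :=
  prodFun fun j t => Real.cos (freq a b j * k j * (t - a j))

lemma cosMode_zero (a b : Fin n → ℝ) : cosMode a b 0 = 1 := by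
  funext x; simp [cosMode, prodFun]

lemma cosMode_update (a b : Fin n → ℝ) (k : Fin n → ℤ) (i : Fin n) (z : ℤ)
    (x : EuclideanSpace ℝ (Fin n)) :
    cosMode a b (Function.update k i z) x = Real.cos (freq a b i * z * (x i - a i)) *
      ∏ j ∈ Finset.univ.erase i, Real.cos (freq a b j * k j * (x j - a j)) := by
  rw [cosMode, prodFun_eq_mul _ i, Function.update_self]
  congr 1
  refine Finset.prod_congr rfl fun j hj => ?_
  rw [Function.update_of_ne (Finset.ne_of_mem_erase hj)]

/-- Product-to-sum formula: multiplying by the basic cosine shifts the i-th index by ±1. Integer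
indices avoid a separate case at kᵢ = 0. -/
lemma cos_mul_cosMode (a b : Fin n → ℝ) (k : Fin n → ℤ) (i : Fin n) :
    (fun x : EuclideanSpace ℝ (Fin n) => Real.cos (freq a b i * (x i - a i))) * cosMode a b k =
      (1 / 2 : ℝ) • (cosMode a b (Function.update k i (k i + 1)) +
        cosMode a b (Function.update k i (k i - 1))) := by
  funext x
  simp only [Pi.mul_apply, Pi.smul_apply, Pi.add_apply, smul_eq_mul]
  have h1 := cosMode_update a b k i (k i) x
  rw [Function.update_eq_self] at h1
  rw [h1, cosMode_update, cosMode_update, ← add_mul]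
  push_cast
  have e1 : freq a b i * (k i + 1) * (x i - a i) =
    freq a b i * k i * (x i - a i) + freq a b i * (x i - a i) := by ring
  have e2 : freq a b i * (k i - 1) * (x i - a i) =
    freq a b i * k i * (x i - a i) - freq a b i * (x i - a i) := by ring
  rw [e1, e2, Real.cos_add, Real.cos_sub]
  ring

lemma contDiff_cosMode (a b : Fin n → ℝ) (k : Fin n → ℤ) : ContDiff ℝ ∞ (cosMode a b k) :=
  contDiff_prodFun fun _ => by fun_prop

/-- The linear span of the Neumann modes. -/
def cosSpan (a b : Fin n → ℝ) : Submodule ℝ (EuclideanSpace ℝ (Fin n) → ℝ) :=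
  Submodule.span ℝ (range (cosMode a b))

lemma cos_mul_mem_cosSpan {a b : Fin n → ℝ} (i : Fin n) {G : EuclideanSpace ℝ (Fin n) → ℝ}
    (hG : G ∈ cosSpan a b) :
    (fun x : EuclideanSpace ℝ (Fin n) => Real.cos (freq a b i * (x i - a i))) * G ∈
      cosSpan a b := by
  induction hG using Submodule.span_induction with
  | mem x hx =>
    obtain ⟨k, rfl⟩ := hx
    rw [cos_mul_cosMode]
    exact Submodule.smul_mem _ _ (Submodule.add_mem _ (Submodule.subset_span ⟨_, rfl⟩)
      (Submodule.subset_span ⟨_, rfl⟩))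
  | zero => rw [mul_zero]; exact Submodule.zero_mem _
  | add x y _ _ hx hy => rw [mul_add]; exact Submodule.add_mem _ hx hy
  | smul c x _ hx => rw [mul_smul_comm]; exact Submodule.smul_mem _ _ hx

lemma integral_mul_cosSpan {a b : Fin n → ℝ} {u : EuclideanSpace ℝ (Fin n) → ℝ}
    (hu : MemLp u 2 (volume.restrict (openBox a b)))
    (h : ∀ k, ∫ x in openBox a b, u x * cosMode a b k x = 0)
    {G : EuclideanSpace ℝ (Fin n) → ℝ} (hG : G ∈ cosSpan a b) :
    Continuous G ∧ ∫ x in openBox a b, u x * G x = 0 := by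
  have hi : ∀ {G : EuclideanSpace ℝ (Fin n) → ℝ}, Continuous G →
      Integrable (fun x => u x * G x) (volume.restrict (openBox a b)) := fun hG =>
    hu.integrable_mul (memLp_openBox hG.continuousOn)
  induction hG using Submodule.span_induction with
  | mem x hx =>
    obtain ⟨k, rfl⟩ := hx
    exact ⟨(contDiff_cosMode a b k).continuous, h k⟩
  | zero => exact ⟨continuous_zero, by simp⟩
  | add x y _ _ hx hy =>
    refine ⟨hx.1.add hy.1, ?_⟩
    simp only [Pi.add_apply, mul_add]
    rw [integral_add (hi hx.1) (hi hy.1), hx.2, hy.2, add_zero]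
  | smul c x _ hx =>
    refine ⟨hx.1.const_smul c, ?_⟩
    simp only [Pi.smul_apply, smul_eq_mul, mul_left_comm (u _) c]
    rw [integral_const_mul, hx.2, mul_zero]

/-- Completeness of the Neumann modes in `L²` of a box. -/
lemma ae_eq_zero_of_cosMode {a b : Fin n → ℝ} (hab : ∀ i, a i < b i)
    {u : L2 (openBox a b)} (h : ∀ k, ∫ x in openBox a b, u x * cosMode a b k x = 0) : u = 0 := by
  have hu2 : MemLp u 2 (volume.restrict (openBox a b)) := Lp.memLp u
  have hu : Integrable u (volume.restrict (openBox a b)) := integrable_L2 hu2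
  have hcs : CompactSpace (closedBox a b) := isCompact_iff_compactSpace.1 (isCompact_closedBox a b)
  let c : Fin n → C(closedBox a b, ℝ) := fun i =>
    ⟨fun x => Real.cos (freq a b i * (x.1 i - a i)), by fun_prop⟩
  -- Stone-Weierstrass is applied to the algebra generated by the basic cosines. They separate
  -- points because each argument runs through [0, π], where cosine is injective.
  let A : Subalgebra ℝ C(closedBox a b, ℝ) := Algebra.adjoin ℝ (range c)
  have hsep : A.SeparatesPoints := by
    intro x y hxy
    obtain ⟨i, hi⟩ : ∃ i, x.1 i ≠ y.1 i := by
      by_contra! hall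
      exact hxy (Subtype.ext (by ext i; exact hall i))
    refine ⟨_, ⟨c i, Algebra.subset_adjoin ⟨i, rfl⟩, rfl⟩, fun heq => hi ?_⟩
    have hl : 0 < b i - a i := sub_pos.2 (hab i)
    have hmem : ∀ z : closedBox a b, freq a b i * (z.1 i - a i) ∈ Icc 0 Real.pi := fun z => by
      have h1 := (z.2 i).1
      have h2 := (z.2 i).2
      refine ⟨mul_nonneg (div_nonneg Real.pi_pos.le hl.le) (by linarith), ?_⟩
      rw [freq, div_mul_eq_mul_div, div_le_iff₀ hl]
      exact mul_le_mul_of_nonneg_left (by linarith) Real.pi_pos.le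
    have h3 := Real.injOn_cos (hmem x) (hmem y) heq
    have h4 : freq a b i ≠ 0 := (div_pos Real.pi_pos hl).ne'
    have := mul_left_cancel₀ h4 h3
    linarith
  -- The span of the modes is stable under multiplication by A; with G = 1 every element of A is the
  -- restriction of an element of the span. Stating it for all G makes the induction pass through
  -- products.
  have hA : ∀ g ∈ A, ∀ G ∈ cosSpan a b, ∃ G' ∈ cosSpan a b,
      ∀ x : closedBox a b, G' x = g x * G x := by
    intro g hg
    induction hg using Algebra.adjoin_induction with
    | mem x hx =>
      obtain ⟨i, rfl⟩ := hx
      exact fun G hG => ⟨_, cos_mul_mem_cosSpan i hG, fun x => rfl⟩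
    | algebraMap r => exact fun G hG => ⟨r • G, Submodule.smul_mem _ _ hG, fun x => rfl⟩
    | add x y _ _ hx hy =>
      intro G hG
      obtain ⟨G₁, h1, h1'⟩ := hx G hG
      obtain ⟨G₂, h2, h2'⟩ := hy G hG
      exact ⟨G₁ + G₂, Submodule.add_mem _ h1 h2, fun z => by simp [h1', h2', add_mul]⟩
    | mul x y _ _ hx hy =>
      intro G hG
      obtain ⟨G₂, h2, h2'⟩ := hy G hG
      obtain ⟨G₁, h1, h1'⟩ := hx G₂ h2
      exact ⟨G₁, h1, fun z => by simp [h1', h2', mul_assoc]⟩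
  have hone : (1 : EuclideanSpace ℝ (Fin n) → ℝ) ∈ cosSpan a b := by
    rw [← cosMode_zero a b]; exact Submodule.subset_span ⟨0, rfl⟩
  have hcont : ∀ φ : EuclideanSpace ℝ (Fin n) → ℝ, Continuous φ →
      ∫ x in openBox a b, φ x • u x = 0 := by
    intro φ hφ
    set I := ∫ x in openBox a b, ‖u x‖ with hI
    have hI0 : 0 ≤ I := integral_nonneg fun x => norm_nonneg _
    -- Replacing φ by a combination of modes within ε changes the integral by at most ε times the L¹
    -- norm of u, and the replaced integral is zero.
    have hle : ∀ ε > 0, |∫ x in openBox a b, φ x • u x| ≤ ε * I := by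
      intro ε hε
      obtain ⟨g, hg⟩ := ContinuousMap.exists_mem_subalgebra_near_continuous_of_separatesPoints A
        hsep (fun x => φ x) (hφ.comp continuous_subtype_val) ε hε
      obtain ⟨G, hG, hG'⟩ := hA g.1 g.2 1 hone
      obtain ⟨hGc, hG0⟩ := integral_mul_cosSpan hu2 h hG
      have hi : ∀ {G : EuclideanSpace ℝ (Fin n) → ℝ}, Continuous G →
          Integrable (fun x => u x * G x) (volume.restrict (openBox a b)) := fun hG =>
        hu2.integrable_mul (memLp_openBox hG.continuousOn)
      have e : ∫ x in openBox a b, φ x • u x = ∫ x in openBox a b, u x * (φ x - G x) := by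
        simp only [mul_sub, smul_eq_mul]
        rw [integral_sub (hi hφ) (hi hGc), hG0, sub_zero]
        simp only [mul_comm]
      rw [e, hI, ← integral_const_mul, ← Real.norm_eq_abs]
      refine norm_integral_le_of_norm_le (hu.norm.const_mul ε) ?_
      filter_upwards [ae_mem_openBox a b] with x hx
      have h1 := hg ⟨x, openBox_subset_closedBox a b hx⟩
      have h2 := hG' ⟨x, openBox_subset_closedBox a b hx⟩
      simp only [Pi.one_apply, mul_one] at h2
      rw [norm_mul, mul_comm ε, norm_sub_rev]
      refine mul_le_mul_of_nonneg_left ?_ (norm_nonneg _)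
      rw [h2]
      exact h1.le
    have h0 : |∫ x in openBox a b, φ x • u x| ≤ 0 := by
      refine le_of_forall_pos_le_add fun δ hδ => ?_
      have := hle (δ / (I + 1)) (by positivity)
      refine this.trans ?_
      rw [zero_add, div_mul_eq_mul_div, div_le_iff₀ (by linarith)]
      nlinarith
    exact abs_eq_zero.1 (le_antisymm h0 (abs_nonneg _))
  have hloc : LocallyIntegrableOn u (openBox a b) volume := IntegrableOn.locallyIntegrableOn hu
  have hae := (isOpen_openBox a b).ae_eq_zero_of_integral_contDiff_smul_eq_zero hloc
    fun φ hφ _ hsub => by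
      rw [← hcont φ hφ.continuous]
      refine (setIntegral_eq_integral_of_forall_compl_eq_zero fun x hx => ?_).symm
      rw [image_eq_zero_of_notMem_tsupport fun h' => hx (hsub h'), zero_smul]
  rw [Lp.eq_zero_iff_ae_eq_zero]
  exact (ae_restrict_iff' (isOpen_openBox a b).measurableSet).2 hae

end Robin

end

/-! ### Density of smooth functions in H¹ and existence of traces -/

noncomputable section

namespace Robin

variable {n m : ℕ}

/-- The Hilbert space `L²(Ω) ⊕ L²(Ω; ℝⁿ)`. -/
abbrev GraphSpace (Ω : Set (EuclideanSpace ℝ (Fin n))) : Type := WithLp 2 (L2 Ω × L2Vec Ω)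

section Graph

variable {Ω : Set (EuclideanSpace ℝ (Fin n))}

lemma inner_graph {U : EuclideanSpace ℝ (Fin n) → ℝ}
    {V : EuclideanSpace ℝ (Fin n) → EuclideanSpace ℝ (Fin n)}
    (hU : MemLp U 2 (volume.restrict Ω)) (hV : MemLp V 2 (volume.restrict Ω))
    (z : GraphSpace Ω) :
    inner ℝ (WithLp.toLp 2 (hU.toLp U, hV.toLp V) : GraphSpace Ω) z =
      (∫ x in Ω, z.fst x * U x) + ∫ x in Ω, inner ℝ (V x) (z.snd x) := by
  rw [WithLp.prod_inner_apply, L2.inner_def, L2.inner_def]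
  congr 1
  · refine integral_congr_ae ?_
    filter_upwards [hU.coeFn_toLp] with x hx
    simp only [hx]
    rfl
  · refine integral_congr_ae ?_
    filter_upwards [hV.coeFn_toLp] with x hx
    simp only [hx]
    rfl

/-- The conditions on a test function. -/
def IsTest (Ω : Set (EuclideanSpace ℝ (Fin n))) (φ : EuclideanSpace ℝ (Fin n) → ℝ) : Prop :=
  ContDiff ℝ ∞ φ ∧ HasCompactSupport φ ∧ tsupport φ ⊆ Ω

lemma IsTest.continuous_deriv {φ : EuclideanSpace ℝ (Fin n) → ℝ} (hφ : IsTest Ω φ)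
    (v : EuclideanSpace ℝ (Fin n)) : Continuous fun x => fderiv ℝ φ x v :=
  (hφ.1.continuous_fderiv (by simp)).clm_apply continuous_const

lemma IsTest.memLp_deriv {φ : EuclideanSpace ℝ (Fin n) → ℝ} (hφ : IsTest Ω φ) (i : Fin n) :
    MemLp (fun x => fderiv ℝ φ x (EuclideanSpace.single i 1)) 2 (volume.restrict Ω) :=
  (hφ.continuous_deriv _).memLp_of_hasCompactSupport (hφ.2.1.fderiv_apply ℝ _)

lemma IsTest.memLp_single {φ : EuclideanSpace ℝ (Fin n) → ℝ} (hφ : IsTest Ω φ) (i : Fin n) :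
    MemLp (fun x => φ x • EuclideanSpace.single i (1 : ℝ)) 2 (volume.restrict Ω) :=
  (hφ.1.continuous.smul continuous_const).memLp_of_hasCompactSupport hφ.2.1.smul_right

/-- The vector in `L²(Ω) ⊕ L²(Ω; ℝⁿ)` representing a test of the weak gradient. -/
def testVector {φ : EuclideanSpace ℝ (Fin n) → ℝ} (hφ : IsTest Ω φ) (i : Fin n) : GraphSpace Ω :=
  WithLp.toLp 2 ((hφ.memLp_deriv i).toLp _, (hφ.memLp_single i).toLp _)

/-- Being a weak gradient is orthogonality to a family of vectors of L² ⊕ L², so the pairs (u, ∇u)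
form a closed subspace. -/
lemma hasWeakGradient_iff (z : GraphSpace Ω) : HasWeakGradient Ω z.fst z.snd ↔
    ∀ φ (hφ : IsTest Ω φ) (i : Fin n), inner ℝ (testVector hφ i) z = 0 := by
  have key : ∀ φ (hφ : IsTest Ω φ) (i : Fin n), inner ℝ (testVector hφ i) z =
      (∫ x in Ω, z.fst x * fderiv ℝ φ x (EuclideanSpace.single i 1)) +
        ∫ x in Ω, z.snd x i * φ x := by
    intro φ hφ i
    rw [testVector, inner_graph]
    congr 1
    refine integral_congr_ae (ae_of_all _ fun x => ?_)
    simp only [inner_smul_left, EuclideanSpace.inner_single_left]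
    simp [mul_comm]
  constructor
  · intro h φ hφ i
    rw [key, h φ hφ.1 hφ.2.1 hφ.2.2 i]; ring
  · intro h φ h1 h2 h3 i
    have := (key φ ⟨h1, h2, h3⟩ i).symm.trans (h φ ⟨h1, h2, h3⟩ i)
    linarith

lemma isClosed_hasWeakGradient :
    IsClosed {z : GraphSpace Ω | HasWeakGradient Ω z.fst z.snd} := by
  simp only [hasWeakGradient_iff, ofPred_forall]
  exact isClosed_iInter fun φ => isClosed_iInter fun hφ => isClosed_iInter fun i =>
    isClosed_eq (by fun_prop) continuous_const

lemma HasWeakGradient.sub {z w : GraphSpace Ω} (hz : HasWeakGradient Ω z.fst z.snd)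
    (hw : HasWeakGradient Ω w.fst w.snd) :
    HasWeakGradient Ω (z - w).fst (z - w).snd := by
  rw [hasWeakGradient_iff] at *
  intro φ hφ i
  rw [inner_sub_right, hz φ hφ i, hw φ hφ i, sub_zero]

lemma gradient_add' {f g : EuclideanSpace ℝ (Fin n) → ℝ} (hf : Differentiable ℝ f)
    (hg : Differentiable ℝ g) (x : EuclideanSpace ℝ (Fin n)) :
    gradient (f + g) x = gradient f x + gradient g x := by
  simp only [gradient]
  rw [fderiv_add (hf x) (hg x), map_add]

lemma gradient_smul' {f : EuclideanSpace ℝ (Fin n) → ℝ} (hf : Differentiable ℝ f) (c : ℝ)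
    (x : EuclideanSpace ℝ (Fin n)) : gradient (c • f) x = c • gradient f x := by
  simp only [gradient]
  rw [fderiv_const_smul (hf x), map_smul]

/-- The pairs `(f, ∇f)` with `f` smooth on `ℝⁿ`. -/
def smoothGraph (Ω : Set (EuclideanSpace ℝ (Fin n))) : Submodule ℝ (GraphSpace Ω) where
  carrier := {z | ∃ f : EuclideanSpace ℝ (Fin n) → ℝ, ContDiff ℝ ∞ f ∧
    z.fst =ᵐ[volume.restrict Ω] f ∧ z.snd =ᵐ[volume.restrict Ω] gradient f}
  add_mem' := by
    rintro z w ⟨f, hf, h1, h2⟩ ⟨g, hg, h3, h4⟩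
    refine ⟨f + g, hf.add hg, (Lp.coeFn_add _ _).trans (h1.add h3), ?_⟩
    refine (Lp.coeFn_add _ _).trans ((h2.add h4).trans (ae_of_all _ fun x => ?_))
    exact (gradient_add' (hf.differentiable (by simp)) (hg.differentiable (by simp)) x).symm
  zero_mem' := by
    refine ⟨0, contDiff_const, Lp.coeFn_zero _ _ _, (Lp.coeFn_zero _ _ _).trans ?_⟩
    refine ae_of_all _ fun x => ?_
    simp [gradient]
  smul_mem' := by
    rintro c z ⟨f, hf, h1, h2⟩
    refine ⟨c • f, contDiff_const.smul hf, (Lp.coeFn_smul _ _).trans (h1.const_smul c), ?_⟩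
    refine (Lp.coeFn_smul _ _).trans ((h2.const_smul c).trans (ae_of_all _ fun x => ?_))
    exact (gradient_smul' (hf.differentiable (by simp)) c x).symm

/-- The gradient of a smooth function is its weak gradient. -/
lemma integral_mul_fderiv_test {f φ : EuclideanSpace ℝ (Fin n) → ℝ} (hf : ContDiff ℝ ∞ f)
    (hφ : IsTest Ω φ) (i : Fin n) :
    ∫ x in Ω, f x * fderiv ℝ φ x (EuclideanSpace.single i 1) =
      - ∫ x in Ω, gradient f x i * φ x := by
  have e1 : ∫ x in Ω, f x * fderiv ℝ φ x (EuclideanSpace.single i 1) =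
      ∫ x, f x * fderiv ℝ φ x (EuclideanSpace.single i 1) := by
    refine setIntegral_eq_integral_of_forall_compl_eq_zero fun x hx => ?_
    rw [fderiv_of_notMem_tsupport ℝ fun h => hx (hφ.2.2 h)]; simp
  have e2 : ∫ x in Ω, gradient f x i * φ x = ∫ x, gradient f x i * φ x := by
    refine setIntegral_eq_integral_of_forall_compl_eq_zero fun x hx => ?_
    rw [image_eq_zero_of_notMem_tsupport fun h => hx (hφ.2.2 h), mul_zero]
  have hfd : Continuous fun x => fderiv ℝ f x (EuclideanSpace.single i 1) :=
    (hf.continuous_fderiv (by simp)).clm_apply continuous_const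
  rw [e1, e2]
  simp only [gradient_apply]
  refine integral_mul_fderiv_eq_neg_fderiv_mul_of_integrable ?_ ?_ ?_
    (fun x _ => hf.differentiable (by simp) x) (fun x _ => hφ.1.differentiable (by simp) x)
  · exact (hfd.mul hφ.1.continuous).integrable_of_hasCompactSupport hφ.2.1.mul_left
  · exact (hf.continuous.mul (hφ.continuous_deriv _)).integrable_of_hasCompactSupport
      (hφ.2.1.fderiv_apply ℝ _).mul_left
  · exact (hf.continuous.mul hφ.1.continuous).integrable_of_hasCompactSupport hφ.2.1.mul_left

lemma hasWeakGradient_of_smooth {u : L2 Ω} {p : L2Vec Ω} {f : EuclideanSpace ℝ (Fin n) → ℝ}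
    (hf : ContDiff ℝ ∞ f) (h1 : u =ᵐ[volume.restrict Ω] f)
    (h2 : p =ᵐ[volume.restrict Ω] gradient f) : HasWeakGradient Ω u p := by
  intro φ a1 a2 a3 i
  have := integral_mul_fderiv_test hf ⟨a1, a2, a3⟩ i
  rw [← integral_congr_ae (show (fun x => u x * fderiv ℝ φ x (EuclideanSpace.single i 1))
      =ᵐ[volume.restrict Ω] fun x => f x * fderiv ℝ φ x (EuclideanSpace.single i 1) by
      filter_upwards [h1] with x hx; rw [hx]), ← integral_congr_ae
    (show (fun x => p x i * φ x) =ᵐ[volume.restrict Ω] fun x => gradient f x i * φ x by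
      filter_upwards [h2] with x hx; rw [hx])] at this
  exact this

end Graph

/-- The fundamental lemma of the calculus of variations, one component at a time. -/
lemma hasWeakGradient_zero {a b : Fin n → ℝ} {p : L2Vec (openBox a b)}
    (h : HasWeakGradient (openBox a b) 0 p) : p = 0 := by
  have hi : ∀ i, ∀ᵐ x ∂(volume.restrict (openBox a b)), p x i = 0 := by
    intro i
    have hp : Integrable (fun x => p x i) (volume.restrict (openBox a b)) :=
      integrable_L2 ((L2Tendsto.mk (l := atTop) (fun _ : ℕ => Lp.memLp p) (Lp.memLp p)
        (by simp)).coord i).memLp_lim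
    have hloc : LocallyIntegrableOn (fun x => p x i) (openBox a b) volume :=
      IntegrableOn.locallyIntegrableOn hp
    have hae := (isOpen_openBox a b).ae_eq_zero_of_integral_contDiff_smul_eq_zero hloc
      fun φ hφ hc hsub => by
        have h1 := h φ hφ hc hsub i
        have h2 : ∫ x in openBox a b, (0 : L2 (openBox a b)) x *
            fderiv ℝ φ x (EuclideanSpace.single i 1) = 0 := by
          refine integral_eq_zero_of_ae ?_
          filter_upwards [Lp.coeFn_zero ℝ 2 (volume.restrict (openBox a b))] with x hx
          rw [hx]; simp
        rw [h2] at h1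
        have h3 : ∫ x in openBox a b, p x i * φ x = 0 := by linarith
        rw [← h3]
        simp only [smul_eq_mul, mul_comm (φ _)]
        refine (setIntegral_eq_integral_of_forall_compl_eq_zero fun x hx => ?_).symm
        rw [image_eq_zero_of_notMem_tsupport fun h' => hx (hsub h'), mul_zero]
    exact (ae_restrict_iff' (isOpen_openBox a b).measurableSet).2 hae
  rw [Lp.eq_zero_iff_ae_eq_zero]
  filter_upwards [eventually_all.2 hi] with x hx
  ext i; exact hx i

/-- The weak gradient is unique. -/
lemma HasWeakGradient.unique {a b : Fin n → ℝ} {u : L2 (openBox a b)} {p q : L2Vec (openBox a b)}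
    (hp : HasWeakGradient (openBox a b) u p) (hq : HasWeakGradient (openBox a b) u q) : p = q := by
  have := HasWeakGradient.sub (z := WithLp.toLp 2 (u, p)) (w := WithLp.toLp 2 (u, q)) hp hq
  have h2 : HasWeakGradient (openBox a b) 0 (p - q) := by simpa using this
  exact sub_eq_zero.1 (hasWeakGradient_zero h2)

lemma HasWeakGradient.weakGradient_eq {a b : Fin n → ℝ} {u : L2 (openBox a b)}
    {p : L2Vec (openBox a b)} (h : HasWeakGradient (openBox a b) u p) :
    weakGradient (openBox a b) u = p := by
  have hm : MemH1 (openBox a b) u := ⟨p, h⟩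
  rw [weakGradient, dif_pos hm]
  exact hm.choose_spec.unique h

lemma MemH1.hasWeakGradient {Ω : Set (EuclideanSpace ℝ (Fin n))} {u : L2 Ω} (h : MemH1 Ω u) :
    HasWeakGradient Ω u (weakGradient Ω u) := by
  rw [weakGradient, dif_pos h]
  exact h.choose_spec

lemma fderiv_cosMode (a b : Fin n → ℝ) (k : Fin n → ℤ) (i : Fin n)
    (x : EuclideanSpace ℝ (Fin n)) :
    fderiv ℝ (cosMode a b k) x (EuclideanSpace.single i 1) =
      prodFun (Function.update (fun j t => Real.cos (freq a b j * k j * (t - a j))) i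
        fun t => -(freq a b i * k i) * Real.sin (freq a b i * k i * (t - a i))) x := by
  rw [cosMode, fderiv_prodFun fun j => by fun_prop]
  congr 2
  funext t
  have := ((((hasDerivAt_id t).sub_const (a i)).const_mul (freq a b i * k i)).cos).deriv
  simp only [id, mul_one] at this
  rw [this]; ring

/-- Test against (f, ∇f) for a Neumann mode f. As ∂ᵢf vanishes on the faces orthogonal to the i-th
axis, integration by parts gives ∫ ∇f · p = (∑ cᵢ²) ∫ u f, where cᵢ are the frequencies of f.
Orthogonality reads (1 + ∑ cᵢ²) ∫ u f = 0, so u is orthogonal to all modes and vanishes, and p with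
it. -/
lemma orthogonal_smoothGraph {a b : Fin n → ℝ} (hab : ∀ i, a i < b i)
    {z : GraphSpace (openBox a b)} (hz : HasWeakGradient (openBox a b) z.fst z.snd)
    (ho : z ∈ (smoothGraph (openBox a b))ᗮ) : z = 0 := by
  have hu : z.fst = 0 := by
    refine ae_eq_zero_of_cosMode hab fun k => ?_
    set f := cosMode a b k with hf
    have hfs : ContDiff ℝ ∞ f := contDiff_cosMode a b k
    have hf1 : ContDiff ℝ 1 f := hfs.of_le (by simp)
    have m1 : MemLp f 2 (volume.restrict (openBox a b)) :=
      memLp_openBox hf1.continuous.continuousOn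
    have m2 : MemLp (gradient f) 2 (volume.restrict (openBox a b)) :=
      memLp_openBox (continuous_gradient hf1).continuousOn
    have h0 := (Submodule.mem_orthogonal _ _).1 ho (WithLp.toLp 2 (m1.toLp f, m2.toLp (gradient f)))
      ⟨f, hfs, m1.coeFn_toLp, m2.coeFn_toLp⟩
    rw [inner_graph] at h0
    set I := ∫ x in openBox a b, z.fst x * f x with hI
    have hcoord : ∀ i, Integrable (fun x => gradient f x i * z.snd x i)
        (volume.restrict (openBox a b)) := fun i =>
      ((L2Tendsto.mk (l := atTop) (fun _ : ℕ => m2) m2 (by simp)).coord i).memLp_lim.integrable_mul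
        ((L2Tendsto.mk (l := atTop) (fun _ : ℕ => Lp.memLp z.snd) (Lp.memLp z.snd) (by simp)).coord i).memLp_lim
    have e : ∫ x in openBox a b, inner ℝ (gradient f x) (z.snd x) =
        ∑ i, (freq a b i * k i) ^ 2 * I := by
      have e1 : ∀ x, inner ℝ (gradient f x) (z.snd x) = ∑ i, gradient f x i * z.snd x i := by
        intro x
        rw [PiLp.inner_apply]
        exact Finset.sum_congr rfl fun i _ => by simp [mul_comm]
      simp only [e1]
      rw [integral_finsetSum _ fun i _ => hcoord i]
      refine Finset.sum_congr rfl fun i _ => ?_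
      set c := freq a b i * k i with hc
      set g := Function.update (fun j t => Real.cos (freq a b j * k j * (t - a j))) i
        fun t => -c * Real.sin (c * (t - a i)) with hg
      have hgs : ∀ j, ContDiff ℝ ∞ (g j) := by
        intro j
        by_cases hj : j = i
        · subst hj; rw [hg, Function.update_self]; fun_prop
        · rw [hg, Function.update_of_ne hj]; fun_prop
      have hl : 0 < b i - a i := sub_pos.2 (hab i)
      have hprod : ∀ x : EuclideanSpace ℝ (Fin n), |∏ j ∈ Finset.univ.erase i,
          Real.cos (freq a b j * k j * (x j - a j))| ≤ 1 := fun x => by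
        rw [Finset.abs_prod]
        exact Finset.prod_le_one (fun j _ => abs_nonneg _) fun j _ => Real.abs_cos_le_one _
      have habs : ∀ x : EuclideanSpace ℝ (Fin n), |prodFun g x| ≤
          |c| * |Real.sin (c * (x i - a i))| := fun x => by
        rw [hg, prodFun_update_apply, abs_mul, abs_mul, abs_neg]
        exact mul_le_of_le_one_right (by positivity) (hprod x)
      -- Applied at the zeros 0 and kᵢπ of the sine, this bounds |∂ᵢf| linearly near the lower and
      -- the upper face. One factor |c| comes from differentiating the cosine, the other from the
      -- argument of the sine.
      have hlip : ∀ s t : ℝ, Real.sin s = 0 → |Real.sin t| ≤ |t - s| := fun s t hs => by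
        have e : Real.sin t = Real.sin (t - s) * Real.cos s := by
          rw [Real.sin_sub, hs]
          have := Real.sin_sq_add_cos_sq s
          rw [hs] at this
          linear_combination (-Real.sin t) * this
        rw [e, abs_mul]
        exact (mul_le_of_le_one_right (abs_nonneg _) (Real.abs_cos_le_one _)).trans
          Real.abs_sin_le_abs
      have key := hz.integral_mul_fderiv (i := i) (contDiff_prodFun hgs) (K := |c| * |c|)
        (by positivity)
        (fun x hx => by
          refine (habs x).trans ?_
          rw [mul_assoc |c| |c|]
          refine mul_le_mul_of_nonneg_left ((hlip 0 _ Real.sin_zero).trans ?_) (abs_nonneg _)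
          rw [sub_zero, abs_mul, abs_of_pos (sub_pos.2 (hx i).1)])
        (fun x hx => by
          refine (habs x).trans ?_
          rw [mul_assoc |c| |c|]
          refine mul_le_mul_of_nonneg_left ((hlip (k i * Real.pi) _
            (Real.sin_int_mul_pi _)).trans ?_) (abs_nonneg _)
          have : c * (x i - a i) - k i * Real.pi = -(c * (b i - x i)) := by
            rw [hc, freq]; field_simp; ring
          rw [this, abs_neg, abs_mul, abs_of_pos (sub_pos.2 (hx i).2)])
      have hgf : ∀ x, gradient f x i = prodFun g x := fun x => by
        rw [gradient_apply, hf, fderiv_cosMode]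
      have hgd : ∀ x, fderiv ℝ (prodFun g) x (EuclideanSpace.single i 1) = -(c ^ 2) * f x := by
        intro x
        rw [fderiv_prodFun fun j => (hgs j).differentiable (by simp)]
        have h1 : deriv (g i) = fun t => -(c ^ 2) * Real.cos (c * (t - a i)) := by
          funext t
          rw [hg, Function.update_self]
          have := (((((hasDerivAt_id t).sub_const (a i)).const_mul c).sin).const_mul (-c)).deriv
          simp only [id, mul_one] at this
          rw [this]; ring
        rw [h1, hg, Function.update_idem, prodFun_update_apply, hf, cosMode, prodFun_eq_mul _ i]
        ring
      simp only [hgd, hgf, mul_left_comm (z.fst _) (-(c ^ 2))] at key ⊢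
      rw [integral_const_mul] at key
      simp only [mul_comm (prodFun g _)]
      linarith
    rw [e, ← Finset.sum_mul] at h0
    have hnn : 0 ≤ ∑ i, (freq a b i * k i) ^ 2 := Finset.sum_nonneg fun i _ => sq_nonneg _
    have h1 : (1 + ∑ i, (freq a b i * k i) ^ 2) * I = 0 := by linarith
    rcases mul_eq_zero.1 h1 with h2 | h2
    · linarith
    · exact h2
  have hp : z.snd = 0 := by
    rw [hu] at hz
    exact hasWeakGradient_zero hz
  exact (WithLp.ofLp_injective 2) (Prod.ext hu hp)

/-- Functions that are smooth on `ℝⁿ` are dense in `H¹` of a box. -/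
theorem exists_smooth_approx {a b : Fin n → ℝ} (hab : ∀ i, a i < b i) {u : L2 (openBox a b)}
    (hu : MemH1 (openBox a b) u) : ∃ φ : ℕ → EuclideanSpace ℝ (Fin n) → ℝ,
      (∀ j, ContDiff ℝ ∞ (φ j)) ∧ L2Tendsto (volume.restrict (openBox a b)) atTop φ u ∧
      L2Tendsto (volume.restrict (openBox a b)) atTop (fun j => gradient (φ j))
        (weakGradient (openBox a b) u) := by
  set z : GraphSpace (openBox a b) := WithLp.toLp 2 (u, weakGradient (openBox a b) u) with hz
  have hzW : HasWeakGradient (openBox a b) z.fst z.snd := hu.hasWeakGradient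
  set H := (smoothGraph (openBox a b)).topologicalClosure with hH
  have hHc : IsClosed (H : Set (GraphSpace (openBox a b))) := Submodule.isClosed_topologicalClosure _
  have : CompleteSpace H := hHc.completeSpace_coe
  have hHW : ∀ y ∈ H, HasWeakGradient (openBox a b) y.fst y.snd := by
    intro y hy
    refine closure_minimal (s := (smoothGraph (openBox a b) : Set (GraphSpace (openBox a b)))) ?_
      isClosed_hasWeakGradient hy
    rintro w ⟨f, hf, h1, h2⟩
    exact hasWeakGradient_of_smooth hf h1 h2
  -- The part w of (u, ∇u) orthogonal to the closed span of smooth graphs is itself a function with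
  -- its weak gradient, because the graph condition is closed and linear; hence w = 0.
  obtain ⟨y, hy, w, hw, hyw⟩ := H.exists_add_mem_mem_orthogonal z
  have hwe : w = z - y := by rw [hyw]; abel
  have hw0 : w = 0 := by
    refine orthogonal_smoothGraph hab ?_ (Submodule.orthogonal_le
      (Submodule.le_topologicalClosure _) hw)
    rw [hwe]
    exact hzW.sub (hHW y hy)
  have hzH : z ∈ closure (smoothGraph (openBox a b) : Set (GraphSpace (openBox a b))) := by
    rw [hyw, hw0, add_zero]; exact hy
  obtain ⟨s, hs, hlim⟩ := mem_closure_iff_seq_limit.1 hzH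
  choose φ hφ h1 h2 using hs
  have hφ1 : ∀ j, ContDiff ℝ 1 (φ j) := fun j => (hφ j).of_le (by simp)
  have l1 : Tendsto (fun j => (s j).fst) atTop (𝓝 u) :=
    ((WithLp.prod_continuous_ofLp 2 _ _).fst.tendsto z).comp hlim
  have l2 : Tendsto (fun j => (s j).snd) atTop (𝓝 (weakGradient (openBox a b) u)) :=
    ((WithLp.prod_continuous_ofLp 2 _ _).snd.tendsto z).comp hlim
  refine ⟨φ, hφ, ⟨fun j => memLp_openBox (hφ j).continuous.continuousOn, Lp.memLp _, ?_⟩,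
    ⟨fun j => memLp_openBox (continuous_gradient (hφ1 j)).continuousOn, Lp.memLp _, ?_⟩⟩
  · rw [Lp.tendsto_Lp_iff_tendsto_eLpNorm'] at l1
    refine l1.congr fun j => eLpNorm_congr_ae ?_
    filter_upwards [h1 j] with x hx
    simp [hx]
  · rw [Lp.tendsto_Lp_iff_tendsto_eLpNorm'] at l2
    refine l2.congr fun j => eLpNorm_congr_ae ?_
    filter_upwards [h2 j] with x hx
    simp [hx]

/-- The linear vector field with outer normal component `1` on the boundary of a box. -/
lemma normalField_linear {a b : Fin n → ℝ} (hab : ∀ i, a i < b i) :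
    NormalField a b 1 (fun i t => (2 * t - a i - b i) / (b i - a i))
      (fun i _ => 2 / (b i - a i)) where
  cont i := by fun_prop
  cont' i := continuousOn_const
  hasDeriv i t _ := by
    have := ((((hasDerivAt_id t).const_mul 2).sub_const (a i)).sub_const (b i)).div_const (b i - a i)
    simpa using this
  upper i := by rw [div_eq_one_iff_eq (sub_pos.2 (hab i)).ne']; ring
  lower i := by rw [div_eq_iff (sub_pos.2 (hab i)).ne']; ring

/-- Every `u ∈ H¹` of a box has a trace. -/
theorem exists_hasTrace {a b : Fin (m + 1) → ℝ} (hab : ∀ i, a i < b i) {u : L2 (openBox a b)}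
    (hu : MemH1 (openBox a b) u) : ∃ g, HasTrace (openBox a b) u g := by
  obtain ⟨φ, hφ, t1, t2⟩ := exists_smooth_approx hab hu
  have hφ1 : ∀ j, ContDiff ℝ 1 (φ j) := fun j => (hφ j).of_le (by simp)
  have hmem : ∀ j, MemLp (φ j) 2 (surfaceMeasure (openBox a b)) := fun j =>
    continuous_memLp_surface hab (hφ j).continuous
  -- With β = 1 the boundary form is the squared L² norm on the boundary. Applied to differences of
  -- approximants, it shows that their boundary values are Cauchy.
  have hN := normalField_linear hab
  have hf : Tendsto Prod.fst (atTop : Filter (ℕ × ℕ)) atTop := by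
    rw [← prod_atTop_atTop_eq]; exact tendsto_fst
  have hs : Tendsto Prod.snd (atTop : Filter (ℕ × ℕ)) atTop := by
    rw [← prod_atTop_atTop_eq]; exact tendsto_snd
  have c1 : L2Tendsto (volume.restrict (openBox a b)) atTop (fun (k : ℕ × ℕ) x => φ k.1 x - φ k.2 x)
      fun x => u x - u x := (t1.comp hf).sub (t1.comp hs)
  have c2 : L2Tendsto (volume.restrict (openBox a b)) atTop
      (fun (k : ℕ × ℕ) x => gradient (φ k.1) x - gradient (φ k.2) x)
      fun x => weakGradient (openBox a b) u x - weakGradient (openBox a b) u x :=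
    (t2.comp hf).sub (t2.comp hs)
  have c3 := tendsto_boundaryForm hN c1 c2
  have e0 : boundaryForm a b (fun i t => (2 * t - a i - b i) / (b i - a i))
      (fun i _ => 2 / (b i - a i)) (fun x => u x - u x)
      (fun x => weakGradient (openBox a b) u x - weakGradient (openBox a b) u x) = 0 := by
    simp [boundaryForm]
  rw [e0] at c3
  have e1 : ∀ k : ℕ × ℕ, dist ((hmem k.1).toLp (φ k.1)) ((hmem k.2).toLp (φ k.2)) ^ 2 =
      boundaryForm a b (fun i t => (2 * t - a i - b i) / (b i - a i))
      (fun i _ => 2 / (b i - a i)) (fun x => φ k.1 x - φ k.2 x)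
      (fun x => gradient (φ k.1) x - gradient (φ k.2) x) := fun k => by
    have hg : (fun x => gradient (φ k.1) x - gradient (φ k.2) x) =
        gradient (fun x => φ k.1 x - φ k.2 x) := by
      funext x
      simp only [gradient]
      rw [fderiv_fun_sub ((hφ1 _).differentiable (by simp) x)
        ((hφ1 _).differentiable (by simp) x), map_sub]
    rw [hg, ← boundary_eq_boundaryForm hab hN ((hφ1 _).sub (hφ1 _)), one_mul, dist_eq_norm,
      ← MemLp.toLp_sub, ← real_inner_self_eq_norm_sq, L2.inner_def]
    refine integral_congr_ae ?_
    filter_upwards [((hmem k.1).sub (hmem k.2)).coeFn_toLp] with x hx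
    rw [hx]
    simp [pow_two]
  have hcau : CauchySeq fun j => (hmem j).toLp (φ j) := by
    rw [cauchySeq_iff_tendsto_dist_atTop_0]
    have := c3.sqrt
    rw [Real.sqrt_zero] at this
    refine this.congr fun k => ?_
    rw [← e1, Real.sqrt_sq dist_nonneg]
  obtain ⟨g, hg⟩ := cauchySeq_tendsto_of_complete hcau
  refine ⟨g, φ, hφ, t1.tendsto, t2.tendsto, ?_⟩
  rw [Lp.tendsto_Lp_iff_tendsto_eLpNorm'] at hg
  refine hg.congr fun j => eLpNorm_congr_ae ?_
  filter_upwards [(hmem j).coeFn_toLp] with x hx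
  simp [hx]

end Robin

end

/-! ### One-dimensional Poincaré inequality for the ground state transform -/

noncomputable section

namespace Robin

variable {n m : ℕ}

namespace IsRobinPair

variable {α L μ₁ μ₂ : ℝ} {φ χ : ℝ → ℝ}

lemma hasDerivAt_φ (h : IsRobinPair α L μ₁ μ₂ φ χ) (t : ℝ) : HasDerivAt φ (deriv φ t) t :=
  (h.φ_smooth.differentiable (by simp) t).hasDerivAt

lemma hasDerivAt_χ (h : IsRobinPair α L μ₁ μ₂ φ χ) (t : ℝ) : HasDerivAt χ (deriv χ t) t :=
  (h.χ_smooth.differentiable (by simp) t).hasDerivAt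

lemma χ_zero (h : IsRobinPair α L μ₁ μ₂ φ χ) : χ 0 = 0 := by
  have := h.χ_odd 0; simp at this; linarith

lemma continuous_deriv_φ (h : IsRobinPair α L μ₁ μ₂ φ χ) : Continuous (deriv φ) :=
  h.φ_smooth.continuous_deriv (by simp)

lemma continuous_deriv_χ (h : IsRobinPair α L μ₁ μ₂ φ χ) : Continuous (deriv χ) :=
  h.χ_smooth.continuous_deriv (by simp)

/-- Both v and χ vanish at 0 and χ has nonzero slope there, so v/χ has a limit, and the remaining
factor v χ' tends to 0. -/
lemma tendsto_sq_mul_logDeriv (h : IsRobinPair α L μ₁ μ₂ φ χ) {v : ℝ → ℝ}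
    (hv : Differentiable ℝ v) (hv0 : v 0 = 0) :
    Tendsto (fun t => v t ^ 2 * (deriv χ t / χ t)) (𝓝[>] 0) (𝓝 0) := by
  have s1 : Tendsto (fun t => t⁻¹ * v t) (𝓝[>] 0) (𝓝 (deriv v 0)) := by
    have := (hasDerivAt_iff_tendsto_slope.1 (hv 0).hasDerivAt).mono_left
      (nhdsWithin_mono 0 fun t (ht : 0 < t) => ht.ne')
    refine this.congr fun t => ?_
    simp [slope_def_field, hv0, div_eq_inv_mul]
  have s2 : Tendsto (fun t => t⁻¹ * χ t) (𝓝[>] 0) (𝓝 (deriv χ 0)) := by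
    have := (hasDerivAt_iff_tendsto_slope.1 (h.hasDerivAt_χ 0)).mono_left
      (nhdsWithin_mono 0 fun t (ht : 0 < t) => ht.ne')
    refine this.congr fun t => ?_
    simp [slope_def_field, h.χ_zero, div_eq_inv_mul]
  have s3 : Tendsto (fun t => v t * deriv χ t) (𝓝[>] 0) (𝓝 0) := by
    have : Tendsto (fun t => v t * deriv χ t) (𝓝 0) (𝓝 (v 0 * deriv χ 0)) :=
      (hv.continuous.mul h.continuous_deriv_χ).tendsto 0
    rw [hv0, zero_mul] at this
    exact this.mono_left nhdsWithin_le_nhds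
  have s4 := s3.mul (s1.div s2 h.χ_deriv.ne')
  rw [zero_mul] at s4
  refine s4.congr' ?_
  filter_upwards [self_mem_nhdsWithin] with t (ht : 0 < t)
  simp only [Pi.div_apply]
  rw [mul_div_mul_left _ _ (inv_ne_zero ht.ne')]
  ring

/-- A Picone-type identity: (v' − vφ'/φ)² − (μ₂ − μ₁)v² equals the derivative of v²(χ'/χ − φ'/φ)
plus (v' − vχ'/χ)². On (0, L) the excited state has no zero, and the total derivative integrates to
zero. -/
lemma half_poincare (h : IsRobinPair α L μ₁ μ₂ φ χ) {v : ℝ → ℝ} (hv : ContDiff ℝ 1 v)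
    (hv0 : v 0 = 0) : (μ₂ - μ₁) * ∫ t in (0 : ℝ)..L, v t ^ 2 ≤
      ∫ t in (0 : ℝ)..L, (deriv v t - v t * (deriv φ t / φ t)) ^ 2 := by
  have hL := h.pos
  have hvd : Differentiable ℝ v := hv.differentiable (by simp)
  have hvd' : Continuous (deriv v) := hv.continuous_deriv (by simp)
  have hφ : ∀ t ∈ Icc 0 L, 0 < φ t := fun t ht => h.φ_pos t ⟨by linarith [ht.1], ht.2⟩
  have hφc := h.φ_smooth.continuous
  have hχc := h.χ_smooth.continuous
  have hφ' := h.continuous_deriv_φ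
  have hχ' := h.continuous_deriv_χ
  set H : ℝ → ℝ := fun t => v t ^ 2 * (deriv χ t / χ t) - v t ^ 2 * (deriv φ t / φ t) with hH
  have hqc : ContinuousOn (fun t => deriv φ t / φ t) (Icc 0 L) :=
    hφ'.continuousOn.div hφc.continuousOn fun t ht => (hφ t ht).ne'
  have hHc : ContinuousOn H (Icc 0 L) := by
    refine ContinuousOn.sub ?_ ((hvd.continuous.pow 2).continuousOn.mul hqc)
    intro t ht
    rcases ht.1.eq_or_lt with h0 | h0
    · subst h0
      have h1 := h.tendsto_sq_mul_logDeriv hvd hv0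
      have h2 : ContinuousWithinAt (fun t => v t ^ 2 * (deriv χ t / χ t)) (Ioi 0) 0 := by
        rw [ContinuousWithinAt, hv0]
        simpa using h1
      exact (continuousWithinAt_Ioi_iff_Ici.1 h2).mono Icc_subset_Ici_self
    · exact (((hvd.continuous.pow 2).continuousAt).mul (hχ'.continuousAt.div hχc.continuousAt
        (h.χ_pos t ⟨h0, ht.2⟩).ne')).continuousWithinAt
  have hgc : ContinuousOn (fun t => (deriv v t - v t * (deriv φ t / φ t)) ^ 2 -
      (μ₂ - μ₁) * v t ^ 2) (Icc 0 L) :=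
    ((hvd'.continuousOn.sub (hvd.continuous.continuousOn.mul hqc)).pow 2).sub
      ((hvd.continuous.pow 2).continuousOn.const_mul _)
  have key := intervalIntegral.sub_le_integral_of_hasDeriv_right_of_le (g := H)
    (g' := fun t => 2 * v t * deriv v t * (deriv χ t / χ t - deriv φ t / φ t) +
      v t ^ 2 * (-μ₂ - (deriv χ t / χ t) ^ 2 + μ₁ + (deriv φ t / φ t) ^ 2)) hL.le hHc
    (fun t ht => by
      have hχt := (h.χ_pos t ⟨ht.1, ht.2.le⟩).ne'
      have hφt := (hφ t (Ioo_subset_Icc_self ht)).ne'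
      have d1 := ((h.χ_eq t).div (h.hasDerivAt_χ t) hχt)
      have d2 := ((h.φ_eq t).div (h.hasDerivAt_φ t) hφt)
      have d3 := (hvd t).hasDerivAt.pow 2
      refine (((d3.mul d1).sub (d3.mul d2)).congr_deriv ?_).hasDerivWithinAt
      simp only [Nat.cast_ofNat, Pi.pow_apply, Pi.div_apply]
      field_simp
      ring)
    (hgc.integrableOn_compact isCompact_Icc)
    (fun t ht => by
      nlinarith [sq_nonneg (deriv v t - v t * (deriv χ t / χ t))])
  -- At L both logarithmic derivatives equal −α; at 0 the factor v² vanishes.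
  have e1 : H L - H 0 = 0 := by
    have h1 := (h.χ_pos L ⟨hL, le_rfl⟩).ne'
    have h2 := (hφ L ⟨hL.le, le_rfl⟩).ne'
    simp only [hH, hv0, h.χ_bdry, h.φ_bdry, mul_div_assoc, div_self h1, div_self h2]
    ring
  rw [e1, intervalIntegral.integral_sub, intervalIntegral.integral_const_mul] at key
  · linarith
  · refine ContinuousOn.intervalIntegrable ?_
    rw [uIcc_of_le hL.le]
    exact (hvd'.continuousOn.sub (hvd.continuous.continuousOn.mul hqc)).pow 2
  · exact ((hvd.continuous.pow 2).const_mul _).intervalIntegrable _ _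

lemma deriv_φ_neg (h : IsRobinPair α L μ₁ μ₂ φ χ) (t : ℝ) : deriv φ (-t) = -deriv φ t := by
  have h1 : (fun t => φ (-t)) = φ := funext h.φ_even
  have h2 := deriv_comp_neg φ t
  rw [h1] at h2
  linarith

lemma deriv_χ_neg (h : IsRobinPair α L μ₁ μ₂ φ χ) (t : ℝ) : deriv χ (-t) = deriv χ t := by
  have h1 : (fun t => χ (-t)) = fun t => -χ t := funext h.χ_odd
  have h2 := deriv_comp_neg χ t
  rw [h1, deriv.fun_neg] at h2
  linarith

/-- Poincaré inequality for the ground state transform on a symmetric interval. -/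
lemma poincare (h : IsRobinPair α L μ₁ μ₂ φ χ) {u : ℝ → ℝ} (hu : ContDiff ℝ 1 u) :
    ∃ κ, (μ₂ - μ₁) * ∫ t in (-L)..L, (u t - κ * φ t) ^ 2 ≤
      ∫ t in (-L)..L, (deriv u t - u t * (deriv φ t / φ t)) ^ 2 := by
  have hL := h.pos
  have hφ0 : φ 0 ≠ 0 := (h.φ_pos 0 ⟨by linarith, hL.le⟩).ne'
  -- This κ makes u − κφ vanish at 0, the zero of χ, so that each half of the interval can be
  -- treated alone. Subtracting κφ leaves u' − uφ'/φ unchanged. The orthogonal projection is not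
  -- needed here, since it only makes the left side smaller.
  refine ⟨u 0 / φ 0, ?_⟩
  set κ := u 0 / φ 0 with hκ
  set v : ℝ → ℝ := fun t => u t - κ * φ t with hv
  have hv1 : ContDiff ℝ 1 v := hu.sub (contDiff_const.mul (h.φ_smooth.of_le (by simp)))
  have hv0 : v 0 = 0 := by simp only [hv, hκ]; rw [div_mul_cancel₀ _ hφ0, sub_self]
  have hud : Differentiable ℝ u := hu.differentiable (by simp)
  have hvd : Differentiable ℝ v := hv1.differentiable (by simp)
  have hvu : ∀ t ∈ Icc (-L) L, deriv v t - v t * (deriv φ t / φ t) =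
      deriv u t - u t * (deriv φ t / φ t) := fun t ht => by
    have h1 : deriv v t = deriv u t - κ * deriv φ t :=
      ((hud t).hasDerivAt.sub ((h.hasDerivAt_φ t).const_mul κ)).deriv
    have h2 := (h.φ_pos t ht).ne'
    rw [h1]; simp only [hv]; field_simp; ring
  have e1 : ∫ t in (-L)..L, (deriv u t - u t * (deriv φ t / φ t)) ^ 2 =
      ∫ t in (-L)..L, (deriv v t - v t * (deriv φ t / φ t)) ^ 2 := by
    refine intervalIntegral.integral_congr fun t ht => ?_
    rw [uIcc_of_le (by linarith)] at ht
    rw [hvu t ht]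
  have hcont : ContinuousOn (fun t => (deriv v t - v t * (deriv φ t / φ t)) ^ 2) (Icc (-L) L) :=
    (((hv1.continuous_deriv (by simp)).continuousOn).sub (hvd.continuous.continuousOn.mul
      (h.continuous_deriv_φ.continuousOn.div h.φ_smooth.continuous.continuousOn
        fun t ht => (h.φ_pos t ht).ne'))).pow 2
  have i1 : IntervalIntegrable (fun t => (deriv v t - v t * (deriv φ t / φ t)) ^ 2) volume (-L) 0 :=
    (hcont.mono (by rw [uIcc_of_le (by linarith)]; exact Icc_subset_Icc_right hL.le)).intervalIntegrable
  have i2 : IntervalIntegrable (fun t => (deriv v t - v t * (deriv φ t / φ t)) ^ 2) volume 0 L :=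
    (hcont.mono (by rw [uIcc_of_le hL.le]; exact Icc_subset_Icc_left (by linarith))).intervalIntegrable
  have hvc : Continuous fun t => v t ^ 2 := hvd.continuous.pow 2
  rw [e1, ← intervalIntegral.integral_add_adjacent_intervals i1 i2,
    ← intervalIntegral.integral_add_adjacent_intervals (hvc.intervalIntegrable (-L) 0)
      (hvc.intervalIntegrable 0 L), mul_add]
  refine add_le_add ?_ (h.half_poincare hv1 hv0)
  -- The left half follows by reflection; φ'/φ is odd.
  have hneg := h.half_poincare (v := fun t => v (-t)) (hv1.comp contDiff_neg) (by simpa using hv0)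
  have f1 : ∫ t in (0 : ℝ)..L, v (-t) ^ 2 = ∫ t in (-L)..0, v t ^ 2 := by
    have := intervalIntegral.integral_comp_neg (a := 0) (b := L) fun t => v t ^ 2
    simpa using this
  have f2 : ∫ t in (0 : ℝ)..L, (deriv (fun t => v (-t)) t - v (-t) * (deriv φ t / φ t)) ^ 2 =
      ∫ t in (-L)..0, (deriv v t - v t * (deriv φ t / φ t)) ^ 2 := by
    have := intervalIntegral.integral_comp_neg (a := 0) (b := L)
      fun t => (deriv v t - v t * (deriv φ t / φ t)) ^ 2
    rw [neg_zero] at this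
    rw [← this]
    congr 1
    funext t
    rw [deriv_comp_neg, h.deriv_φ_neg, h.φ_even]
    ring
  rw [f1, f2] at hneg
  exact hneg

end IsRobinPair

end Robin

end

/-! ### Tensorization over a product measure -/

noncomputable section

namespace Robin

variable {n m : ℕ}

/-- Bounded measurable functions. -/
def BddMeas {X : Type*} [MeasurableSpace X] (f : X → ℝ) : Prop :=
  Measurable f ∧ ∃ C, ∀ x, |f x| ≤ C

namespace BddMeas

variable {X Y : Type*} [MeasurableSpace X] [MeasurableSpace Y] {f g : X → ℝ}

lemma mul (hf : BddMeas f) (hg : BddMeas g) : BddMeas fun x => f x * g x := by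
  obtain ⟨C, hC⟩ := hf.2
  obtain ⟨D, hD⟩ := hg.2
  refine ⟨hf.1.mul hg.1, C * D, fun x => ?_⟩
  rw [abs_mul]
  exact mul_le_mul (hC x) (hD x) (abs_nonneg _) ((abs_nonneg _).trans (hC x))

lemma sub (hf : BddMeas f) (hg : BddMeas g) : BddMeas fun x => f x - g x := by
  obtain ⟨C, hC⟩ := hf.2
  obtain ⟨D, hD⟩ := hg.2
  exact ⟨hf.1.sub hg.1, C + D, fun x => (abs_sub _ _).trans (add_le_add (hC x) (hD x))⟩

lemma pow_two (hf : BddMeas f) : BddMeas fun x => f x ^ 2 := by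
  simpa only [_root_.pow_two] using hf.mul hf

lemma const (c : ℝ) : BddMeas fun _ : X => c := ⟨measurable_const, |c|, fun _ => le_rfl⟩

lemma prod {ι : Type*} {s : Finset ι} {f : ι → X → ℝ} (hf : ∀ i, BddMeas (f i)) :
    BddMeas fun x => ∏ i ∈ s, f i x := by
  classical
  induction s using Finset.induction_on with
  | empty => simpa using const (X := X) 1
  | insert i s hi ih => simpa only [Finset.prod_insert hi] using (hf i).mul ih

lemma comp (hf : BddMeas f) {k : Y → X} (hk : Measurable k) : BddMeas fun y => f (k y) :=
  ⟨hf.1.comp hk, hf.2.imp fun _ hC y => hC (k y)⟩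

lemma integrable (hf : BddMeas f) (μ : Measure X) [IsFiniteMeasure μ] : Integrable f μ := by
  obtain ⟨C, hC⟩ := hf.2
  exact Integrable.of_bound hf.1.aestronglyMeasurable C (ae_of_all _ hC)

lemma integral {F : X → Y → ℝ} (hF : BddMeas fun p : X × Y => F p.1 p.2) (μ : Measure Y)
    [IsFiniteMeasure μ] : BddMeas fun x => ∫ y, F x y ∂μ := by
  obtain ⟨C, hC⟩ := hF.2
  refine ⟨(hF.1.stronglyMeasurable.integral_prod_right' (ν := μ)).measurable,
    C * μ.real univ, fun x => ?_⟩
  rw [← Real.norm_eq_abs]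
  exact norm_integral_le_of_norm_le_const (ae_of_all _ fun y => hC (x, y))

end BddMeas

/-- Pythagoras for the unit vector φ. The last term measures how far κ is from the optimal
coefficient ∫ fφ. -/
lemma integral_sub_mul_sq {X : Type*} [MeasurableSpace X] {μ : Measure X} [IsFiniteMeasure μ]
    {f φ : X → ℝ} (hf : BddMeas f) (hφ : BddMeas φ) (h1 : ∫ x, φ x ^ 2 ∂μ = 1) (κ : ℝ) :
    ∫ x, (f x - φ x * κ) ^ 2 ∂μ = ∫ x, f x ^ 2 ∂μ - (∫ x, f x * φ x ∂μ) ^ 2 +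
      (∫ x, f x * φ x ∂μ - κ) ^ 2 := by
  have e : ∀ x, (f x - φ x * κ) ^ 2 = f x ^ 2 - (2 * κ * (f x * φ x) - κ ^ 2 * φ x ^ 2) :=
    fun x => by ring
  simp only [e]
  have i1 := hf.pow_two.integrable μ
  have i2 := ((hf.mul hφ).integrable μ).const_mul (2 * κ)
  have i3 := (hφ.pow_two.integrable μ).const_mul (κ ^ 2)
  have i4 : Integrable (fun x => 2 * κ * (f x * φ x) - κ ^ 2 * φ x ^ 2) μ := i2.sub i3
  rw [integral_sub i1 i4, integral_sub i2 i3, integral_const_mul, integral_const_mul, h1]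
  ring

lemma sq_integral_mul_le {X : Type*} [MeasurableSpace X] {μ : Measure X} [IsFiniteMeasure μ]
    {f φ : X → ℝ} (hf : BddMeas f) (hφ : BddMeas φ) (h1 : ∫ x, φ x ^ 2 ∂μ = 1) :
    (∫ x, f x * φ x ∂μ) ^ 2 ≤ ∫ x, f x ^ 2 ∂μ := by
  have h2 := integral_sub_mul_sq hf hφ h1 (∫ x, f x * φ x ∂μ)
  have h3 : 0 ≤ ∫ x, (f x - φ x * ∫ x, f x * φ x ∂μ) ^ 2 ∂μ := integral_nonneg fun x => sq_nonneg _
  rw [h2] at h3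
  simp at h3
  exact h3

lemma measurable_insertNth (i : Fin (m + 1)) :
    Measurable fun p : ℝ × (Fin m → ℝ) => (i.insertNth p.1 p.2 : Fin (m + 1) → ℝ) :=
  (MeasurableEquiv.piFinSuccAbove (fun _ => ℝ) i).symm.measurable

lemma integral_pi_insertNth (μ : Fin (m + 1) → Measure ℝ) [∀ i, IsFiniteMeasure (μ i)]
    (i : Fin (m + 1)) {f : (Fin (m + 1) → ℝ) → ℝ} (hf : Integrable f (Measure.pi μ)) :
    ∫ x, f x ∂(Measure.pi μ) =
      ∫ y, ∫ s, f (i.insertNth s y) ∂(μ i) ∂(Measure.pi fun j => μ (i.succAbove j)) := by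
  have hmp := (measurePreserving_piFinSuccAbove μ i).symm
  have hint := (hmp.integrable_comp_emb
    (MeasurableEquiv.piFinSuccAbove (fun _ => ℝ) i).symm.measurableEmbedding).2 hf
  rw [← hmp.integral_comp' f]
  exact integral_prod_symm _ hint

lemma measurable_update_pair (i : Fin n) :
    Measurable fun p : (Fin n → ℝ) × ℝ => Function.update p.1 i p.2 :=
  measurable_update'

/-- The component of `u` orthogonal to `φᵢ` in the `i`-th variable. -/
def coordFluct (μ : Fin n → Measure ℝ) (φ : Fin n → ℝ → ℝ) (i : Fin n) (u : (Fin n → ℝ) → ℝ)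
    (x : Fin n → ℝ) : ℝ :=
  u x - φ i (x i) * ∫ t, u (Function.update x i t) * φ i t ∂(μ i)

lemma bddMeas_coordFluct (μ : Fin n → Measure ℝ) [∀ i, IsFiniteMeasure (μ i)]
    {φ : Fin n → ℝ → ℝ} (hφ : ∀ i, BddMeas (φ i)) (i : Fin n) {u : (Fin n → ℝ) → ℝ}
    (hu : BddMeas u) : BddMeas (coordFluct μ φ i u) :=
  hu.sub (((hφ i).comp (measurable_pi_apply i)).mul (BddMeas.integral
    (F := fun x t => u (Function.update x i t) * φ i t)
    ((hu.comp (measurable_update_pair i)).mul ((hφ i).comp measurable_snd)) (μ i)))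

/-- Tensorization of the variance (Efron-Stein inequality), in a form relative to a product of
normalized functions. -/
theorem tensorization : ∀ {n : ℕ} (μ : Fin n → Measure ℝ) [∀ i, IsFiniteMeasure (μ i)]
    (φ : Fin n → ℝ → ℝ) (_ : ∀ i, BddMeas (φ i)) (_ : ∀ i, ∫ t, φ i t ^ 2 ∂(μ i) = 1)
    (u : (Fin n → ℝ) → ℝ) (_ : BddMeas u),
    ∫ x, u x ^ 2 ∂(Measure.pi μ) - (∫ x, u x * ∏ i, φ i (x i) ∂(Measure.pi μ)) ^ 2 ≤
      ∑ i, ∫ x, coordFluct μ φ i u x ^ 2 ∂(Measure.pi μ) := by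
  intro n
  induction n with
  | zero =>
    intro μ _ φ _ _ u _
    rw [Measure.pi_of_empty μ (fun i => i.elim0)]
    simp
  | succ n ih =>
    intro μ _ φ hφ h1 u hu
    set μ' : Fin n → Measure ℝ := fun i => μ i.succ with hμ'
    set ν := Measure.pi μ' with hν
    have hdec : ∀ {f : (Fin (n + 1) → ℝ) → ℝ}, BddMeas f → ∫ x, f x ∂(Measure.pi μ) =
        ∫ y, ∫ s, f (Fin.cons s y) ∂(μ 0) ∂ν := fun {f} hf => by
      rw [integral_pi_insertNth μ 0 (hf.integrable _)]
      simp only [Fin.insertNth_zero', Fin.succAbove_zero]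
      rfl
    have hcons : Measurable fun p : (Fin n → ℝ) × ℝ => (Fin.cons p.2 p.1 : Fin (n + 1) → ℝ) := by
      have := (measurable_insertNth (m := n) 0).comp measurable_swap
      simp only [Fin.insertNth_zero'] at this
      exact this
    have hcu : BddMeas fun p : (Fin n → ℝ) × ℝ => u (Fin.cons p.2 p.1) := hu.comp hcons
    -- The induction hypothesis is applied to the coefficient U of u along φ₀ in the variable 0.
    set U : (Fin n → ℝ) → ℝ := fun y => ∫ s, u (Fin.cons s y) * φ 0 s ∂(μ 0) with hU
    have hUb : BddMeas U := BddMeas.integral (F := fun y s => u (Fin.cons s y) * φ 0 s)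
      (hcu.mul ((hφ 0).comp measurable_snd)) (μ 0)
    have hs : ∀ y, BddMeas fun s => u (Fin.cons s y) := fun y =>
      hcu.comp (measurable_const.prodMk measurable_id)
    have IH := ih μ' (fun i => φ i.succ) (fun i => hφ _) (fun i => h1 _) U hUb
    -- Pythagoras in the variable 0, for each value of the other variables.
    have e0 : ∫ x, u x ^ 2 ∂(Measure.pi μ) =
        ∫ y, U y ^ 2 ∂ν + ∫ x, coordFluct μ φ 0 u x ^ 2 ∂(Measure.pi μ) := by
      rw [hdec hu.pow_two, hdec (bddMeas_coordFluct μ hφ 0 hu).pow_two, ← integral_add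
        (hUb.pow_two.integrable _)]
      · refine integral_congr_ae (ae_of_all _ fun y => ?_)
        simp only [coordFluct, Fin.cons_zero, Fin.update_cons_zero]
        rw [integral_sub_mul_sq (hs y) (hφ 0) (h1 0)]
        simp only [hU]
        ring
      · exact (BddMeas.integral (F := fun y s => coordFluct μ φ 0 u (Fin.cons s y) ^ 2)
          ((bddMeas_coordFluct μ hφ 0 hu).comp hcons).pow_two (μ 0)).integrable _
    have e1 : ∫ x, u x * ∏ i, φ i (x i) ∂(Measure.pi μ) =
        ∫ y, U y * ∏ i, φ i.succ (y i) ∂ν := by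
      rw [hdec (hu.mul (BddMeas.prod fun i => (hφ i).comp (measurable_pi_apply i)))]
      refine integral_congr_ae (ae_of_all _ fun y => ?_)
      simp only [hU, Fin.prod_univ_succ, Fin.cons_zero, Fin.cons_succ]
      rw [← integral_mul_const]
      congr 1
      funext s
      ring
    -- Taking the coefficient along φ₀ commutes with the fluctuation in any other variable (Fubini),
    -- and by Cauchy-Schwarz it does not increase the L² norm.
    have e2 : ∀ i : Fin n, ∫ y, coordFluct μ' (fun i => φ i.succ) i U y ^ 2 ∂ν ≤
        ∫ x, coordFluct μ φ i.succ u x ^ 2 ∂(Measure.pi μ) := by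
      intro i
      have hD := bddMeas_coordFluct μ hφ i.succ hu
      rw [hdec hD.pow_two]
      refine integral_mono ((bddMeas_coordFluct μ' (fun i => hφ _) i hUb).pow_two.integrable _)
        ((BddMeas.integral (F := fun y s => coordFluct μ φ i.succ u (Fin.cons s y) ^ 2)
          (hD.comp hcons).pow_two (μ 0)).integrable _) fun y => ?_
      have hDy : BddMeas fun s => coordFluct μ φ i.succ u (Fin.cons s y) :=
        (hD.comp hcons).comp (measurable_const.prodMk measurable_id)
      refine le_trans (le_of_eq ?_) (sq_integral_mul_le hDy (hφ 0) (h1 0))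
      congr 1
      have hF : BddMeas fun p : ℝ × ℝ =>
          u (Fin.cons p.1 (Function.update y i p.2)) * φ i.succ p.2 * φ 0 p.1 :=
        ((hcu.comp (((measurable_update_pair i).comp
          (measurable_const.prodMk measurable_snd)).prodMk measurable_fst)).mul
          ((hφ i.succ).comp measurable_snd)).mul ((hφ 0).comp measurable_fst)
      have hsw : ∫ s, (∫ t, u (Fin.cons s (Function.update y i t)) * φ i.succ t ∂(μ i.succ)) *
          φ 0 s ∂(μ 0) = ∫ t, U (Function.update y i t) * φ i.succ t ∂(μ i.succ) := by
        simp only [← integral_mul_const, hU]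
        rw [integral_integral_swap (hF.integrable _)]
        congr 1
        funext t
        congr 1
        funext s
        ring
      simp only [coordFluct, Fin.cons_succ, ← Fin.cons_update, sub_mul]
      have hI : BddMeas fun s =>
          ∫ t, u (Fin.cons s (Function.update y i t)) * φ i.succ t ∂(μ i.succ) :=
        BddMeas.integral (F := fun s t => u (Fin.cons s (Function.update y i t)) * φ i.succ t)
          ((hcu.comp (((measurable_update_pair i).comp
          (measurable_const.prodMk measurable_snd)).prodMk measurable_fst)).mul
          ((hφ i.succ).comp measurable_snd)) (μ i.succ)
      rw [integral_sub (((hs y).mul (hφ 0)).integrable _)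
        ((((BddMeas.const _).mul hI).mul (hφ 0)).integrable _)]
      simp only [mul_assoc]
      rw [integral_const_mul]
      rw [hsw]
    rw [Fin.sum_univ_succ, e0, e1]
    have := Finset.sum_le_sum fun i (_ : i ∈ Finset.univ) => e2 i
    linarith

end Robin

end

/-! ### Poincaré inequality on a box -/

noncomputable section

namespace Robin

variable {n m : ℕ}

lemma setIntegral_Icc_shift (a b : ℝ) (hab : a ≤ b) (F : ℝ → ℝ) :
    ∫ t in Icc a b, F (t - (a + b) / 2) = ∫ s in (-((b - a) / 2))..((b - a) / 2), F s := by
  rw [integral_Icc_eq_integral_Ioc, ← intervalIntegral.integral_of_le hab,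
    intervalIntegral.integral_comp_sub_right]
  congr 1 <;> ring

lemma IsRobinPair.poincare_Icc {α a b μ₁ μ₂ : ℝ} {φ χ : ℝ → ℝ}
    (h : IsRobinPair α ((b - a) / 2) μ₁ μ₂ φ χ) {u : ℝ → ℝ} (hu : ContDiff ℝ 1 u) :
    ∃ κ, (μ₂ - μ₁) * ∫ t in Icc a b, (u t - κ * φ (t - (a + b) / 2)) ^ 2 ≤
      ∫ t in Icc a b, (deriv u t -
        u t * (deriv φ (t - (a + b) / 2) / φ (t - (a + b) / 2))) ^ 2 := by
  have hab : a ≤ b := by linarith [h.pos]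
  set c := (a + b) / 2 with hc
  obtain ⟨κ, hκ⟩ := h.poincare (u := fun s => u (s + c)) (hu.comp (by fun_prop))
  refine ⟨κ, ?_⟩
  have e1 := setIntegral_Icc_shift a b hab fun s => (u (s + c) - κ * φ s) ^ 2
  have e2 := setIntegral_Icc_shift a b hab fun s =>
    (deriv (fun s => u (s + c)) s - u (s + c) * (deriv φ s / φ s)) ^ 2
  rw [← e1, ← e2] at hκ
  simpa only [deriv_comp_add_const, ← hc, sub_add_cancel] using hκ

/-- The ground state of the `i`-th edge, translated to the edge. -/
def edgeState (a b : Fin n → ℝ) (φ : Fin n → ℝ → ℝ) (i : Fin n) (t : ℝ) : ℝ :=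
  φ i (t - (a i + b i) / 2)

/-- The logarithmic derivative of the ground state of the `i`-th edge. -/
def edgeLog (a b : Fin n → ℝ) (φ : Fin n → ℝ → ℝ) (i : Fin n) (t : ℝ) : ℝ :=
  deriv (φ i) (t - (a i + b i) / 2) / φ i (t - (a i + b i) / 2)

section Edge

variable {α : ℝ} {a b μ₁ μ₂ : Fin n → ℝ} {φ χ : Fin n → ℝ → ℝ}

lemma edge_lt (hP : ∀ i, IsRobinPair α ((b i - a i) / 2) (μ₁ i) (μ₂ i) (φ i) (χ i)) (i : Fin n) :
    a i < b i := by linarith [(hP i).pos]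

lemma shift_mem {i : Fin n} {t : ℝ} (ht : t ∈ Icc (a i) (b i)) :
    t - (a i + b i) / 2 ∈ Icc (-((b i - a i) / 2)) ((b i - a i) / 2) :=
  ⟨by linarith [ht.1], by linarith [ht.2]⟩

lemma edgeState_pos (hP : ∀ i, IsRobinPair α ((b i - a i) / 2) (μ₁ i) (μ₂ i) (φ i) (χ i))
    {i : Fin n} {t : ℝ} (ht : t ∈ Icc (a i) (b i)) : 0 < edgeState a b φ i t :=
  (hP i).φ_pos _ (shift_mem ht)

lemma contDiff_edgeState (hP : ∀ i, IsRobinPair α ((b i - a i) / 2) (μ₁ i) (μ₂ i) (φ i) (χ i))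
    (i : Fin n) : ContDiff ℝ ∞ (edgeState a b φ i) :=
  (hP i).φ_smooth.comp (by fun_prop)

lemma continuousOn_edgeLog (hP : ∀ i, IsRobinPair α ((b i - a i) / 2) (μ₁ i) (μ₂ i) (φ i) (χ i))
    (i : Fin n) : ContinuousOn (edgeLog a b φ i) (Icc (a i) (b i)) :=
  (((hP i).continuous_deriv_φ.comp (by fun_prop)).continuousOn).div
    (contDiff_edgeState hP i).continuous.continuousOn fun _ ht => (edgeState_pos hP ht).ne'

end Edge

lemma insertNth_eq_add (i : Fin (m + 1)) (s : ℝ) (y : Fin m → ℝ) :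
    (i.insertNth s y : Fin (m + 1) → ℝ) = i.insertNth 0 y + s • Pi.single i 1 := by
  ext j
  rcases Fin.eq_self_or_eq_succAbove i j with rfl | ⟨k, rfl⟩
  · simp
  · simp

lemma contDiff_comp_insertNth {g : (Fin (m + 1) → ℝ) → ℝ} (hg : ContDiff ℝ 1 g)
    (i : Fin (m + 1)) (y : Fin m → ℝ) :
    ContDiff ℝ 1 (fun s => g (i.insertNth s y)) ∧
      ∀ s, deriv (fun s => g (i.insertNth s y)) s =
        fderiv ℝ g (i.insertNth s y) (Pi.single i 1) := by
  have heq : (fun s => g (i.insertNth s y)) = fun s => g (i.insertNth 0 y + s • Pi.single i 1) :=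
    funext fun s => by rw [insertNth_eq_add i s y]
  rw [heq]
  refine ⟨hg.comp (by fun_prop), fun s => ?_⟩
  rw [insertNth_eq_add i s y]
  have h1 : HasDerivAt (fun s : ℝ => (i.insertNth 0 y : Fin (m + 1) → ℝ) + s • Pi.single i (1 : ℝ))
      (Pi.single i 1) s := by
    simpa using ((hasDerivAt_id s).smul_const (Pi.single i (1 : ℝ) : Fin (m + 1) → ℝ)).const_add
      (i.insertNth 0 y : Fin (m + 1) → ℝ)
  exact ((hg.differentiable (by simp) _).hasFDerivAt.comp_hasDerivAt s h1).deriv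

lemma integrable_inner_insertNth (μ : Fin (m + 1) → Measure ℝ) [∀ i, IsFiniteMeasure (μ i)]
    (i : Fin (m + 1)) {f : (Fin (m + 1) → ℝ) → ℝ} (hf : Integrable f (Measure.pi μ)) :
    Integrable (fun y => ∫ s, f (i.insertNth s y) ∂(μ i))
      (Measure.pi fun j => μ (i.succAbove j)) := by
  have hmp := (measurePreserving_piFinSuccAbove μ i).symm
  have hint := (hmp.integrable_comp_emb
    (MeasurableEquiv.piFinSuccAbove (fun _ => ℝ) i).symm.measurableEmbedding).2 hf
  exact hint.integral_prod_right

/-- Lebesgue measure on the edges of a box. -/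
def edgeMeasure (a b : Fin n → ℝ) (i : Fin n) : Measure ℝ := volume.restrict (Icc (a i) (b i))

instance (a b : Fin n → ℝ) (i : Fin n) : IsFiniteMeasure (edgeMeasure a b i) := by
  unfold edgeMeasure; infer_instance

lemma pi_edgeMeasure (a b : Fin n → ℝ) :
    Measure.pi (edgeMeasure a b) = volume.restrict (Icc a b) := by
  unfold edgeMeasure
  rw [← pi_univ_Icc, volume_pi, Measure.restrict_pi_pi]

lemma insertNth_mem_Icc_iff {a b : Fin (m + 1) → ℝ} {i : Fin (m + 1)} {s : ℝ} {y : Fin m → ℝ} :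
    (i.insertNth s y : Fin (m + 1) → ℝ) ∈ Icc a b ↔ s ∈ Icc (a i) (b i) ∧
      y ∈ Icc (fun j => a (i.succAbove j)) fun j => b (i.succAbove j) := by
  simp only [mem_Icc, Pi.le_def, Fin.forall_iff_succAbove i, Fin.insertNth_apply_same,
    Fin.insertNth_apply_succAbove]
  tauto

section Coordinate

variable {α : ℝ} {a b μ₁ μ₂ : Fin n → ℝ} {φ χ : Fin n → ℝ → ℝ}

/-- The squared `L²` norm of the ground state of the `i`-th edge. -/
def edgeNormSq (a b : Fin n → ℝ) (φ : Fin n → ℝ → ℝ) (i : Fin n) : ℝ :=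
  ∫ t in Icc (a i) (b i), edgeState a b φ i t ^ 2

/-- The normalized ground state of the `i`-th edge, extended by zero. -/
def edgeUnit (a b : Fin n → ℝ) (φ : Fin n → ℝ → ℝ) (i : Fin n) : ℝ → ℝ :=
  (Icc (a i) (b i)).indicator fun t => (√(edgeNormSq a b φ i))⁻¹ * edgeState a b φ i t

lemma edgeNormSq_pos (hP : ∀ i, IsRobinPair α ((b i - a i) / 2) (μ₁ i) (μ₂ i) (φ i) (χ i))
    (i : Fin n) : 0 < edgeNormSq a b φ i := by
  have hlt := edge_lt hP i
  have hc : Continuous fun t => edgeState a b φ i t ^ 2 := (contDiff_edgeState hP i).continuous.pow 2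
  rw [edgeNormSq, integral_Icc_eq_integral_Ioc, ← intervalIntegral.integral_of_le hlt.le]
  exact intervalIntegral.intervalIntegral_pos_of_pos_on (hc.intervalIntegrable _ _)
    (fun t ht => pow_pos (edgeState_pos hP (Ioo_subset_Icc_self ht)) 2) hlt

lemma bddMeas_indicator {X : Type*} [TopologicalSpace X] [MeasurableSpace X]
    [OpensMeasurableSpace X] {K : Set X} (hK : IsCompact K) (hKm : MeasurableSet K) {f : X → ℝ}
    (hf : Continuous f) : BddMeas (K.indicator f) := by
  obtain ⟨C, hC⟩ := hK.exists_bound_of_continuousOn hf.continuousOn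
  refine ⟨hf.measurable.indicator hKm, max C 0, fun x => ?_⟩
  by_cases hx : x ∈ K
  · rw [indicator_of_mem hx]; exact (hC x hx).trans (le_max_left _ _)
  · rw [indicator_of_notMem hx, abs_zero]; exact le_max_right _ _

lemma bddMeas_edgeUnit (hP : ∀ i, IsRobinPair α ((b i - a i) / 2) (μ₁ i) (μ₂ i) (φ i) (χ i))
    (i : Fin n) : BddMeas (edgeUnit a b φ i) :=
  bddMeas_indicator isCompact_Icc measurableSet_Icc
    (continuous_const.mul (contDiff_edgeState hP i).continuous)

lemma integral_edgeUnit_sq (hP : ∀ i, IsRobinPair α ((b i - a i) / 2) (μ₁ i) (μ₂ i) (φ i) (χ i))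
    (i : Fin n) : ∫ t, edgeUnit a b φ i t ^ 2 ∂(edgeMeasure a b i) = 1 := by
  have hN := edgeNormSq_pos hP i
  have : ∫ t, edgeUnit a b φ i t ^ 2 ∂(edgeMeasure a b i) =
      ∫ t in Icc (a i) (b i), (edgeNormSq a b φ i)⁻¹ * edgeState a b φ i t ^ 2 := by
    refine setIntegral_congr_fun measurableSet_Icc fun t ht => ?_
    simp only [edgeUnit, indicator_of_mem ht, mul_pow, inv_pow, Real.sq_sqrt hN.le]
  rw [this, integral_const_mul, ← edgeNormSq, inv_mul_cancel₀ hN.ne']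

end Coordinate

/-- On each line parallel to the i-th axis the fluctuation is the distance to the closest multiple
of the ground state, hence at most the distance to the multiple supplied by
`IsRobinPair.poincare_Icc`. Fubini integrates over the lines. -/
lemma coordFluct_le {α : ℝ} {a b μ₁ μ₂ : Fin (m + 1) → ℝ} {φ χ : Fin (m + 1) → ℝ → ℝ}
    (hP : ∀ i, IsRobinPair α ((b i - a i) / 2) (μ₁ i) (μ₂ i) (φ i) (χ i))
    {g : (Fin (m + 1) → ℝ) → ℝ} (hg : ContDiff ℝ 1 g) (i : Fin (m + 1)) (hgap : μ₁ i ≤ μ₂ i) :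
    (μ₂ i - μ₁ i) * ∫ x, coordFluct (edgeMeasure a b) (edgeUnit a b φ) i
        ((Icc a b).indicator g) x ^ 2 ∂(Measure.pi (edgeMeasure a b)) ≤
      ∫ x in Icc a b, (fderiv ℝ g x (Pi.single i 1) - g x * edgeLog a b φ i (x i)) ^ 2 := by
  set u := (Icc a b).indicator g with hu
  set a' := fun j => a (i.succAbove j) with ha'
  set b' := fun j => b (i.succAbove j) with hb'
  have hub : BddMeas u := bddMeas_indicator isCompact_Icc measurableSet_Icc hg.continuous
  have hfl := (bddMeas_coordFluct (edgeMeasure a b) (bddMeas_edgeUnit hP) i hub).pow_two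
  have hR : Integrable (fun x => (fderiv ℝ g x (Pi.single i 1) - g x * edgeLog a b φ i (x i)) ^ 2)
      (Measure.pi (edgeMeasure a b)) := by
    rw [pi_edgeMeasure]
    refine ContinuousOn.integrableOn_compact isCompact_Icc ((ContinuousOn.sub
      ((hg.continuous_fderiv (by simp)).clm_apply continuous_const).continuousOn
      (hg.continuous.continuousOn.mul ((continuousOn_edgeLog hP i).comp
        (continuous_apply i).continuousOn fun x hx => ⟨hx.1 i, hx.2 i⟩))).pow 2)
  rw [← pi_edgeMeasure, integral_pi_insertNth _ i (hfl.integrable _),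
    integral_pi_insertNth _ i hR, ← integral_const_mul]
  refine integral_mono_ae ((integrable_inner_insertNth _ i (hfl.integrable _)).const_mul _)
    (integrable_inner_insertNth _ i hR) ?_
  have hae : ∀ᵐ y ∂(Measure.pi fun j => edgeMeasure a b (i.succAbove j)), y ∈ Icc a' b' := by
    have : (Measure.pi fun j => edgeMeasure a b (i.succAbove j)) = volume.restrict (Icc a' b') :=
      pi_edgeMeasure a' b'
    rw [this]
    exact ae_restrict_mem measurableSet_Icc
  filter_upwards [hae] with y hy
  obtain ⟨hc, hd⟩ := contDiff_comp_insertNth hg i y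
  obtain ⟨κ, hκ⟩ := (hP i).poincare_Icc hc
  set f : ℝ → ℝ := fun s => u (i.insertNth s y) with hf
  have hfb : BddMeas f :=
    hub.comp ((measurable_insertNth i).comp (measurable_id.prodMk measurable_const))
  have hfg : ∀ s ∈ Icc (a i) (b i), f s = g (i.insertNth s y) := fun s hs => by
    simp only [hf, hu]
    exact indicator_of_mem (insertNth_mem_Icc_iff.2 ⟨hs, hy⟩) _
  have hN := Real.sqrt_pos.2 (edgeNormSq_pos hP i)
  -- The coefficient is rescaled because `edgeUnit` is normalised.
  set κ' := κ * √(edgeNormSq a b φ i) with hκ'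
  have h1 := integral_sub_mul_sq hfb (bddMeas_edgeUnit hP i) (integral_edgeUnit_sq hP i)
  have e1 : ∫ s, coordFluct (edgeMeasure a b) (edgeUnit a b φ) i u (i.insertNth s y) ^ 2
      ∂(edgeMeasure a b i) ≤ ∫ s, (f s - edgeUnit a b φ i s * κ') ^ 2 ∂(edgeMeasure a b i) := by
    simp only [coordFluct, Fin.insertNth_apply_same, Fin.update_insertNth]
    rw [h1, h1]
    nlinarith [sq_nonneg (∫ t, f t * edgeUnit a b φ i t ∂(edgeMeasure a b i) - κ')]
  have e2 : ∫ s, (f s - edgeUnit a b φ i s * κ') ^ 2 ∂(edgeMeasure a b i) =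
      ∫ s in Icc (a i) (b i), (g (i.insertNth s y) - κ * φ i (s - (a i + b i) / 2)) ^ 2 := by
    refine setIntegral_congr_fun measurableSet_Icc fun s hs => ?_
    simp only [hfg s hs, edgeUnit, indicator_of_mem hs, hκ', edgeState]
    congr 2
    field_simp
  refine (mul_le_mul_of_nonneg_left e1 (by linarith)).trans ?_
  rw [e2]
  refine hκ.trans (le_of_eq ?_)
  simp only [hd, edgeLog, Fin.insertNth_apply_same]
  rfl

/-- The ground state of a box. -/
def boxState (a b : Fin n → ℝ) (φ : Fin n → ℝ → ℝ) : EuclideanSpace ℝ (Fin n) → ℝ :=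
  prodFun (edgeState a b φ)

/-- K is the inverse squared norm of the product ground state. Only its independence of f matters,
because its term tends to zero along approximants of a function orthogonal to that state. -/
lemma poincare_smooth {α : ℝ} {a b μ₁ μ₂ : Fin (m + 1) → ℝ} {φ χ : Fin (m + 1) → ℝ → ℝ}
    (hP : ∀ i, IsRobinPair α ((b i - a i) / 2) (μ₁ i) (μ₂ i) (φ i) (χ i)) {G : ℝ} (hG : 0 ≤ G)
    (hgap : ∀ i, G ≤ μ₂ i - μ₁ i) : ∃ K : ℝ, ∀ f : EuclideanSpace ℝ (Fin (m + 1)) → ℝ,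
      ContDiff ℝ 1 f → G * ((∫ x in openBox a b, f x * f x) -
        K * (∫ x in openBox a b, f x * boxState a b φ x) ^ 2) ≤
      ∑ i, ∫ x in openBox a b, (gradient f x i - edgeLog a b φ i (x i) * f x) *
        (gradient f x i - edgeLog a b φ i (x i) * f x) := by
  refine ⟨(∏ i, (√(edgeNormSq a b φ i))⁻¹) ^ 2, fun f hf => ?_⟩
  set e := (EuclideanSpace.equiv (Fin (m + 1)) ℝ).symm
  set g : (Fin (m + 1) → ℝ) → ℝ := fun x => f (e x) with hg
  have hgc : ContDiff ℝ 1 g := hf.comp e.contDiff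
  have hgd : ∀ x i, fderiv ℝ g x (Pi.single i 1) = gradient f (e x) i := fun x i => by
    have : HasFDerivAt g ((fderiv ℝ f (e x)).comp
      (e : (Fin (m + 1) → ℝ) →L[ℝ] EuclideanSpace ℝ (Fin (m + 1)))) x :=
      ((hf.differentiable (by simp)).differentiableAt.hasFDerivAt).comp x e.hasFDerivAt
    rw [this.fderiv, gradient_apply]
    rfl
  have hub : BddMeas ((Icc a b).indicator g) :=
    bddMeas_indicator isCompact_Icc measurableSet_Icc hgc.continuous
  have ht := tensorization (edgeMeasure a b) (edgeUnit a b φ) (bddMeas_edgeUnit hP)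
    (integral_edgeUnit_sq hP) _ hub
  have hsum : ∑ i, G * ∫ x, coordFluct (edgeMeasure a b) (edgeUnit a b φ) i
      ((Icc a b).indicator g) x ^ 2 ∂(Measure.pi (edgeMeasure a b)) ≤ ∑ i, ∫ x in Icc a b,
        (fderiv ℝ g x (Pi.single i 1) - g x * edgeLog a b φ i (x i)) ^ 2 :=
    Finset.sum_le_sum fun i _ => (mul_le_mul_of_nonneg_right (hgap i)
      (integral_nonneg fun x => sq_nonneg _)).trans
      (coordFluct_le hP hgc i (by linarith [hgap i]))
  rw [← Finset.mul_sum] at hsum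
  have hfin := (mul_le_mul_of_nonneg_left ht hG).trans hsum
  have e1 : ∫ x, (Icc a b).indicator g x ^ 2 ∂(Measure.pi (edgeMeasure a b)) =
      ∫ x in openBox a b, f x * f x := by
    rw [← restrict_closedBox, setIntegral_closedBox, pi_edgeMeasure]
    refine setIntegral_congr_fun measurableSet_Icc fun x hx => ?_
    simp only [indicator_of_mem hx, hg, pow_two]
    rfl
  have e2 : ∫ x, (Icc a b).indicator g x * ∏ i, edgeUnit a b φ i (x i)
      ∂(Measure.pi (edgeMeasure a b)) = (∏ i, (√(edgeNormSq a b φ i))⁻¹) *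
        ∫ x in openBox a b, f x * boxState a b φ x := by
    rw [← restrict_closedBox, setIntegral_closedBox, pi_edgeMeasure, ← integral_const_mul]
    refine setIntegral_congr_fun measurableSet_Icc fun x hx => ?_
    have h1 : ∏ i, edgeUnit a b φ i (x i) = ∏ i, ((√(edgeNormSq a b φ i))⁻¹ *
        edgeState a b φ i (x i)) := Finset.prod_congr rfl fun i _ =>
      indicator_of_mem (show x i ∈ Icc (a i) (b i) from ⟨hx.1 i, hx.2 i⟩) _
    simp only [indicator_of_mem hx, hg, h1, Finset.prod_mul_distrib, boxState, prodFun]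
    have : e x = WithLp.toLp 2 x := rfl
    rw [this]
    ring
  have e3 : ∀ i, ∫ x in Icc a b,
      (fderiv ℝ g x (Pi.single i 1) - g x * edgeLog a b φ i (x i)) ^ 2 =
      ∫ x in openBox a b, (gradient f x i - edgeLog a b φ i (x i) * f x) *
        (gradient f x i - edgeLog a b φ i (x i) * f x) := fun i => by
    rw [← restrict_closedBox, setIntegral_closedBox]
    refine setIntegral_congr_fun measurableSet_Icc fun x _ => ?_
    have h1 : e x = WithLp.toLp 2 x := rfl
    have h2 : g x = f (WithLp.toLp 2 x) := rfl
    simp only [hgd, h1, h2]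
    ring
  rw [e1, e2] at hfin
  simp only [e3] at hfin
  rw [mul_pow] at hfin
  exact hfin

/-- Poincaré inequality for the ground state transform on a box. -/
theorem poincare_box {α : ℝ} {a b μ₁ μ₂ : Fin (m + 1) → ℝ} {φ χ : Fin (m + 1) → ℝ → ℝ}
    (hP : ∀ i, IsRobinPair α ((b i - a i) / 2) (μ₁ i) (μ₂ i) (φ i) (χ i)) {G : ℝ} (hG : 0 ≤ G)
    (hgap : ∀ i, G ≤ μ₂ i - μ₁ i) {u : L2 (openBox a b)} (hu : MemH1 (openBox a b) u)
    (ho : ∫ x in openBox a b, u x * boxState a b φ x = 0) :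
    G * (∫ x in openBox a b, u x * u x) ≤
      ∑ i, ∫ x in openBox a b, (weakGradient (openBox a b) u x i - edgeLog a b φ i (x i) * u x) *
        (weakGradient (openBox a b) u x i - edgeLog a b φ i (x i) * u x) := by
  obtain ⟨K, hK⟩ := poincare_smooth hP hG hgap
  obtain ⟨f, hf, t1, t2⟩ := exists_smooth_approx (edge_lt hP) hu
  have hstate : MemLp (boxState a b φ) 2 (volume.restrict (openBox a b)) :=
    memLp_openBox (contDiff_prodFun fun i => contDiff_edgeState hP i).continuous.continuousOn
  have t0 : L2Tendsto (volume.restrict (openBox a b)) atTop (fun _ : ℕ => boxState a b φ)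
      (boxState a b φ) := ⟨fun _ => hstate, hstate, by simp⟩
  have t3 := fun i => (t2.coord i).sub
    (t1.continuousOn_mul (continuousOn_coord_comp (continuousOn_edgeLog hP i)))
  -- The approximants need not be orthogonal to the ground state, so the projection term is kept
  -- until the limit.
  have l1 := (((t1.integral_mul t1).sub (((t1.integral_mul t0).pow 2).const_mul K)).const_mul G)
  have l2 := tendsto_finsetSum Finset.univ fun i _ => (t3 i).integral_mul (t3 i)
  have := le_of_tendsto_of_tendsto' l1 l2 fun j => hK (f j) ((hf j).of_le (by simp))
  rw [ho] at this
  simpa using this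

end Robin

end

/-! ### Ground state representation of the Robin energy -/

noncomputable section

namespace Robin

variable {n m : ℕ}

namespace IsRobinPair

variable {α L μ₁ μ₂ : ℝ} {φ χ : ℝ → ℝ}

/-- The Riccati equation of the logarithmic derivative. -/
lemma hasDerivAt_logDeriv (h : IsRobinPair α L μ₁ μ₂ φ χ) {t : ℝ} (ht : t ∈ Icc (-L) L) :
    HasDerivAt (fun s => deriv φ s / φ s) (-(μ₁ + (deriv φ t / φ t) ^ 2)) t := by
  have h0 := (h.φ_pos t ht).ne'
  refine ((h.φ_eq t).div (h.hasDerivAt_φ t) h0).congr_deriv ?_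
  field_simp
  ring

lemma logDeriv_right (h : IsRobinPair α L μ₁ μ₂ φ χ) : deriv φ L / φ L = -α := by
  have hL := h.pos
  rw [h.φ_bdry, mul_div_cancel_right₀ _ (h.φ_pos L ⟨by linarith, le_rfl⟩).ne']

lemma logDeriv_left (h : IsRobinPair α L μ₁ μ₂ φ χ) : deriv φ (-L) / φ (-L) = α := by
  rw [h.deriv_φ_neg, h.φ_even, neg_div, h.logDeriv_right, neg_neg]

lemma continuousOn_logDeriv (h : IsRobinPair α L μ₁ μ₂ φ χ) :
    ContinuousOn (fun s => deriv φ s / φ s) (Icc (-L) L) :=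
  fun _ ht => (h.hasDerivAt_logDeriv ht).continuousAt.continuousWithinAt

lemma integral_mul_eq_zero (h : IsRobinPair α L μ₁ μ₂ φ χ) : ∫ t in (-L)..L, φ t * χ t = 0 := by
  have e := intervalIntegral.integral_comp_neg (a := -L) (b := L) fun t => φ t * χ t
  simp only [h.φ_even, h.χ_odd, neg_neg, mul_neg, intervalIntegral.integral_neg] at e
  linarith

/-- The equality case of the Poincaré inequality. The difference of the integrands is the derivative
of χ(χ' − χφ'/φ), which vanishes at both ends by the Robin conditions. -/
lemma integral_excited (h : IsRobinPair α L μ₁ μ₂ φ χ) :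
    ∫ t in (-L)..L, (deriv χ t - deriv φ t / φ t * χ t) ^ 2 =
      (μ₂ - μ₁) * ∫ t in (-L)..L, χ t ^ 2 := by
  have hL := h.pos
  have hle : -L ≤ L := by linarith
  have hχ := h.χ_smooth.continuous
  have c1 : ContinuousOn (fun t => (deriv χ t - deriv φ t / φ t * χ t) ^ 2) (Icc (-L) L) :=
    (h.continuous_deriv_χ.continuousOn.sub (h.continuousOn_logDeriv.mul hχ.continuousOn)).pow 2
  have i1 : IntervalIntegrable (fun t => (deriv χ t - deriv φ t / φ t * χ t) ^ 2) volume (-L) L :=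
    (c1.mono (by rw [uIcc_of_le hle])).intervalIntegrable
  have i2 : IntervalIntegrable (fun t => (μ₂ - μ₁) * χ t ^ 2) volume (-L) L :=
    (continuous_const.mul (hχ.pow 2)).intervalIntegrable _ _
  have hd : ∀ t ∈ uIcc (-L) L, HasDerivAt
      (fun t => χ t * (deriv χ t - deriv φ t / φ t * χ t))
      ((deriv χ t - deriv φ t / φ t * χ t) ^ 2 - (μ₂ - μ₁) * χ t ^ 2) t := fun t ht => by
    rw [uIcc_of_le hle] at ht
    exact ((h.hasDerivAt_χ t).mul ((h.χ_eq t).sub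
      ((h.hasDerivAt_logDeriv ht).mul (h.hasDerivAt_χ t)))).congr_deriv (by
        simp only [Pi.sub_apply, Pi.mul_apply]; ring)
  have := intervalIntegral.integral_eq_sub_of_hasDerivAt hd (i1.sub i2)
  rw [intervalIntegral.integral_sub i1 i2, intervalIntegral.integral_const_mul] at this
  rw [h.logDeriv_right, h.logDeriv_left, h.deriv_χ_neg, h.χ_odd, h.χ_bdry] at this
  linarith

lemma integral_χ_sq_pos (h : IsRobinPair α L μ₁ μ₂ φ χ) : 0 < ∫ t in (-L)..L, χ t ^ 2 := by
  have hL := h.pos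
  have hc : Continuous fun t => χ t ^ 2 := h.χ_smooth.continuous.pow 2
  rw [← intervalIntegral.integral_add_adjacent_intervals (hc.intervalIntegrable (-L) 0)
    (hc.intervalIntegrable 0 L)]
  refine add_pos_of_nonneg_of_pos
    (intervalIntegral.integral_nonneg (by linarith) fun t _ => sq_nonneg _) ?_
  exact intervalIntegral.intervalIntegral_pos_of_pos_on (hc.intervalIntegrable _ _)
    (fun t ht => pow_pos (h.χ_pos t (Ioo_subset_Ioc_self ht)) 2) hL

lemma first_le_second (h : IsRobinPair α L μ₁ μ₂ φ χ) : μ₁ ≤ μ₂ := by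
  have hL := h.pos
  have h1 := h.integral_excited
  have h2 : 0 ≤ ∫ t in (-L)..L, (deriv χ t - deriv φ t / φ t * χ t) ^ 2 :=
    intervalIntegral.integral_nonneg (by linarith) fun t _ => sq_nonneg _
  rw [h1] at h2
  linarith [nonneg_of_mul_nonneg_left h2 h.integral_χ_sq_pos]

end IsRobinPair

section Edge

variable {α : ℝ} {a b μ₁ μ₂ : Fin n → ℝ} {φ χ : Fin n → ℝ → ℝ}

/-- The Robin condition fixes the normal component and the Riccati equation the derivative. This
field converts α ∫ u² dS into the terms that complete the squares in the energy. -/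
lemma normalField_edgeLog
    (hP : ∀ i, IsRobinPair α ((b i - a i) / 2) (μ₁ i) (μ₂ i) (φ i) (χ i)) :
    NormalField a b α (fun i t => -edgeLog a b φ i t)
      (fun i t => μ₁ i + edgeLog a b φ i t ^ 2) where
  cont i := (continuousOn_edgeLog hP i).neg
  cont' i := continuousOn_const.add ((continuousOn_edgeLog hP i).pow 2)
  hasDeriv i t ht := by
    have h1 := (hP i).hasDerivAt_logDeriv (shift_mem (Ioo_subset_Icc_self ht))
    have h2 := (h1.comp t ((hasDerivAt_id t).sub_const ((a i + b i) / 2))).neg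
    exact h2.congr_deriv (by simp [edgeLog])
  upper i := by
    have : b i - (a i + b i) / 2 = (b i - a i) / 2 := by ring
    rw [edgeLog, this, (hP i).logDeriv_right, neg_neg]
  lower i := by
    have : a i - (a i + b i) / 2 = -((b i - a i) / 2) := by ring
    rw [edgeLog, this, (hP i).logDeriv_left]

end Edge

/-- The excess of the Robin energy of `u` over its ground state value. -/
def excess (a b : Fin n → ℝ) (φ : Fin n → ℝ → ℝ) (u : EuclideanSpace ℝ (Fin n) → ℝ)
    (p : EuclideanSpace ℝ (Fin n) → EuclideanSpace ℝ (Fin n)) : ℝ :=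
  ∑ i, ∫ x in openBox a b, (p x i - edgeLog a b φ i (x i) * u x) *
    (p x i - edgeLog a b φ i (x i) * u x)

lemma excess_nonneg (a b : Fin n → ℝ) (φ : Fin n → ℝ → ℝ) (u : EuclideanSpace ℝ (Fin n) → ℝ)
    (p : EuclideanSpace ℝ (Fin n) → EuclideanSpace ℝ (Fin n)) : 0 ≤ excess a b φ u p :=
  Finset.sum_nonneg fun _ _ => integral_nonneg fun _ => mul_self_nonneg _

lemma integral_sq_eq_norm_sq {Ω : Set (EuclideanSpace ℝ (Fin n))} (u : L2 Ω) :
    ∫ x in Ω, u x ^ 2 = ‖u‖ ^ 2 := by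
  rw [← real_inner_self_eq_norm_sq, L2.inner_def]
  simp [pow_two]

lemma memLp_coord {μ : Measure (EuclideanSpace ℝ (Fin n))}
    {p : EuclideanSpace ℝ (Fin n) → EuclideanSpace ℝ (Fin n)} (hp : MemLp p 2 μ) (i : Fin n) :
    MemLp (fun x => p x i) 2 μ :=
  ((L2Tendsto.mk (l := (atTop : Filter ℕ)) (fun _ : ℕ => hp) hp (by simp)).coord i).memLp_lim

/-- The Robin energy of `u ∈ H¹` in terms of the ground state transform. -/
lemma energy_eq {α : ℝ} {a b μ₁ μ₂ : Fin (m + 1) → ℝ} {φ χ : Fin (m + 1) → ℝ → ℝ}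
    (hP : ∀ i, IsRobinPair α ((b i - a i) / 2) (μ₁ i) (μ₂ i) (φ i) (χ i))
    {u : L2 (openBox a b)} (hu : MemH1 (openBox a b) u) :
    (∫ x in openBox a b, ‖weakGradient (openBox a b) u x‖ ^ 2) +
        α * ∫ x, trace (openBox a b) u x ^ 2 ∂(surfaceMeasure (openBox a b)) =
      (∑ i, μ₁ i) * ‖u‖ ^ 2 + excess a b φ u (weakGradient (openBox a b) u) := by
  have hab := edge_lt hP
  have htr := exists_hasTrace hab hu
  have hN := normalField_edgeLog hP
  set p := weakGradient (openBox a b) u with hp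
  have hbd : α * ∫ x, trace (openBox a b) u x ^ 2 ∂(surfaceMeasure (openBox a b)) =
      boundaryForm a b (fun i t => -edgeLog a b φ i t) (fun i t => μ₁ i + edgeLog a b φ i t ^ 2)
        u p := by
    -- Existence of a trace rules out the default value 0.
    rw [trace, dif_pos htr]
    exact htr.choose_spec.boundary_eq hab hN
  have hpp : ∀ i, Integrable (fun x => p x i * p x i) (volume.restrict (openBox a b)) := fun i =>
    (memLp_coord (Lp.memLp p) i).integrable_mul (memLp_coord (Lp.memLp p) i)
  have hgrad : ∫ x in openBox a b, ‖p x‖ ^ 2 = ∑ i, ∫ x in openBox a b, p x i * p x i := by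
    rw [← integral_finsetSum _ fun i _ => hpp i]
    simp only [← pow_two, EuclideanSpace.norm_sq_eq, Real.norm_eq_abs, sq_abs]
  have husq : ∀ i : Fin (m + 1), Integrable (fun x => μ₁ i * (u x * u x))
      (volume.restrict (openBox a b)) := fun i =>
    ((Lp.memLp u).integrable_mul (Lp.memLp u)).const_mul _
  rw [hbd, hgrad, boundaryForm, excess, ← integral_sq_eq_norm_sq, Finset.sum_mul,
    ← Finset.sum_add_distrib, ← Finset.sum_add_distrib]
  refine Finset.sum_congr rfl fun i _ => ?_
  obtain ⟨i1, i2⟩ := integrable_boundaryTerm hN (Lp.memLp u) (Lp.memLp p) i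
  have i3 : Integrable (fun x => (μ₁ i + edgeLog a b φ i (x i) ^ 2) * u x * u x +
      2 * (-edgeLog a b φ i (x i) * u x * p x i)) (volume.restrict (openBox a b)) :=
    i1.add (i2.const_mul 2)
  have hq : Integrable (fun x => (p x i - edgeLog a b φ i (x i) * u x) *
      (p x i - edgeLog a b φ i (x i) * u x)) (volume.restrict (openBox a b)) :=
    (((hpp i).add i3).sub (husq i)).congr
      (Eventually.of_forall fun x => by simp only [Pi.add_apply, Pi.sub_apply]; ring)
  rw [← integral_const_mul, ← integral_const_mul, ← integral_add i1 (i2.const_mul 2),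
    ← integral_add (hpp i) i3,
    ← integral_add (by simpa only [pow_two] using husq i) hq]
  -- With q the logarithmic derivative: p² + (μ₁ + q²)u² − 2qup = μ₁u² + (p − qu)².
  exact integral_congr_ae (Eventually.of_forall fun x => by ring)

lemma rayleigh_eq {α : ℝ} {a b μ₁ μ₂ : Fin (m + 1) → ℝ} {φ χ : Fin (m + 1) → ℝ → ℝ}
    (hP : ∀ i, IsRobinPair α ((b i - a i) / 2) (μ₁ i) (μ₂ i) (φ i) (χ i))
    {u : L2 (openBox a b)} (hu : MemH1 (openBox a b) u) (h0 : u ≠ 0) :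
    rayleigh (openBox a b) α u =
      (∑ i, μ₁ i) + excess a b φ u (weakGradient (openBox a b) u) / ‖u‖ ^ 2 := by
  have : ‖u‖ ^ 2 ≠ 0 := pow_ne_zero 2 (norm_ne_zero_iff.2 h0)
  rw [rayleigh, energy_eq hP hu, integral_sq_eq_norm_sq, add_div, mul_div_cancel_right₀ _ this]

/-- A smooth function, as an element of `L²` of a box. -/
def boxL2 (a b : Fin n → ℝ) (f : EuclideanSpace ℝ (Fin n) → ℝ) (hf : ContDiff ℝ ∞ f) :
    L2 (openBox a b) := (memLp_openBox (a := a) (b := b) hf.continuous.continuousOn).toLp f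

section BoxL2

variable {a b : Fin n → ℝ} {f g : EuclideanSpace ℝ (Fin n) → ℝ}

lemma coeFn_boxL2 (hf : ContDiff ℝ ∞ f) :
    boxL2 a b f hf =ᵐ[volume.restrict (openBox a b)] f := MemLp.coeFn_toLp _

lemma inner_boxL2 (hf : ContDiff ℝ ∞ f) (u : L2 (openBox a b)) :
    inner ℝ (boxL2 a b f hf) u = ∫ x in openBox a b, u x * f x := by
  rw [L2.inner_def]
  refine integral_congr_ae ?_
  filter_upwards [coeFn_boxL2 (a := a) (b := b) hf] with x hx
  simp [hx, mul_comm]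

lemma inner_boxL2_boxL2 (hf : ContDiff ℝ ∞ f) (hg : ContDiff ℝ ∞ g) :
    inner ℝ (boxL2 a b f hf) (boxL2 a b g hg) = ∫ x in openBox a b, g x * f x := by
  rw [inner_boxL2]
  refine integral_congr_ae ?_
  filter_upwards [coeFn_boxL2 (a := a) (b := b) hg] with x hx
  rw [hx]

lemma norm_boxL2_sq (hf : ContDiff ℝ ∞ f) :
    ‖boxL2 a b f hf‖ ^ 2 = ∫ x in openBox a b, f x * f x := by
  rw [← real_inner_self_eq_norm_sq, inner_boxL2_boxL2]

lemma boxL2_weakGradient (hf : ContDiff ℝ ∞ f) : MemH1 (openBox a b) (boxL2 a b f hf) ∧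
    weakGradient (openBox a b) (boxL2 a b f hf) =ᵐ[volume.restrict (openBox a b)]
      gradient f := by
  have hg : MemLp (gradient f) 2 (volume.restrict (openBox a b)) :=
    memLp_openBox (continuous_gradient (hf.of_le (by simp))).continuousOn
  have hw : HasWeakGradient (openBox a b) (boxL2 a b f hf) (hg.toLp _) :=
    hasWeakGradient_of_smooth hf (coeFn_boxL2 hf) hg.coeFn_toLp
  exact ⟨⟨_, hw⟩, by rw [hw.weakGradient_eq]; exact hg.coeFn_toLp⟩

lemma excess_boxL2 (φ : Fin n → ℝ → ℝ) (hf : ContDiff ℝ ∞ f) :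
    excess a b φ (boxL2 a b f hf) (weakGradient (openBox a b) (boxL2 a b f hf)) =
      excess a b φ f (gradient f) := by
  refine Finset.sum_congr rfl fun i _ => integral_congr_ae ?_
  filter_upwards [coeFn_boxL2 (a := a) (b := b) hf, (boxL2_weakGradient (a := a) (b := b) hf).2]
    with x h1 h2
  rw [h1, h2]

lemma smul_boxL2_add (hf : ContDiff ℝ ∞ f) (hg : ContDiff ℝ ∞ g) (c d : ℝ) :
    c • boxL2 a b f hf + d • boxL2 a b g hg =
      boxL2 a b (fun x => c * f x + d * g x) ((contDiff_const.mul hf).add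
        (contDiff_const.mul hg)) := by
  ext1
  filter_upwards [Lp.coeFn_add (c • boxL2 a b f hf) (d • boxL2 a b g hg),
    Lp.coeFn_smul c (boxL2 a b f hf), Lp.coeFn_smul d (boxL2 a b g hg), coeFn_boxL2 hf,
    coeFn_boxL2 hg, coeFn_boxL2 (a := a) (b := b) ((contDiff_const.mul hf).add
        (contDiff_const.mul hg) : ContDiff ℝ ∞ fun x => c * f x + d * g x)] with x h1 h2 h3 h4 h5 h6
  rw [h1, h6, Pi.add_apply, h2, h3, Pi.smul_apply, Pi.smul_apply, h4, h5]
  rfl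

end BoxL2

/-! ### Product states of a box -/

lemma setIntegral_prodFun (a b : Fin n → ℝ) (w : Fin n → ℝ → ℝ) :
    ∫ x in openBox a b, prodFun w x = ∏ i, ∫ t in Icc (a i) (b i), w i t := by
  rw [← restrict_closedBox, setIntegral_closedBox, ← pi_edgeMeasure]
  exact integral_fintype_prod_eq_prod (μ := edgeMeasure a b) w

lemma setIntegral_prodFun_update (a b : Fin n → ℝ) (w : Fin n → ℝ → ℝ) (i : Fin n) (k : ℝ → ℝ) :
    ∫ x in openBox a b, prodFun (Function.update w i k) x =
      (∫ t in Icc (a i) (b i), k t) *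
        ∏ j ∈ Finset.univ.erase i, ∫ t in Icc (a j) (b j), w j t := by
  rw [setIntegral_prodFun, ← Finset.mul_prod_erase _ _ (Finset.mem_univ i), Function.update_self]
  congr 1
  refine Finset.prod_congr rfl fun j hj => ?_
  rw [Function.update_of_ne (Finset.ne_of_mem_erase hj)]

lemma prodFun_update_mul (w : Fin n → ℝ → ℝ) (i : Fin n) (k l : ℝ → ℝ)
    (x : EuclideanSpace ℝ (Fin n)) :
    prodFun (Function.update w i k) x * prodFun (Function.update w i l) x =
      prodFun (Function.update (fun j t => w j t * w j t) i fun t => k t * l t) x := by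
  simp only [prodFun_update_apply, Finset.prod_mul_distrib]
  ring

/-- The excited state of a box that is excited along the `i`-th edge. -/
def boxExcited (a b : Fin n → ℝ) (φ χ : Fin n → ℝ → ℝ) (i : Fin n) :
    EuclideanSpace ℝ (Fin n) → ℝ :=
  prodFun (Function.update (edgeState a b φ) i (edgeState a b χ i))

section States

variable {α : ℝ} {a b μ₁ μ₂ : Fin n → ℝ} {φ χ : Fin n → ℝ → ℝ}

lemma contDiff_edgeExcited
    (hP : ∀ i, IsRobinPair α ((b i - a i) / 2) (μ₁ i) (μ₂ i) (φ i) (χ i)) (i : Fin n) :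
    ContDiff ℝ ∞ (edgeState a b χ i) :=
  (hP i).χ_smooth.comp (by fun_prop)

lemma contDiff_boxState (hP : ∀ i, IsRobinPair α ((b i - a i) / 2) (μ₁ i) (μ₂ i) (φ i) (χ i)) :
    ContDiff ℝ ∞ (boxState a b φ) := contDiff_prodFun (contDiff_edgeState hP)

lemma contDiff_update (hP : ∀ i, IsRobinPair α ((b i - a i) / 2) (μ₁ i) (μ₂ i) (φ i) (χ i))
    (i j : Fin n) :
    ContDiff ℝ ∞ (Function.update (edgeState a b φ) i (edgeState a b χ i) j) := by
  rcases eq_or_ne j i with rfl | hj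
  · rw [Function.update_self]; exact contDiff_edgeExcited hP j
  · rw [Function.update_of_ne hj]; exact contDiff_edgeState hP j

lemma contDiff_boxExcited (hP : ∀ i, IsRobinPair α ((b i - a i) / 2) (μ₁ i) (μ₂ i) (φ i) (χ i))
    (i : Fin n) : ContDiff ℝ ∞ (boxExcited a b φ χ i) := contDiff_prodFun (contDiff_update hP i)

lemma deriv_edgeState (a b : Fin n → ℝ) (φ : Fin n → ℝ → ℝ) (i : Fin n) (t : ℝ) :
    deriv (edgeState a b φ i) t = deriv (φ i) (t - (a i + b i) / 2) :=
  deriv_comp_sub_const _ _ _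

lemma deriv_edgeState_eq (hP : ∀ i, IsRobinPair α ((b i - a i) / 2) (μ₁ i) (μ₂ i) (φ i) (χ i))
    {i : Fin n} {t : ℝ} (ht : t ∈ Icc (a i) (b i)) :
    deriv (edgeState a b φ i) t = edgeLog a b φ i t * edgeState a b φ i t := by
  rw [deriv_edgeState, edgeLog]
  exact (div_mul_cancel₀ _ (edgeState_pos hP ht).ne').symm

lemma gradient_boxState (hP : ∀ i, IsRobinPair α ((b i - a i) / 2) (μ₁ i) (μ₂ i) (φ i) (χ i))
    {x : EuclideanSpace ℝ (Fin n)} (hx : x ∈ openBox a b) (j : Fin n) :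
    gradient (boxState a b φ) x j = edgeLog a b φ j (x j) * boxState a b φ x := by
  rw [gradient_apply, boxState,
    fderiv_prodFun fun j => (contDiff_edgeState hP j).differentiable (by simp),
    prodFun_update_apply, prodFun_eq_mul _ j, deriv_edgeState_eq hP (Ioo_subset_Icc_self (hx j)),
    mul_assoc]

lemma gradient_boxExcited_of_ne
    (hP : ∀ i, IsRobinPair α ((b i - a i) / 2) (μ₁ i) (μ₂ i) (φ i) (χ i))
    {x : EuclideanSpace ℝ (Fin n)} (hx : x ∈ openBox a b) {i j : Fin n} (hj : j ≠ i) :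
    gradient (boxExcited a b φ χ i) x j =
      edgeLog a b φ j (x j) * boxExcited a b φ χ i x := by
  rw [gradient_apply, boxExcited,
    fderiv_prodFun fun j => (contDiff_update hP i j).differentiable (by simp),
    prodFun_update_apply, prodFun_eq_mul _ j, Function.update_of_ne hj,
    deriv_edgeState_eq hP (Ioo_subset_Icc_self (hx j)), mul_assoc]

lemma gradient_boxExcited_self
    (hP : ∀ i, IsRobinPair α ((b i - a i) / 2) (μ₁ i) (μ₂ i) (φ i) (χ i))
    (x : EuclideanSpace ℝ (Fin n)) (i : Fin n) :
    gradient (boxExcited a b φ χ i) x i - edgeLog a b φ i (x i) * boxExcited a b φ χ i x =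
      prodFun (Function.update (edgeState a b φ) i fun t =>
        deriv (edgeState a b χ i) t - edgeLog a b φ i t * edgeState a b χ i t) x := by
  rw [gradient_apply, boxExcited,
    fderiv_prodFun fun j => (contDiff_update hP i j).differentiable (by simp),
    Function.update_self, Function.update_idem]
  simp only [prodFun_update_apply]
  ring

lemma integral_state_mul_excited
    (hP : ∀ i, IsRobinPair α ((b i - a i) / 2) (μ₁ i) (μ₂ i) (φ i) (χ i)) (i : Fin n) :
    ∫ x in openBox a b, boxExcited a b φ χ i x * boxState a b φ x = 0 := by
  have h : ∀ x, boxExcited a b φ χ i x * boxState a b φ x =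
      prodFun (Function.update (fun j t => edgeState a b φ j t * edgeState a b φ j t) i fun t =>
        edgeState a b χ i t * edgeState a b φ i t) x := fun x => by
    rw [← prodFun_update_mul, Function.update_eq_self]; rfl
  simp only [h, setIntegral_prodFun_update]
  have e := setIntegral_Icc_shift (a i) (b i) (edge_lt hP i).le fun t => χ i t * φ i t
  have := (hP i).integral_mul_eq_zero
  simp only [mul_comm (φ i _)] at this
  rw [this] at e
  exact mul_eq_zero_of_left e _

lemma integral_excited_sq
    (hP : ∀ i, IsRobinPair α ((b i - a i) / 2) (μ₁ i) (μ₂ i) (φ i) (χ i)) (i : Fin n) :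
    ∫ x in openBox a b, (gradient (boxExcited a b φ χ i) x i -
        edgeLog a b φ i (x i) * boxExcited a b φ χ i x) *
      (gradient (boxExcited a b φ χ i) x i - edgeLog a b φ i (x i) * boxExcited a b φ χ i x) =
    (μ₂ i - μ₁ i) * ∫ x in openBox a b, boxExcited a b φ χ i x * boxExcited a b φ χ i x := by
  simp only [gradient_boxExcited_self hP]
  simp only [boxExcited, prodFun_update_mul, setIntegral_prodFun_update]
  rw [← mul_assoc]
  congr 1
  have e1 := setIntegral_Icc_shift (a i) (b i) (edge_lt hP i).le fun t => χ i t ^ 2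
  have e2 := setIntegral_Icc_shift (a i) (b i) (edge_lt hP i).le fun t =>
    (deriv (χ i) t - deriv (φ i) t / φ i t * χ i t) ^ 2
  rw [(hP i).integral_excited, ← e1] at e2
  simpa only [deriv_edgeState, edgeState, edgeLog, pow_two] using e2

lemma boxState_ne_zero (hP : ∀ i, IsRobinPair α ((b i - a i) / 2) (μ₁ i) (μ₂ i) (φ i) (χ i)) :
    boxL2 a b _ (contDiff_boxState hP) ≠ 0 := by
  rw [← norm_ne_zero_iff, ← pow_ne_zero_iff two_ne_zero, norm_boxL2_sq]
  have h : ∀ x, boxState a b φ x * boxState a b φ x =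
      prodFun (fun j t => edgeState a b φ j t ^ 2) x := fun x => by
    simp only [boxState, prodFun, ← Finset.prod_mul_distrib, pow_two]
  simp only [h, setIntegral_prodFun]
  exact Finset.prod_ne_zero_iff.2 fun i _ => (edgeNormSq_pos hP i).ne'

lemma boxExcited_ne_zero (hP : ∀ i, IsRobinPair α ((b i - a i) / 2) (μ₁ i) (μ₂ i) (φ i) (χ i))
    (i : Fin n) : boxL2 a b _ (contDiff_boxExcited hP i) ≠ 0 := by
  rw [← norm_ne_zero_iff, ← pow_ne_zero_iff two_ne_zero, norm_boxL2_sq]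
  simp only [boxExcited, prodFun_update_mul, setIntegral_prodFun_update]
  refine mul_ne_zero ?_ (Finset.prod_ne_zero_iff.2 fun j _ => ?_)
  · have e := setIntegral_Icc_shift (a i) (b i) (edge_lt hP i).le fun t => χ i t ^ 2
    simp only [pow_two] at e
    have := (hP i).integral_χ_sq_pos
    simp only [pow_two, ← e] at this
    exact this.ne'
  · simpa only [edgeNormSq, pow_two] using (edgeNormSq_pos hP j).ne'

/-- The product ground state satisfies ∂ⱼw = qⱼw for every j, and the excited state does so for j ≠
i. Only the i-th term survives, and only its excited part. -/
lemma excess_combination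
    (hP : ∀ i, IsRobinPair α ((b i - a i) / 2) (μ₁ i) (μ₂ i) (φ i) (χ i)) (i : Fin n) (c d : ℝ) :
    excess a b φ (fun x => c * boxState a b φ x + d * boxExcited a b φ χ i x)
        (gradient fun x => c * boxState a b φ x + d * boxExcited a b φ χ i x) =
      d ^ 2 * ((μ₂ i - μ₁ i) * ‖boxL2 a b _ (contDiff_boxExcited hP i)‖ ^ 2) := by
  have h1 := (contDiff_boxState hP).differentiable (by simp)
  have h2 := (contDiff_boxExcited hP i).differentiable (by simp)
  have hg : ∀ x j, gradient (fun x => c * boxState a b φ x + d * boxExcited a b φ χ i x) x j =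
      c * gradient (boxState a b φ) x j + d * gradient (boxExcited a b φ χ i) x j := fun x j => by
    simp only [gradient_apply]
    rw [fderiv_fun_add ((h1 x).const_mul c) ((h2 x).const_mul d), fderiv_const_mul (h1 x),
      fderiv_const_mul (h2 x)]
    rfl
  have hmem : MeasurableSet (openBox a b) := (isOpen_openBox a b).measurableSet
  rw [excess, Finset.sum_eq_single i]
  · rw [norm_boxL2_sq, ← integral_excited_sq hP, ← integral_const_mul]
    refine setIntegral_congr_fun hmem fun x hx => ?_
    simp only [hg, gradient_boxState hP hx]
    ring
  · intro j _ hj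
    refine (setIntegral_congr_fun hmem (g := fun _ => 0) fun x hx => ?_).trans (by simp)
    simp only [hg, gradient_boxState hP hx, gradient_boxExcited_of_ne hP hx hj]
    ring
  · simp

end States

/-! ### Minimax values of a box and the comparison of gaps -/

section Minimax

variable {α : ℝ} {a b μ₁ μ₂ : Fin (m + 1) → ℝ} {φ χ : Fin (m + 1) → ℝ → ℝ}

lemma rayleigh_combination
    (hP : ∀ i, IsRobinPair α ((b i - a i) / 2) (μ₁ i) (μ₂ i) (φ i) (χ i)) (i : Fin (m + 1))
    (c d : ℝ) {u : L2 (openBox a b)} (hu : u = c • boxL2 a b _ (contDiff_boxState hP) +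
      d • boxL2 a b _ (contDiff_boxExcited hP i)) (h0 : u ≠ 0) :
    MemH1 (openBox a b) u ∧ rayleigh (openBox a b) α u = (∑ j, μ₁ j) + (μ₂ i - μ₁ i) *
      ((d ^ 2 * ‖boxL2 a b _ (contDiff_boxExcited hP i)‖ ^ 2) /
        (c ^ 2 * ‖boxL2 a b _ (contDiff_boxState hP)‖ ^ 2 +
          d ^ 2 * ‖boxL2 a b _ (contDiff_boxExcited hP i)‖ ^ 2)) := by
  have hn : ‖u‖ ^ 2 = c ^ 2 * ‖boxL2 a b _ (contDiff_boxState hP)‖ ^ 2 +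
      d ^ 2 * ‖boxL2 a b _ (contDiff_boxExcited hP i)‖ ^ 2 := by
    rw [hu, norm_add_sq_real, inner_smul_left, inner_smul_right, inner_boxL2_boxL2,
      integral_state_mul_excited hP, norm_smul, norm_smul, mul_pow, mul_pow]
    simp
  have hm := hu.trans (smul_boxL2_add _ _ c d)
  have h1 : MemH1 (openBox a b) u := hm ▸ (boxL2_weakGradient _).1
  refine ⟨h1, ?_⟩
  rw [rayleigh_eq hP h1 h0, hn]
  congr 1
  rw [hm, excess_boxL2, excess_combination hP]
  ring

/-- The excess is nonnegative and vanishes on the line spanned by the product ground state. -/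
theorem isLeast_first (hP : ∀ i, IsRobinPair α ((b i - a i) / 2) (μ₁ i) (μ₂ i) (φ i) (χ i)) :
    IsLeast (minimaxValues (openBox a b) α 1) (∑ i, μ₁ i) := by
  set Φ := boxL2 a b _ (contDiff_boxState hP) with hΦ
  have hΦ0 : Φ ≠ 0 := boxState_ne_zero hP
  have hR : ∀ u ∈ ℝ ∙ Φ, MemH1 (openBox a b) u ∧
      (u ≠ 0 → rayleigh (openBox a b) α u = ∑ i, μ₁ i) := fun u hu => by
    obtain ⟨c, rfl⟩ := Submodule.mem_span_singleton.1 hu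
    have he : c • Φ = c • Φ + (0 : ℝ) • boxL2 a b _ (contDiff_boxExcited hP 0) := by simp
    refine ⟨?_, fun h0 => by simpa using (rayleigh_combination hP 0 c 0 he h0).2⟩
    rw [he, smul_boxL2_add]
    exact (boxL2_weakGradient _).1
  constructor
  · refine ⟨ℝ ∙ Φ, fun u hu => (hR u hu).1, finrank_span_singleton hΦ0, ?_, ?_⟩
    · have hm := Submodule.mem_span_singleton_self (R := ℝ) Φ
      exact ⟨Φ, ⟨hm, hΦ0⟩, (hR Φ hm).2 hΦ0⟩
    · rintro _ ⟨u, ⟨hu, h0⟩, rfl⟩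
      exact ((hR u hu).2 h0).le
  · rintro r ⟨U, hU, hf, hr⟩
    have : U ≠ ⊥ := by rintro rfl; simp at hf
    obtain ⟨u, hu, h0⟩ := U.ne_bot_iff.1 this
    refine le_trans ?_ (hr.2 ⟨u, ⟨hu, h0⟩, rfl⟩)
    rw [rayleigh_eq hP (hU u hu) h0]
    have := div_nonneg (excess_nonneg a b φ u (weakGradient (openBox a b) u)) (sq_nonneg ‖u‖)
    linarith

/-- The span of the ground state and the state excited along the edge of smallest gap attains the
value. Conversely, every two-dimensional subspace contains a nonzero vector orthogonal to the ground
state, to which `poincare_box` applies. -/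
theorem isLeast_second (hP : ∀ i, IsRobinPair α ((b i - a i) / 2) (μ₁ i) (μ₂ i) (φ i) (χ i))
    {i : Fin (m + 1)} (hi : ∀ j, μ₂ i - μ₁ i ≤ μ₂ j - μ₁ j) :
    IsLeast (minimaxValues (openBox a b) α 2) ((∑ j, μ₁ j) + (μ₂ i - μ₁ i)) := by
  set Φ := boxL2 a b _ (contDiff_boxState hP) with hΦ
  set Ψ := boxL2 a b _ (contDiff_boxExcited hP i) with hΨ
  have hΦ0 : 0 < ‖Φ‖ := norm_pos_iff.2 (boxState_ne_zero hP)
  have hΨ0 : 0 < ‖Ψ‖ := norm_pos_iff.2 (boxExcited_ne_zero hP i)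
  have hG : 0 ≤ μ₂ i - μ₁ i := sub_nonneg.2 (hP i).first_le_second
  have horth : inner ℝ Φ Ψ = 0 := by
    rw [hΦ, hΨ, inner_boxL2_boxL2, integral_state_mul_excited hP]
  constructor
  · refine ⟨Submodule.span ℝ {Φ, Ψ}, fun u hu => ?_, ?_, ?_, ?_⟩
    · obtain ⟨c, d, rfl⟩ := Submodule.mem_span_pair.1 hu
      rw [smul_boxL2_add]
      exact (boxL2_weakGradient _).1
    · have hli : LinearIndependent ℝ ![Φ, Ψ] := by
        rw [LinearIndependent.pair_iff]
        intro s t hst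
        have h1 : inner ℝ Φ (s • Φ + t • Ψ) = 0 := by rw [hst, inner_zero_right]
        have h2 : inner ℝ Ψ (s • Φ + t • Ψ) = 0 := by rw [hst, inner_zero_right]
        rw [inner_add_right, inner_smul_right, inner_smul_right, horth,
          real_inner_self_eq_norm_sq] at h1
        rw [inner_add_right, inner_smul_right, inner_smul_right, real_inner_comm, horth,
          real_inner_self_eq_norm_sq] at h2
        simpa [hΦ0.ne', hΨ0.ne'] using And.intro h1 h2
      have := finrank_span_eq_card hli
      rw [Matrix.range_cons_cons_empty] at this
      simpa using this
    · refine ⟨Ψ, ⟨Submodule.subset_span (by simp), norm_pos_iff.1 hΨ0⟩, ?_⟩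
      have := (rayleigh_combination hP i 0 1 (u := Ψ) (by simp [hΨ]) (norm_pos_iff.1 hΨ0)).2
      rw [this, ← hΨ, ← hΦ]
      have : ‖Ψ‖ ^ 2 ≠ 0 := by positivity
      simp [this]
    · rintro _ ⟨u, ⟨hu, h0⟩, rfl⟩
      obtain ⟨c, d, rfl⟩ := Submodule.mem_span_pair.1 hu
      rw [(rayleigh_combination hP i c d rfl h0).2]
      have : d ^ 2 * ‖Ψ‖ ^ 2 / (c ^ 2 * ‖Φ‖ ^ 2 + d ^ 2 * ‖Ψ‖ ^ 2) ≤ 1 :=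
        div_le_one_of_le₀ (le_add_of_nonneg_left (by positivity)) (by positivity)
      have := mul_le_mul_of_nonneg_left this hG
      rw [← hΨ, ← hΦ]
      linarith
  · rintro r ⟨U, hU, hf, hr⟩
    have : FiniteDimensional ℝ U := Module.finite_of_finrank_pos (by omega)
    -- The functional ⟨Φ, ·⟩ maps a two-dimensional space to ℝ, so it has a nontrivial kernel.
    have hker := LinearMap.ker_ne_bot_of_finrank_lt
      (f := (innerSL ℝ Φ).toLinearMap.comp U.subtype) (by rw [hf]; simp)
    obtain ⟨⟨u, hu⟩, huk, h0⟩ := (Submodule.ne_bot_iff _).1 hker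
    have h0 : u ≠ 0 := fun h => h0 (by simpa using h)
    have ho : inner ℝ Φ u = 0 := by simpa using huk
    rw [hΦ, inner_boxL2] at ho
    refine le_trans ?_ (hr.2 ⟨u, ⟨hu, h0⟩, rfl⟩)
    rw [rayleigh_eq hP (hU u hu) h0]
    have hp := poincare_box hP hG hi (hU u hu) ho
    have hn : 0 < ‖u‖ ^ 2 := pow_pos (norm_pos_iff.2 h0) 2
    have e := integral_sq_eq_norm_sq u
    simp only [pow_two (u _)] at e
    rw [e] at hp
    have := (le_div_iff₀ hn).2 hp
    rw [excess]
    linarith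

end Minimax

/-- The first two Robin eigenvalues of a box are attained, and their gap is the smallest among the
gaps of the edges. -/
theorem box_spectrum (α : ℝ) {a b : Fin (m + 1) → ℝ} (hab : ∀ i, a i < b i) :
    (∀ k : ℕ, k = 1 ∨ k = 2 →
      IsLeast (minimaxValues (openBox a b) α k) (robinEigenvalue (openBox a b) α k)) ∧
    ∃ i μ₁ μ₂ φ χ, IsRobinPair α ((b i - a i) / 2) μ₁ μ₂ φ χ ∧
      robinEigenvalue (openBox a b) α 2 - robinEigenvalue (openBox a b) α 1 = μ₂ - μ₁ := by
  choose μ₁ μ₂ φ χ hP using fun i => exists_robinPair α (L := (b i - a i) / 2)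
    (by linarith [hab i])
  obtain ⟨i, hi⟩ := Finite.exists_min fun i => μ₂ i - μ₁ i
  have h1 := isLeast_first hP
  have h2 := isLeast_second hP hi
  have e1 : robinEigenvalue (openBox a b) α 1 = _ := h1.csInf_eq
  have e2 : robinEigenvalue (openBox a b) α 2 = _ := h2.csInf_eq
  refine ⟨?_, i, μ₁ i, μ₂ i, φ i, χ i, hP i, by rw [e1, e2]; ring⟩
  rintro k (rfl | rfl)
  · rwa [e1]
  · rwa [e2]

/-- The diagonal from a to b contains a second edge of positive length, hence strictness. Its ends
lie in the closure of the box, which has the same diameter. -/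
lemma edge_lt_diam (hn : 2 ≤ n) {a b : Fin n → ℝ} (hab : ∀ i, a i < b i) (i : Fin n) :
    b i - a i < Metric.diam (openBox a b) := by
  have hmem : ∀ c : Fin n → ℝ, (∀ j, c j ∈ Icc (a j) (b j)) → WithLp.toLp 2 c ∈ closedBox a b :=
    fun c hc => hc
  have h1 := Metric.dist_le_diam_of_mem (isCompact_closedBox a b).isBounded
    (hmem b fun j => right_mem_Icc.2 (hab j).le) (hmem a fun j => left_mem_Icc.2 (hab j).le)
  rw [← closure_openBox hab, Metric.diam_closure] at h1
  refine lt_of_lt_of_le ?_ h1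
  rw [EuclideanSpace.dist_eq]
  refine Real.lt_sqrt_of_sq_lt ?_
  obtain ⟨j, hj⟩ : ∃ j, j ≠ i := by
    have : Nontrivial (Fin n) := Fin.nontrivial_iff_two_le.2 hn
    exact exists_ne i
  have h2 : ∀ k, dist (b k) (a k) ^ 2 = (b k - a k) ^ 2 := fun k => by
    rw [Real.dist_eq, sq_abs]
  simp only [h2]
  rw [← Finset.add_sum_erase _ _ (Finset.mem_univ i)]
  have h3 := Finset.single_le_sum (f := fun k => (b k - a k) ^ 2) (fun k _ => sq_nonneg _)
    (Finset.mem_erase.2 ⟨hj, Finset.mem_univ j⟩)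
  have h4 : 0 < (b j - a j) ^ 2 := pow_pos (sub_pos.2 (hab j)) 2
  linarith

end Robin

end

theorem mainTheorem3 (α : ℝ) (n : ℕ) (hn : 2 ≤ n) (a b : Fin n → ℝ) (hab : ∀ i, a i < b i)
    (D : ℝ) (hD : Metric.diam (Robin.openBox a b) = D) :
    (∀ k : ℕ, k = 1 ∨ k = 2 →
      IsLeast (Robin.minimaxValues (Robin.openBox a b) α k)
        (Robin.robinEigenvalue (Robin.openBox a b) α k) ∧
      IsLeast (Robin.minimaxValues (Robin.lineSegment D) α k)
        (Robin.robinEigenvalue (Robin.lineSegment D) α k)) ∧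
    Robin.robinEigenvalue (Robin.openBox a b) α 2 - Robin.robinEigenvalue (Robin.openBox a b) α 1 >
      Robin.robinEigenvalue (Robin.lineSegment D) α 2 -
        Robin.robinEigenvalue (Robin.lineSegment D) α 1 := by
  obtain ⟨m, rfl⟩ : ∃ m, n = m + 1 := ⟨n - 1, by omega⟩
  have hlt := fun i => hD ▸ Robin.edge_lt_diam hn hab i
  have hD0 : 0 < D := by linarith [hlt 0, hab 0]
  obtain ⟨h1, i, μ₁, μ₂, φ, χ, hP, e1⟩ := Robin.box_spectrum α hab
  -- The interval (0, D) is itself a box with a single edge.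
  obtain ⟨h2, j, ν₁, ν₂, ψ, θ, hQ, e2⟩ := Robin.box_spectrum (m := 0) α
    (a := fun _ => 0) (b := fun _ => D) fun _ => hD0
  refine ⟨fun k hk => ⟨h1 k hk, h2 k hk⟩, ?_⟩
  unfold Robin.lineSegment
  rw [e1, e2]
  exact hP.gap_lt hQ (by linarith [hlt i])
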